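/- **Lemma.** There is an absolute constant $C>0$ such that the following holds. Let $0<\gamma<\delta<1$ and let $d,\ell,n:\mathbb N\to\mathbb N$ satisfy $d(\lambda)\le\lambda^{\gamma}+1$ for all $\lambda$ (in particular $d(\lambda)$ may be $\lambda^\gamma$ rounded up or down) and $\frac{n(\lambda)}2-d(\lambda)=\omega(\log\lambda)$. Let $\nu$ be a negligible function, let $F_1:\{0,1\}^{\lambda}\times\{0,1\}^{d(\lambda)}\to\{0,1\}^{\ell(\lambda)}$ be a quantum-query $\nu(\lambda)$-secure pseudorandom function, and let $F_2:\{0,1\}^{\ell(\lambda)}\times\{0,1\}^{n(\lambda)}\to\{0,1\}$ (key in the first argument) be a quantum-query $2^{-\lambda^{\delta}}$-secure pseudorandom function. Let $G$ be the following procedure, run with a key $k\in\{0,1\}^\lambda$ on a $d(\lambda)$-qubit register $\mathbf X$: add registers $\mathbf K,\mathbf Y,\mathbf{Anc}$ of $\ell(\lambda)$, $n(\lambda)$ and $1$ qubits in state $|0\rangle_{\mathbf K}|0\rangle_{\mathbf Y}|-\rangle_{\mathbf{Anc}}$; apply $V:|a\rangle_{\mathbf X}|b\rangle_{\mathbf K}\mapsto|a\rangle|F_1(k,a)\oplus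 b\rangle$; apply $H^{\otimes n(\lambda)}$ to $\mathbf Y$; apply $|a\rangle_{\mathbf K}|b\rangle_{\mathbf Y}|c\rangle_{\mathbf{Anc}}\mapsto|a\rangle|b\rangle|c\oplus F_2(a,b)\rangle$; apply $V$ again; trace out $\mathbf K$ and $\mathbf{Anc}$; output $\mathbf X$ and $\mathbf Y$. (So $|x\rangle\mapsto|x\rangle\otimes 2^{-n(\lambda)/2}\sum_y(-1)^{F_2(F_1(k,x),y)}|y\rangle$.) Then: 1. $G$ is a $(d(\lambda),n(\lambda))$ quantum-accessible adaptively secure pseudorandom function-like state generator: it is controlled on the content of $\mathbf X$, it is implemented exactly by polynomial-size generalized quantum circuits, and for every non-uniform QPT adversary $A$ there is a negligible $\varepsilon$ such that for all $\lambda$ $$\Big|\Pr_{k\leftarrow\{0,1\}^\lambda}\big[A_\lambda^{|G(k,\cdot)\rangle}=1\big]-\Pr_{\mathrm{Haar}}\big[A_\lambda^{|\mathcal O_{\mathrm{Haar}}\rangle}=1\big]\Big|\le\varepsilon(\lambda),$$ where $\mathcal O_{\mathrm{Haar}}$ maps $|x\rangle\mapsto|x\rangle|\vartheta_x\rangle$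 for independent Haar random $n(\lambda)$-qubit states $(\vartheta_x)_{x\in\{0,1\}^{d(\lambda)}}$. 2. For every non-uniform QPT adversary $A$ and all sufficiently large $\lambda$, the left-hand side is at most $$\nu(\lambda)+\frac{2^{d(\lambda)}}{2^{\lambda^\delta}}+C\cdot\frac{q(\lambda)\,2^{d(\lambda)}}{2^{n(\lambda)/2}},$$ where $q(\lambda)$ is the number of queries made by $A_\lambda$. *Conventions.* Quantum circuits are over the gate set $\{\mathrm{CNOT},H,T\}$. A non-uniform QPT adversary is a family of polynomial-size circuits with oracle gates (each query is one gate and may be made in superposition), together with a density matrix of polynomially many qubits as advice for each $\lambda$; it outputs the result of measuring one qubit. A query to a state oracle returns the query register together with a fresh $n(\lambda)$-qubit register, on which $A$ may act from then on. A function family $F$ with key length $\kappa$, input length $a$ and output length $b$ is a quantum-query $\varepsilon(\lambda)$-secure pseudorandom function if it is computed by Boolean circuits of polynomial size (in particular, if it is computable in deterministic polynomial time) and, for every non-uniform QPT adversary $A$, for all sufficiently large $\lambda$, $\big|\Pr_{k}[A_\lambda^{|F(k,\cdot)\rangle}=1]-\Pr_{f}[A_\lambda^{|f\rangle}=1]\big|\le\varepsilon(\lambda)$,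 where $k\leftarrow\{0,1\}^{\kappa(\lambda)}$ and $f:\{0,1\}^{a(\lambda)}\to\{0,1\}^{b(\lambda)}$ are uniform and a function $f$ is queried through the unitary $|x\rangle|y\rangle\mapsto|x\rangle|y\oplus f(x)\rangle$. -/

import Mathlib

open Filter MeasureTheory
open scoped BigOperators Matrix ComplexOrder

namespace QAPRFS

noncomputable section

/-- Bit strings of length `n`; they index the computational basis of `n` qubits. -/
abbrev Bits (n : ℕ) : Type := Fin n → Bool

/-- The first `a` bits of an `(a + b)`-bit string. -/
def fstBits {a b : ℕ} (w : Bits (a + b)) : Bits a := fun i => w (Fin.castAdd b i)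

/-- The last `b` bits of an `(a + b)`-bit string. -/
def sndBits {a b : ℕ} (w : Bits (a + b)) : Bits b := fun i => w (Fin.natAdd a i)

/-- Bitwise exclusive or. -/
def xorBits {n : ℕ} (u v : Bits n) : Bits n := fun i => xor (u i) (v i)

/-- The all-zero string. -/
def zeroBits (n : ℕ) : Bits n := fun _ => false

/-- Operators (in particular density matrices) on `n` qubits. -/
abbrev Op (n : ℕ) : Type := Matrix (Bits n) (Bits n) ℂ

/-- The projector `|x⟩⟨x|`. -/
def ketbra {n : ℕ} (x : Bits n) : Op n := Matrix.single x x 1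

/-- The tensor product `ρ ⊗ σ`, the first factor acting on the first `a` qubits. -/
def tensor {a b : ℕ} (ρ : Op a) (σ : Op b) : Op (a + b) :=
  Matrix.of fun u v => ρ (fstBits u) (fstBits v) * σ (sndBits u) (sndBits v)

/-- Two strings agree on all positions outside a set. -/
def AgreeOff {N : ℕ} (S : Set (Fin N)) (u v : Bits N) : Prop := ∀ i, i ∉ S → u i = v i

/-- The reduced operator on the qubits `e 0, …, e (m - 1)`; all other qubits are traced out. -/
def reduce {N m : ℕ} (e : Fin m ↪ Fin N) (M : Op N) : Op m :=
  open Classical in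
  Matrix.of fun u v => ∑ w : Bits N, ∑ w' : Bits N,
    if w ∘ e = u ∧ w' ∘ e = v ∧ AgreeOff (Set.range e) w w' then M w w' else 0

/-! ### Growth conditions -/

/-- `ε` is negligible: `λ ^ c * ε λ → 0` for every natural number `c`. -/
def Negligible (ε : ℕ → ℝ) : Prop :=
  Asymptotics.SuperpolynomialDecay atTop (fun lam : ℕ => (lam : ℝ)) ε

/-- `s` is bounded by a polynomial. -/
def PolyBounded (s : ℕ → ℕ) : Prop := ∃ p : Polynomial ℕ, ∀ lam, s lam ≤ p.eval lam

/-! ### Classical polynomial-time computation -/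

/-- Boolean circuits as straight-line programs: `w` wires are available, every step adds one wire,
and at the end `out` wires are selected as the output. -/
inductive BoolCircuit (out : ℕ) : ℕ → Type
  | output {w : ℕ} (o : Fin out → Fin w) : BoolCircuit out w
  | const {w : ℕ} (b : Bool) (C : BoolCircuit out (w + 1)) : BoolCircuit out w
  | nand {w : ℕ} (i j : Fin w) (C : BoolCircuit out (w + 1)) : BoolCircuit out w

/-- The function computed by a Boolean circuit. -/
def BoolCircuit.eval {out : ℕ} : {w : ℕ} → BoolCircuit out w → Bits w → Bits out
  | _, .output o, v => fun i => v (o i)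
  | _, .const b C, v => C.eval (Fin.snoc (α := fun _ => Bool) v b)
  | _, .nand i j C, v => C.eval (Fin.snoc (α := fun _ => Bool) v (!(v i && v j)))

/-- The number of gates of a Boolean circuit. -/
def BoolCircuit.gates {out : ℕ} : {w : ℕ} → BoolCircuit out w → ℕ
  | _, .output _ => 0
  | _, .const _ C => C.gates + 1
  | _, .nand _ _ C => C.gates + 1

/-- `F` is computed by a family of Boolean circuits of polynomial size (the size counts gates,
inputs and outputs). No uniformity is demanded, so that every deterministic polynomial-time
algorithm is covered. -/
def PolyComputable {a b : ℕ → ℕ} (F : ∀ lam, Bits (a lam) → Bits (b lam)) : Prop :=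
  ∃ C : ∀ lam, BoolCircuit (b lam) (a lam),
    PolyBounded (fun lam => (C lam).gates + a lam + b lam) ∧ ∀ lam, (C lam).eval = F lam

/-! ### Quantum circuits over the gate set `{H, T, CNOT}` -/

/-- A gate acting on `N` qubits. -/
inductive Gate (N : ℕ) : Type
  | H (i : Fin N) : Gate N
  | T (i : Fin N) : Gate N
  | CNOT (control target : Fin N) (h : control ≠ target) : Gate N

/-- The unitary of a gate. -/
def Gate.mat {N : ℕ} (g : Gate N) : Op N :=
  open Classical in
  match g with
  | .H i => Matrix.of fun u v =>
      if AgreeOff {i} u v then (if u i && v i then (-1 : ℂ) else 1) / (Real.sqrt 2 : ℂ) else 0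
  | .T i => Matrix.diagonal fun u =>
      if u i then Complex.exp (Complex.I * (Real.pi / 4 : ℝ)) else 1
  | .CNOT c t _ => Matrix.of fun u v => if u = Function.update v t (xor (v t) (v c)) then 1 else 0

/-- A generalized quantum circuit: `anc` further input qubits are initialized to `|0⟩`, the gates
are applied from left to right, the qubits selected by `outPos` are output, and all other qubits are
traced out. -/
structure GenCircuit (inp out : ℕ) where
  anc : ℕ
  gates : List (Gate (inp + anc))
  outPos : Fin out ↪ Fin (inp + anc)

/-- The size of a generalized quantum circuit. -/
def GenCircuit.size {inp out : ℕ} (C : GenCircuit inp out) : ℕ :=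
  C.gates.length + (inp + C.anc) + out

/-- The quantum channel of a generalized quantum circuit. -/
def GenCircuit.channel {inp out : ℕ} (C : GenCircuit inp out) (ρ : Op inp) : Op out :=
  reduce C.outPos
    (C.gates.foldl (fun σ g => g.mat * σ * g.matᴴ) (tensor ρ (ketbra (zeroBits C.anc))))

/-! ### Oracles and oracle algorithms -/

/-- A (superposition) oracle that acts on `a` qubits and hands back these `a` qubits together with
`b` fresh ones; it is given by its Kraus operators `kraus s`. -/
structure QOracle (a b : ℕ) where
  ι : Type
  fin : Fintype ι
  kraus : ι → Matrix (Bits a × Bits b) (Bits a) ℂ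

/-- The action of an oracle on a state of its query register. -/
def QOracle.apply {a b : ℕ} (O : QOracle a b) (ρ : Op a) :
    Matrix (Bits a × Bits b) (Bits a × Bits b) ℂ :=
  letI := O.fin
  ∑ s, O.kraus s * ρ * (O.kraus s)ᴴ

/-- The Kraus operator `E` applied to the qubits `e 0, …, e (a - 1)` among `N` qubits, tensored with
the identity on the others. The `b` fresh qubits are appended at the end. -/
def liftKraus {a b N : ℕ} (e : Fin a ↪ Fin N) (E : Matrix (Bits a × Bits b) (Bits a) ℂ) :
    Matrix (Bits (N + b)) (Bits N) ℂ :=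
  open Classical in
  Matrix.of fun u v =>
    if AgreeOff (Set.range e) (fstBits u) v then E (fstBits u ∘ e, sndBits u) (v ∘ e) else 0

/-- The action of an oracle on `N` qubits, with query register `e 0, …, e (a - 1)`. -/
def QOracle.applyAt {a b N : ℕ} (O : QOracle a b) (e : Fin a ↪ Fin N) (ρ : Op N) : Op (N + b) :=
  letI := O.fin
  ∑ s, liftKraus e (O.kraus s) * ρ * (liftKraus e (O.kraus s))ᴴ

/-- Quantum circuits with oracle gates, on `N` qubits. Every query adds the `b` fresh qubits that
the oracle returns, on which the remaining circuit may act. Finally one qubit is measured in the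
computational basis, the outcome being the output bit. -/
inductive OracleCircuit (a b : ℕ) : ℕ → Type
  | measure {N : ℕ} (i : Fin N) : OracleCircuit a b N
  | gate {N : ℕ} (g : Gate N) (C : OracleCircuit a b N) : OracleCircuit a b N
  | query {N : ℕ} (e : Fin a ↪ Fin N) (C : OracleCircuit a b (N + b)) : OracleCircuit a b N

/-- The probability that the output bit is `1`. -/
def OracleCircuit.accept {a b : ℕ} (O : QOracle a b) :
    {N : ℕ} → OracleCircuit a b N → Op N → ℝ
  | _, .measure i, ρ => ∑ w, if w i then (ρ w w).re else 0
  | _, .gate g C, ρ => C.accept O (g.mat * ρ * g.matᴴ)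
  | _, .query e C, ρ => C.accept O (O.applyAt e ρ)

/-- The number of gates and queries. -/
def OracleCircuit.size {a b : ℕ} : {N : ℕ} → OracleCircuit a b N → ℕ
  | _, .measure _ => 1
  | _, .gate _ C => C.size + 1
  | _, .query _ C => C.size + 1

/-- The number of queries. -/
def OracleCircuit.queries {a b : ℕ} : {N : ℕ} → OracleCircuit a b N → ℕ
  | _, .measure _ => 0
  | _, .gate _ C => C.queries
  | _, .query _ C => C.queries + 1

/-- An oracle adversary for one value of the security parameter: a circuit with oracle gates whose
input consists of a density matrix `advice` on `m` qubits and of `anc` qubits in state `|0⟩`. -/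
structure Adversary (a b : ℕ) where
  m : ℕ
  anc : ℕ
  advice : Op m
  posSemidef : advice.PosSemidef
  trace_eq_one : advice.trace = 1
  circ : OracleCircuit a b (m + anc)

/-- The probability that the adversary outputs `1` when it has access to `O`. -/
def Adversary.prob {a b : ℕ} (A : Adversary a b) (O : QOracle a b) : ℝ :=
  A.circ.accept O (tensor A.advice (ketbra (zeroBits A.anc)))

/-- The number of queries of an adversary. -/
def Adversary.queries {a b : ℕ} (A : Adversary a b) : ℕ := A.circ.queries

/-- The size of an adversary: gates, queries and input qubits. -/
def Adversary.size {a b : ℕ} (A : Adversary a b) : ℕ := A.circ.size + A.m + A.anc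

/-- A non-uniform quantum polynomial-time adversary with quantum advice. -/
def IsQPT {a b : ℕ → ℕ} (A : ∀ lam, Adversary (a lam) (b lam)) : Prop :=
  PolyBounded fun lam => (A lam).size

/-! ### Quantum-query secure pseudorandom functions -/

/-- The oracle `|x⟩|y⟩ ↦ |x⟩|y ⊕ f x⟩`. -/
def functionOracle {d n : ℕ} (f : Bits d → Bits n) : QOracle (d + n) 0 where
  ι := Unit
  fin := inferInstance
  kraus _ := Matrix.of fun u v =>
    if fstBits u.1 = fstBits v ∧ sndBits u.1 = xorBits (sndBits v) (f (fstBits v)) then 1 else 0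

/-- The advantage in distinguishing `F k` for a uniform key `k` from a uniform function. -/
def prfAdvantage {κ d n : ℕ} (F : Bits κ → Bits d → Bits n) (A : Adversary (d + n) 0) : ℝ :=
  |(𝔼 k : Bits κ, A.prob (functionOracle (F k))) -
    𝔼 f : Bits d → Bits n, A.prob (functionOracle f)|

/-- `F` is a quantum-query `ε`-secure pseudorandom function with key length `κ`, input length `d`
and output length `n`: it is efficiently computable, and the advantage of every non-uniform QPT
adversary is at most `ε lam` for all sufficiently large `lam`. -/
def IsQPRF {κ d n : ℕ → ℕ} (F : ∀ lam, Bits (κ lam) → Bits (d lam) → Bits (n lam))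
    (ε : ℕ → ℝ) : Prop :=
  PolyComputable (a := fun lam => κ lam + d lam) (b := n)
      (fun lam w => F lam (fstBits w) (sndBits w)) ∧
    ∀ A : ∀ lam, Adversary (d lam + n lam) 0, IsQPT A →
      ∀ᶠ lam in atTop, prfAdvantage (F lam) (A lam) ≤ ε lam

/-! ### Quantum-accessible adaptively secure PRFS generators -/

/-- The oracle `|x⟩ ↦ |x⟩|ψ x⟩`, where `|ψ x⟩` occupies a fresh register. -/
def stateOracle {d n : ℕ} (ψ : Bits d → Bits n → ℂ) : QOracle d n where
  ι := Unit
  fin := inferInstance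
  kraus _ := Matrix.of fun u x => if u.1 = x then ψ x u.2 else 0

/-- Pure `n`-qubit states: unit vectors in `ℂ^(2^n)`. -/
abbrev PureState (n : ℕ) : Type := Metric.sphere (0 : EuclideanSpace ℂ (Bits n)) 1

/-- The Haar distribution on pure `n`-qubit states: the normalized surface measure. -/
def haarState (n : ℕ) : Measure (PureState n) :=
  ((volume : Measure (EuclideanSpace ℂ (Bits n))).toSphere Set.univ)⁻¹ •
    (volume : Measure (EuclideanSpace ℂ (Bits n))).toSphere

/-- The probability that the adversary outputs `1` when its oracle is `|x⟩ ↦ |x⟩|ϑ_x⟩` for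
independent Haar random states `ϑ_x`. -/
def haarProb {d n : ℕ} (A : Adversary d n) : ℝ :=
  ∫ θ : Bits d → PureState n, A.prob (stateOracle fun x y => (θ x : EuclideanSpace ℂ (Bits n)) y)
    ∂(Measure.pi fun _ => haarState n)

/-- The advantage in distinguishing the oracles `O k` of a generator, for a uniform key `k`, from
the Haar random oracle. -/
def prfsAdvantage {κ d n : ℕ} (O : Bits κ → QOracle d n) (A : Adversary d n) : ℝ :=
  |(𝔼 k : Bits κ, A.prob (O k)) - haarProb A|

/-- The generator is implemented exactly by generalized quantum circuits of polynomial size, which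
take the key and the register `X` to the registers `X` and `Y`. -/
def IsQPTGenerator {κ d n : ℕ → ℕ} (O : ∀ lam, Bits (κ lam) → QOracle (d lam) (n lam)) : Prop :=
  ∃ C : ∀ lam, GenCircuit (κ lam + d lam) (d lam + n lam),
    PolyBounded (fun lam => (C lam).size) ∧
    ∀ lam (k : Bits (κ lam)) (ρ : Op (d lam)) (u v : Bits (d lam + n lam)),
      (C lam).channel (tensor (ketbra k) ρ) u v =
        (O lam k).apply ρ (fstBits u, sndBits u) (fstBits v, sndBits v)

/-- The oracle leaves the basis states of its query register unchanged, i.e. it is controlled on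
the query. -/
def QOracle.IsControlled {d n : ℕ} (O : QOracle d n) : Prop :=
  ∀ s (u : Bits d × Bits n) (x : Bits d), u.1 ≠ x → O.kraus s u x = 0

/-- A quantum-accessible adaptively secure PRFS generator with key length `lam`, input length `d`
and output length `n`. Here `G lam k` is the oracle that, controlled on the content `x` of the
query register, creates the state `G(k, x)` in a fresh register. -/
def IsQAPRFS {d n : ℕ → ℕ} (G : ∀ lam : ℕ, Bits lam → QOracle (d lam) (n lam)) : Prop :=
  IsQPTGenerator (κ := fun lam => lam) G ∧
  (∀ lam k, (G lam k).IsControlled) ∧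
  ∀ A : ∀ lam, Adversary (d lam) (n lam), IsQPT A →
    ∃ ε : ℕ → ℝ, Negligible ε ∧ ∀ lam, prfsAdvantage (G lam) (A lam) ≤ ε lam

/-! ### The construction -/

/-- Basis states of the registers `X`, `K`, `Y` and `Anc` of the construction. -/
abbrev Reg (d ℓ n : ℕ) : Type := Bits d × Bits ℓ × Bits n × Bits 1

/-- `V_f : |a⟩_X |b⟩_K ↦ |a⟩_X |f a ⊕ b⟩_K`. -/
def unitaryV {d ℓ : ℕ} (n : ℕ) (f : Bits d → Bits ℓ) : Matrix (Reg d ℓ n) (Reg d ℓ n) ℂ :=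
  Matrix.of fun r s => if r = (s.1, xorBits (f s.1) s.2.1, s.2.2.1, s.2.2.2) then 1 else 0

/-- The Hadamard transform `H^{⊗ n}` on the register `Y`. -/
def hadamardY (d ℓ n : ℕ) : Matrix (Reg d ℓ n) (Reg d ℓ n) ℂ :=
  Matrix.of fun r s =>
    if r.1 = s.1 ∧ r.2.1 = s.2.1 ∧ r.2.2.2 = s.2.2.2 then
      ∏ i, (if r.2.2.1 i && s.2.2.1 i then (-1 : ℂ) else 1) / (Real.sqrt 2 : ℂ)
    else 0

/-- `|a⟩_K |b⟩_Y |c⟩_Anc ↦ |a⟩_K |b⟩_Y |c ⊕ g a b⟩_Anc`. -/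
def evalAnc (d : ℕ) {ℓ n : ℕ} (g : Bits ℓ → Bits n → Bits 1) : Matrix (Reg d ℓ n) (Reg d ℓ n) ℂ :=
  Matrix.of fun r s =>
    if r = (s.1, s.2.1, s.2.2.1, xorBits s.2.2.2 (g s.2.1 s.2.2.1)) then 1 else 0

/-- The initialization `|x⟩ ↦ |x⟩_X |0⟩_K |0⟩_Y |-⟩_Anc`. -/
def initRegs (d ℓ n : ℕ) : Matrix (Reg d ℓ n) (Bits d) ℂ :=
  Matrix.of fun r x =>
    if r.1 = x ∧ r.2.1 = zeroBits ℓ ∧ r.2.2.1 = zeroBits n then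
      (if r.2.2.2 0 then (-1 : ℂ) else 1) / (Real.sqrt 2 : ℂ)
    else 0

/-- The isometric part of the construction, for `f = F₁ k` and `g = F₂`: initialize, apply `V_f`, apply
`U_g` (Hadamards on `Y`, then the evaluation of `g` into `Anc`), and apply `V_f` again. -/
def constructionMat {d ℓ n : ℕ} (f : Bits d → Bits ℓ) (g : Bits ℓ → Bits n → Bits 1) :
    Matrix (Reg d ℓ n) (Bits d) ℂ :=
  unitaryV n f * (evalAnc d g * hadamardY d ℓ n) * unitaryV n f * initRegs d ℓ n

/-- The procedure of the construction, run on a register `X`: the registers `K` and `Anc` are traced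
out at the end, and `X` and `Y` are output. -/
def constructionOracle {d ℓ n : ℕ} (f : Bits d → Bits ℓ) (g : Bits ℓ → Bits n → Bits 1) :
    QOracle d n where
  ι := Bits ℓ × Bits 1
  fin := inferInstance
  kraus s := Matrix.of fun u x => constructionMat f g (u.1, s.1, u.2, s.2) x

/-- The generator built from the two functions `F₁` and `F₂`. -/
def construction {d ℓ n : ℕ → ℕ} (F₁ : ∀ lam, Bits lam → Bits (d lam) → Bits (ℓ lam))
    (F₂ : ∀ lam, Bits (ℓ lam) → Bits (n lam) → Bits 1) (lam : ℕ) (k : Bits lam) :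
    QOracle (d lam) (n lam) :=
  constructionOracle (F₁ lam k) (F₂ lam)

end

end QAPRFS

namespace QAPRFS

noncomputable section

/-! ### Moments of Haar random states -/

/-! Phase kickback on the ancilla and the second application of V, which returns K to zero, leave K
and Anc in a fixed pure state. The procedure is therefore exactly the state oracle with amplitudes
2^{-n/2} (-1)^{F₂(F₁(k,x),y)} (`prob_constructionOracle`), and the advantage is bounded by a sum of
three distances.

From F₁ to a random function f. A query to the oracle with signs F₂(f x, y) is simulated by two
queries to f, one that computes f x into a work register and one that erases it. A distinguisher
thus attacks F₁ (`exists_adversary_first`).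

From F₂ to independent random signs. The keys f x are now independent, so the 2^d inputs x can be
switched to truly random functions one at a time, along a chain of subsets of {0,1}^d whose members
have small circuits (`Segment`). One step is an attack on F₂, except that it involves random
functions f and g with exponentially large tables. The acceptance probability after q queries is a
linear combination of functionals that each depend on at most 2q values of such a function, so
2q-wise independent polynomial hash functions replace f and g without any error (`expect_prob_eq`).
The best hash keys and the largest step of the chain are hardwired into a non-uniform adversary, and
the loss is 2^d times one advantage against F₂ (`exists_adversary_second`).

From random signs to Haar random states (`signState_haar_close`). Haar states are invariant under
sign changes of their amplitudes, so in both worlds the amplitudes may be multiplied by random signs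
g. The final state is then expanded in the characters of g, and by Parseval the average over g makes
the components add up incoherently. The components of full degree q come from histories in which all
q records (query, reply) are distinct; such a component has weight ∏ |ϑ_x(y)|² times a factor that
does not depend on the states ϑ. The product is 2^{-nq} for uniform amplitudes, and its Haar mean is
at least (2^n + q)^{-q} by the moment recursion `haarMoment_insert`. This bounds the probabilities
of both outcomes from below in both worlds by nearly equal numbers. Collision-free histories carry
at least 1 - q²/2^n of the mass, so the acceptance probabilities differ by at most 2q²/2^n. Since
probabilities also differ by at most 1, the bound 2q/2^{n/2} follows. -/

theorem haarState_univ (n : ℕ) : haarState n Set.univ = 1 := by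
  rw [haarState, Measure.smul_apply, smul_eq_mul]
  refine ENNReal.inv_mul_cancel ?_ (measure_ne_top _ _)
  rw [Ne, Measure.measure_univ_eq_zero]
  exact Measure.toSphere_ne_zero _

instance isProbabilityMeasure_haarState (n : ℕ) : IsProbabilityMeasure (haarState n) :=
  ⟨haarState_univ n⟩

/-- The action of a linear isometry on pure states. -/
def sphereMap {n : ℕ} (U : EuclideanSpace ℂ (Bits n) ≃ₗᵢ[ℝ] EuclideanSpace ℂ (Bits n))
    (θ : PureState n) : PureState n :=
  ⟨U θ, by simp⟩

theorem continuous_sphereMap {n : ℕ}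
    (U : EuclideanSpace ℂ (Bits n) ≃ₗᵢ[ℝ] EuclideanSpace ℂ (Bits n)) :
    Continuous (sphereMap U) :=
  Continuous.subtype_mk (U.continuous.comp continuous_subtype_val) _

open scoped Pointwise in
-- The surface measure of a set is a multiple of the volume of the cone over it. A linear isometry
-- preserves volume and maps cones to cones.
theorem measurePreserving_sphereMap {n : ℕ}
    (U : EuclideanSpace ℂ (Bits n) ≃ₗᵢ[ℝ] EuclideanSpace ℂ (Bits n)) :
    MeasurePreserving (sphereMap U) (haarState n) (haarState n) := by
  have hm : Measurable (sphereMap U) := (continuous_sphereMap U).measurable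
  refine ⟨hm, ?_⟩
  ext s hs
  rw [Measure.map_apply hm hs, haarState, Measure.smul_apply, Measure.smul_apply,
    Measure.toSphere_apply' _ (hm hs), Measure.toSphere_apply' _ hs]
  congr 2
  have hU := LinearIsometryEquiv.measurePreserving U
  have key : U ⁻¹' (Set.Ioo (0 : ℝ) 1 • ((↑) '' s)) =
      Set.Ioo (0 : ℝ) 1 • ((↑) '' (sphereMap U ⁻¹' s)) := by
    ext v
    simp only [Set.mem_preimage, Set.mem_smul, Set.mem_image]
    constructor
    · rintro ⟨r, hr, -, ⟨θ, hθ, rfl⟩, h⟩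
      refine ⟨r, hr, _, ⟨sphereMap U.symm θ, ?_, rfl⟩, ?_⟩
      · have : sphereMap U (sphereMap U.symm θ) = θ := by
          apply Subtype.ext; simp [sphereMap]
        change sphereMap U (sphereMap U.symm θ) ∈ s
        rwa [this]
      · apply U.injective
        rw [← h, map_smul]
        simp [sphereMap]
    · rintro ⟨r, hr, -, ⟨θ, hθ, rfl⟩, h⟩
      refine ⟨r, hr, _, ⟨sphereMap U θ, hθ, rfl⟩, ?_⟩
      rw [← h, map_smul]
      simp [sphereMap]
  rw [← key]
  exact hU.measure_preimage_emb U.toHomeomorph.measurableEmbedding _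

theorem integral_comp_sphereMap {n : ℕ}
    (U : EuclideanSpace ℂ (Bits n) ≃ₗᵢ[ℝ] EuclideanSpace ℂ (Bits n)) {f : PureState n → ℝ}
    (hf : Continuous f) :
    ∫ θ, f (sphereMap U θ) ∂haarState n = ∫ θ, f θ ∂haarState n := by
  have h := measurePreserving_sphereMap U
  conv_rhs => rw [← h.map_eq]
  rw [integral_map h.measurable.aemeasurable hf.aestronglyMeasurable]

theorem integrable_haarState {n : ℕ} {f : PureState n → ℝ} (hf : Continuous f) :
    Integrable f (haarState n) :=
  hf.integrable_of_hasCompactSupport (HasCompactSupport.of_compactSpace f)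

/-- The probability of the outcome `y` when a pure state is measured. -/
def weightAt {n : ℕ} (y : Bits n) (θ : PureState n) : ℝ :=
  Complex.normSq ((θ : EuclideanSpace ℂ (Bits n)) y)

theorem continuous_coord {n : ℕ} (y : Bits n) :
    Continuous fun θ : PureState n => (θ : EuclideanSpace ℂ (Bits n)) y := by
  have h : Continuous fun v : EuclideanSpace ℂ (Bits n) => v y := by fun_prop
  exact h.comp continuous_subtype_val

theorem continuous_weightAt {n : ℕ} (y : Bits n) : Continuous (weightAt y) :=
  Complex.continuous_normSq.comp (continuous_coord y)

theorem weightAt_nonneg {n : ℕ} (y : Bits n) (θ : PureState n) : 0 ≤ weightAt y θ :=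
  Complex.normSq_nonneg _

theorem sum_weightAt {n : ℕ} (θ : PureState n) : ∑ y, weightAt y θ = 1 := by
  have h : ‖(θ : EuclideanSpace ℂ (Bits n))‖ = 1 := by simp
  rw [EuclideanSpace.norm_eq, Real.sqrt_eq_one] at h
  simpa [weightAt, Complex.normSq_eq_norm_sq] using h

/-- Multiplication of the coordinates by phases. -/
def phaseIso {n : ℕ} (c : Bits n → Circle) :
    EuclideanSpace ℂ (Bits n) ≃ₗᵢ[ℝ] EuclideanSpace ℂ (Bits n) :=
  LinearIsometryEquiv.piLpCongrRight 2 fun y => (rotation (c y))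

/-- Exchange of two coordinates. -/
def swapIso {n : ℕ} (a b : Bits n) :
    EuclideanSpace ℂ (Bits n) ≃ₗᵢ[ℝ] EuclideanSpace ℂ (Bits n) :=
  LinearIsometryEquiv.piLpCongrLeft 2 ℝ ℂ (Equiv.swap a b)

theorem phaseIso_apply {n : ℕ} (c : Bits n → Circle) (v : EuclideanSpace ℂ (Bits n)) (y : Bits n) :
    phaseIso c v y = c y * v y := by
  simp [phaseIso]

theorem swapIso_apply {n : ℕ} (a b : Bits n) (v : EuclideanSpace ℂ (Bits n)) (y : Bits n) :
    swapIso a b v y = v (Equiv.swap a b y) := by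
  simp [swapIso, LinearIsometryEquiv.piLpCongrLeft_apply, Equiv.piCongrLeft'_apply]

/-- The underlying function of `mixIso`. -/
def mixFun {n : ℕ} (a b : Bits n) (v : EuclideanSpace ℂ (Bits n)) : EuclideanSpace ℂ (Bits n) :=
  WithLp.toLp 2 fun y => if y = a then (v a + v b) / (Real.sqrt 2 : ℂ)
    else if y = b then (v a - v b) / (Real.sqrt 2 : ℂ) else v y

theorem sqrt_two_mul_self : (Real.sqrt 2 : ℂ) * (Real.sqrt 2 : ℂ) = 2 := by
  rw [← Complex.ofReal_mul, Real.mul_self_sqrt (by norm_num)]; norm_num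

theorem sqrt_two_ne_zero : (Real.sqrt 2 : ℂ) ≠ 0 := by
  intro h
  have := sqrt_two_mul_self
  rw [h] at this; norm_num at this

theorem mixFun_involutive {n : ℕ} {a b : Bits n} (hab : a ≠ b) :
    Function.Involutive (mixFun a b) := by
  intro v
  ext y
  have h2 := sqrt_two_mul_self
  have h0 := sqrt_two_ne_zero
  simp only [mixFun]
  by_cases hya : y = a
  · subst hya
    simp only [if_true, hab.symm, if_false]
    field_simp
    rw [pow_two, h2]; ring
  · by_cases hyb : y = b
    · subst hyb
      simp only [if_true, hab.symm, if_false]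
      field_simp
      rw [pow_two, h2]; ring
    · simp [hya, hyb]

theorem normSq_mix (u v : ℂ) :
    Complex.normSq ((u + v) / (Real.sqrt 2 : ℂ)) =
      (Complex.normSq u + Complex.normSq v) / 2 + (u.re * v.re + u.im * v.im) := by
  rw [Complex.normSq_div, Complex.normSq_ofReal, Real.mul_self_sqrt (by norm_num)]
  simp only [Complex.normSq_apply, Complex.add_re, Complex.add_im]
  ring

theorem normSq_mix' (u v : ℂ) :
    Complex.normSq ((u - v) / (Real.sqrt 2 : ℂ)) =
      (Complex.normSq u + Complex.normSq v) / 2 - (u.re * v.re + u.im * v.im) := by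
  rw [Complex.normSq_div, Complex.normSq_ofReal, Real.mul_self_sqrt (by norm_num)]
  simp only [Complex.normSq_apply, Complex.sub_re, Complex.sub_im]
  ring

theorem sum_eq_two_add {ι : Type*} [Fintype ι] [DecidableEq ι] {a b : ι} (hab : a ≠ b)
    (f : ι → ℝ) : ∑ i, f i = f a + f b + ∑ i ∈ (Finset.univ.erase a).erase b, f i := by
  rw [← Finset.add_sum_erase _ f (Finset.mem_univ a),
    ← Finset.add_sum_erase _ f (show b ∈ Finset.univ.erase a by simp [hab.symm])]
  ring

theorem norm_mixFun {n : ℕ} {a b : Bits n} (hab : a ≠ b) (v : EuclideanSpace ℂ (Bits n)) :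
    ‖mixFun a b v‖ = ‖v‖ := by
  rw [EuclideanSpace.norm_eq, EuclideanSpace.norm_eq]
  congr 1
  simp only [← Complex.normSq_eq_norm_sq]
  rw [sum_eq_two_add hab, sum_eq_two_add hab (fun i => Complex.normSq (v i))]
  have h : ∑ i ∈ (Finset.univ.erase a).erase b, Complex.normSq (mixFun a b v i) =
      ∑ i ∈ (Finset.univ.erase a).erase b, Complex.normSq (v i) := by
    refine Finset.sum_congr rfl fun i hi => ?_
    simp only [Finset.mem_erase] at hi
    simp [mixFun, hi.1, hi.2.1]
  rw [h]
  have ha : mixFun a b v a = (v a + v b) / (Real.sqrt 2 : ℂ) := by simp [mixFun]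
  have hb : mixFun a b v b = (v a - v b) / (Real.sqrt 2 : ℂ) := by simp [mixFun, hab.symm]
  rw [ha, hb, normSq_mix, normSq_mix']
  ring

/-- The isometry replacing the coordinates `a` and `b` by `(a + b) / √2` and `(a - b) / √2`. -/
def mixIso {n : ℕ} {a b : Bits n} (hab : a ≠ b) :
    EuclideanSpace ℂ (Bits n) ≃ₗᵢ[ℝ] EuclideanSpace ℂ (Bits n) where
  toFun := mixFun a b
  invFun := mixFun a b
  left_inv := mixFun_involutive hab
  right_inv := mixFun_involutive hab
  map_add' u v := by
    ext y
    simp only [mixFun, PiLp.add_apply]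
    split_ifs <;> ring
  map_smul' r v := by
    ext y
    simp only [mixFun, PiLp.smul_apply, Complex.real_smul, RingHom.id_apply]
    split_ifs <;> ring
  norm_map' v := norm_mixFun hab v

theorem mixIso_apply {n : ℕ} {a b : Bits n} (hab : a ≠ b) (v : EuclideanSpace ℂ (Bits n)) :
    mixIso hab v = mixFun a b v := rfl

/-- The moment `E ∏_{y ∈ T} |θ_y|²` of a Haar random state. -/
def haarMoment {n : ℕ} (T : Finset (Bits n)) : ℝ := ∫ θ, ∏ y ∈ T, weightAt y θ ∂haarState n

theorem continuous_prod_weightAt {n : ℕ} (T : Finset (Bits n)) :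
    Continuous fun θ => ∏ y ∈ T, weightAt y θ :=
  continuous_finsetProd _ fun y _ => continuous_weightAt y

theorem weightAt_swap {n : ℕ} (a b y : Bits n) (θ : PureState n) :
    weightAt y (sphereMap (swapIso a b) θ) = weightAt (Equiv.swap a b y) θ := by
  simp [weightAt, sphereMap, swapIso_apply]

theorem prod_weightAt_swap {n : ℕ} {a b : Bits n} {T : Finset (Bits n)} (ha : a ∉ T) (hb : b ∉ T)
    (θ : PureState n) :
    ∏ y ∈ T, weightAt y (sphereMap (swapIso a b) θ) = ∏ y ∈ T, weightAt y θ := by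
  refine Finset.prod_congr rfl fun y hy => ?_
  rw [weightAt_swap, Equiv.swap_apply_of_ne_of_ne]
  · rintro rfl; exact ha hy
  · rintro rfl; exact hb hy

/-- Let A and B be the weights at `a` and `b`, and R the real part of the product of one amplitude
with the conjugate of the other. Mixing the two coordinates turns A and B into (A + B)/2 ± R without
touching the factor over `T`. Adding the second moments of both gives 2 E[A²] = E[A²] + E[AB] + 2
E[R²]. Finally E[R²] = E[AB]/2, because R² + I² = AB for the corresponding imaginary part I, and a
phase exchanges R² and I² in mean. -/
theorem haarMoment_fourth {n : ℕ} {a b : Bits n} (hab : a ≠ b) {T : Finset (Bits n)} (ha : a ∉ T)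
    (hb : b ∉ T) :
    ∫ θ, (∏ y ∈ T, weightAt y θ) * weightAt a θ ^ 2 ∂haarState n =
      2 * ∫ θ, (∏ y ∈ T, weightAt y θ) * (weightAt a θ * weightAt b θ) ∂haarState n := by
  have cT := continuous_prod_weightAt T
  have ca := continuous_weightAt a
  have cb := continuous_weightAt b
  have cca := continuous_coord a
  have ccb := continuous_coord b
  set p : PureState n → ℝ := fun θ => ∏ y ∈ T, weightAt y θ with hp
  let R : PureState n → ℝ := fun θ =>
    ((θ : EuclideanSpace ℂ (Bits n)) a).re * ((θ : EuclideanSpace ℂ (Bits n)) b).re +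
      ((θ : EuclideanSpace ℂ (Bits n)) a).im * ((θ : EuclideanSpace ℂ (Bits n)) b).im
  let I : PureState n → ℝ := fun θ =>
    ((θ : EuclideanSpace ℂ (Bits n)) a).re * -((θ : EuclideanSpace ℂ (Bits n)) b).im +
      ((θ : EuclideanSpace ℂ (Bits n)) a).im * ((θ : EuclideanSpace ℂ (Bits n)) b).re
  have cR : Continuous R :=
    ((Complex.continuous_re.comp cca).mul (Complex.continuous_re.comp ccb)).add
      ((Complex.continuous_im.comp cca).mul (Complex.continuous_im.comp ccb))
  have cI : Continuous I :=
    ((Complex.continuous_re.comp cca).mul (Complex.continuous_im.comp ccb).neg).add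
      ((Complex.continuous_im.comp cca).mul (Complex.continuous_re.comp ccb))
  have e1 : ∫ θ, p θ * weightAt b θ ^ 2 ∂haarState n = ∫ θ, p θ * weightAt a θ ^ 2 ∂haarState n := by
    rw [← integral_comp_sphereMap (swapIso a b) (f := fun θ => p θ * weightAt a θ ^ 2)
      (cT.mul (ca.pow 2))]
    refine integral_congr_ae (Eventually.of_forall fun θ => ?_)
    simp only [hp, prod_weightAt_swap ha hb, weightAt_swap, Equiv.swap_apply_left]
  have hT : ∀ θ, p (sphereMap (mixIso hab) θ) = p θ := by
    intro θ
    refine Finset.prod_congr rfl fun y hy => ?_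
    have h1 : y ≠ a := by rintro rfl; exact ha hy
    have h2 : y ≠ b := by rintro rfl; exact hb hy
    simp only [weightAt, sphereMap, mixIso_apply, mixFun, h1, h2, if_false]
  have hma : ∀ θ, weightAt a (sphereMap (mixIso hab) θ) =
      (weightAt a θ + weightAt b θ) / 2 + R θ := by
    intro θ
    simp only [weightAt, sphereMap, R, ← normSq_mix, mixIso_apply, mixFun, if_true]
  have hmb : ∀ θ, weightAt b (sphereMap (mixIso hab) θ) =
      (weightAt a θ + weightAt b θ) / 2 - R θ := by
    intro θ
    simp only [weightAt, sphereMap, R, ← normSq_mix', mixIso_apply, mixFun, if_true, hab.symm,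
      if_false]
  have e2 : ∫ θ, p θ * ((weightAt a θ + weightAt b θ) / 2 + R θ) ^ 2 ∂haarState n =
      ∫ θ, p θ * weightAt a θ ^ 2 ∂haarState n := by
    rw [← integral_comp_sphereMap (mixIso hab) (f := fun θ => p θ * weightAt a θ ^ 2)
      (cT.mul (ca.pow 2))]
    simp only [hma, hT]
  have e3 : ∫ θ, p θ * ((weightAt a θ + weightAt b θ) / 2 - R θ) ^ 2 ∂haarState n =
      ∫ θ, p θ * weightAt b θ ^ 2 ∂haarState n := by
    rw [← integral_comp_sphereMap (mixIso hab) (f := fun θ => p θ * weightAt b θ ^ 2)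
      (cT.mul (cb.pow 2))]
    simp only [hmb, hT]
  have e4 : ∫ θ, p θ * I θ ^ 2 ∂haarState n = ∫ θ, p θ * R θ ^ 2 ∂haarState n := by
    -- Multiplying the coordinate `b` by the imaginary unit turns `R` into `I` and changes no
    -- weight.
    let c : Bits n → Circle := fun y => if y = b then ⟨Complex.I, by simp [Submonoid.unitSphere]⟩ else 1
    rw [← integral_comp_sphereMap (phaseIso c) (f := fun θ => p θ * R θ ^ 2)
      (cT.mul (cR.pow 2))]
    refine integral_congr_ae (Eventually.of_forall fun θ => ?_)
    have h1 : p (sphereMap (phaseIso c) θ) = p θ := by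
      refine Finset.prod_congr rfl fun y hy => ?_
      simp [weightAt, sphereMap, phaseIso_apply]
    have h2 : R (sphereMap (phaseIso c) θ) = I θ := by
      simp [R, I, sphereMap, phaseIso_apply, c, hab]
    change p θ * I θ ^ 2 = p _ * R _ ^ 2
    rw [h1, h2]
  have e5 : ∀ θ, R θ ^ 2 + I θ ^ 2 = weightAt a θ * weightAt b θ := by
    intro θ
    simp only [R, I, weightAt, Complex.normSq_apply]
    ring
  have i1 : Integrable (fun θ => p θ * weightAt a θ ^ 2) (haarState n) :=
    integrable_haarState (cT.mul (ca.pow 2))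
  have i2 : Integrable (fun θ => p θ * weightAt b θ ^ 2) (haarState n) :=
    integrable_haarState (cT.mul (cb.pow 2))
  have i3 : Integrable (fun θ => p θ * R θ ^ 2) (haarState n) :=
    integrable_haarState (cT.mul (cR.pow 2))
  have i4 : Integrable (fun θ => p θ * I θ ^ 2) (haarState n) :=
    integrable_haarState (cT.mul (cI.pow 2))
  have i5 : Integrable (fun θ => p θ * (weightAt a θ * weightAt b θ)) (haarState n) :=
    integrable_haarState (cT.mul (ca.mul cb))
  have i6 : Integrable (fun θ => p θ * ((weightAt a θ + weightAt b θ) / 2 + R θ) ^ 2)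
      (haarState n) :=
    integrable_haarState (cT.mul ((((ca.add cb).div_const 2).add cR).pow 2))
  have i7 : Integrable (fun θ => p θ * ((weightAt a θ + weightAt b θ) / 2 - R θ) ^ 2)
      (haarState n) :=
    integrable_haarState (cT.mul ((((ca.add cb).div_const 2).sub cR).pow 2))
  have e6 : ∫ θ, p θ * R θ ^ 2 ∂haarState n + ∫ θ, p θ * I θ ^ 2 ∂haarState n =
      ∫ θ, p θ * (weightAt a θ * weightAt b θ) ∂haarState n := by
    rw [← integral_add i3 i4]
    refine integral_congr_ae (Eventually.of_forall fun θ => ?_)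
    change p θ * R θ ^ 2 + p θ * I θ ^ 2 = p θ * (weightAt a θ * weightAt b θ)
    rw [← e5]; ring
  have e7 : ∫ θ, p θ * ((weightAt a θ + weightAt b θ) / 2 + R θ) ^ 2 ∂haarState n +
      ∫ θ, p θ * ((weightAt a θ + weightAt b θ) / 2 - R θ) ^ 2 ∂haarState n =
      (1 / 2) * ∫ θ, p θ * weightAt a θ ^ 2 ∂haarState n +
        (1 / 2) * ∫ θ, p θ * weightAt b θ ^ 2 ∂haarState n +
        ∫ θ, p θ * (weightAt a θ * weightAt b θ) ∂haarState n +
        2 * ∫ θ, p θ * R θ ^ 2 ∂haarState n := by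
    have j1 := (i1.const_mul (1 / 2)).add (i2.const_mul (1 / 2))
    have h1 := integral_add (i1.const_mul (1 / 2)) (i2.const_mul (1 / 2))
    have h2 := integral_add j1 i5
    have h3 := integral_add (j1.add i5) (i3.const_mul 2)
    simp only [Pi.add_apply] at h2 h3
    rw [← integral_add i6 i7, ← integral_const_mul, ← integral_const_mul, ← integral_const_mul,
      ← h1, ← h2, ← h3]
    refine integral_congr_ae (Eventually.of_forall fun θ => ?_)
    simp only
    ring
  linarith

/-- Insert the factor 1 = ∑ weights. Each of the 2^n - |T| coordinates outside `T` contributes the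
larger moment by symmetry, and each of the |T| coordinates inside contributes it twice by
`haarMoment_fourth`. -/
theorem haarMoment_insert {n : ℕ} {b : Bits n} {T : Finset (Bits n)} (hb : b ∉ T) :
    haarMoment T = ((2 : ℝ) ^ n + T.card) * haarMoment (insert b T) := by
  classical
  have cT := continuous_prod_weightAt T
  have h1 : haarMoment T = ∑ y, ∫ θ, (∏ z ∈ T, weightAt z θ) * weightAt y θ ∂haarState n := by
    have hi : ∀ y ∈ Finset.univ, Integrable (fun θ => (∏ z ∈ T, weightAt z θ) * weightAt y θ)
        (haarState n) := fun y _ => integrable_haarState (cT.mul (continuous_weightAt y))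
    rw [← integral_finsetSum _ hi]
    refine integral_congr_ae (Eventually.of_forall fun θ => ?_)
    simp only [← Finset.mul_sum, sum_weightAt, mul_one]
  have hins : ∀ y, y ∉ T →
      ∫ θ, (∏ z ∈ T, weightAt z θ) * weightAt y θ ∂haarState n = haarMoment (insert b T) := by
    intro y hy
    rw [haarMoment, ← integral_comp_sphereMap (swapIso y b) (continuous_prod_weightAt _)]
    refine integral_congr_ae (Eventually.of_forall fun θ => ?_)
    simp only [Finset.prod_insert hb, prod_weightAt_swap hy hb]
    rw [weightAt_swap, Equiv.swap_apply_right, mul_comm]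
  have hmem : ∀ y, y ∈ T →
      ∫ θ, (∏ z ∈ T, weightAt z θ) * weightAt y θ ∂haarState n = 2 * haarMoment (insert b T) := by
    intro y hy
    have hyb : y ≠ b := by rintro rfl; exact hb hy
    have h := haarMoment_fourth (T := T.erase y) hyb (by simp) (by simp [hb])
    have e1 : ∀ θ, (∏ z ∈ T, weightAt z θ) * weightAt y θ =
        (∏ z ∈ T.erase y, weightAt z θ) * weightAt y θ ^ 2 := by
      intro θ
      rw [← Finset.mul_prod_erase T _ hy]; ring
    have e2 : ∀ θ, ∏ z ∈ insert b T, weightAt z θ =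
        (∏ z ∈ T.erase y, weightAt z θ) * (weightAt y θ * weightAt b θ) := by
      intro θ
      rw [Finset.prod_insert hb, ← Finset.mul_prod_erase T _ hy]; ring
    simp only [haarMoment, e1, e2, h]
  rw [h1, ← Finset.sum_add_sum_compl T, Finset.sum_congr rfl hmem,
    Finset.sum_congr rfl fun y hy => hins y (by simpa using hy)]
  simp only [Finset.sum_const, nsmul_eq_mul, Finset.card_compl]
  have hc : T.card ≤ Fintype.card (Bits n) := Finset.card_le_univ T
  rw [Nat.cast_sub hc]
  simp
  ring

/-- The recursion makes the moment the inverse of a product of |T| factors, all at most M. Leaving M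
free allows one common bound for several sets at once. -/
theorem haarMoment_ge {n : ℕ} (T : Finset (Bits n)) {M : ℝ} (hM : (2 : ℝ) ^ n + T.card ≤ M) :
    (M ^ T.card)⁻¹ ≤ haarMoment T := by
  induction T using Finset.induction_on with
  | empty => simp [haarMoment]
  | insert b T hb ih =>
    rw [Finset.card_insert_of_notMem hb] at hM ⊢
    push_cast at hM
    have h := ih (by linarith)
    rw [haarMoment_insert hb] at h
    have hN : (0 : ℝ) < 2 ^ n := by positivity
    have hT : (0 : ℝ) ≤ T.card := by positivity
    have hMpos : 0 < M := by linarith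
    have hnn : 0 ≤ haarMoment (insert b T) :=
      integral_nonneg fun θ => Finset.prod_nonneg fun y _ => weightAt_nonneg y θ
    have h2 : (M ^ T.card)⁻¹ ≤ M * haarMoment (insert b T) :=
      h.trans (mul_le_mul_of_nonneg_right (by linarith) hnn)
    rw [pow_succ, mul_inv, ← div_eq_mul_inv, div_le_iff₀ hMpos]
    linarith

/-! ### Amplitudes of algorithms that query a state oracle -/

/-- Splitting a string into its first `a` and its last `b` bits. -/
def splitBits (a b : ℕ) : Bits (a + b) ≃ Bits a × Bits b where
  toFun u := (fstBits u, sndBits u)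
  invFun p := Fin.append p.1 p.2
  left_inv u := by
    funext i
    refine Fin.addCases (fun j => ?_) (fun j => ?_) i <;> simp [fstBits, sndBits]
  right_inv p := by
    ext i <;> simp [fstBits, sndBits]

theorem sum_splitBits {M : Type*} [AddCommMonoid M] {a b : ℕ} (f : Bits a → Bits b → M) :
    ∑ u : Bits (a + b), f (fstBits u) (sndBits u) = ∑ v, ∑ y, f v y := by
  rw [← Fintype.sum_prod_type' f, ← (splitBits a b).sum_comp]
  rfl

/-- The Kraus operator of a state oracle applied to the qubits `e`. -/
def stateKraus {d n N : ℕ} (ψ : Bits d → Bits n → ℂ) (e : Fin d ↪ Fin N) :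
    Matrix (Bits (N + n)) (Bits N) ℂ :=
  Matrix.of fun u v => if fstBits u = v then ψ (v ∘ e) (sndBits u) else 0

theorem agreeOff_and_comp_eq_iff {d N : ℕ} (e : Fin d ↪ Fin N) (u v : Bits N) :
    (AgreeOff (Set.range e) u v ∧ u ∘ e = v ∘ e) ↔ u = v := by
  constructor
  · rintro ⟨h1, h2⟩
    funext i
    by_cases hi : i ∈ Set.range e
    · obtain ⟨j, rfl⟩ := hi
      exact congrFun h2 j
    · exact h1 i hi
  · rintro rfl
    exact ⟨fun _ _ => rfl, rfl⟩

/-- A state oracle is controlled on its query register, so agreement off `e` and agreement on `e`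
combine to leave all old qubits unchanged; a query only appends a register. -/
theorem liftKraus_stateOracle {d n N : ℕ} (ψ : Bits d → Bits n → ℂ) (e : Fin d ↪ Fin N) (s : Unit) :
    liftKraus e ((stateOracle ψ).kraus s) = stateKraus ψ e := by
  ext u v
  simp only [liftKraus, stateOracle, stateKraus, Matrix.of_apply, ← ite_and,
    agreeOff_and_comp_eq_iff]

theorem applyAt_stateOracle {d n N : ℕ} (ψ : Bits d → Bits n → ℂ) (e : Fin d ↪ Fin N) (ρ : Op N) :
    (stateOracle ψ).applyAt e ρ = stateKraus ψ e * ρ * (stateKraus ψ e)ᴴ := by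
  rw [← liftKraus_stateOracle ψ e ()]
  exact Fintype.sum_unique (ι := Unit) _

theorem stateKraus_mul_apply {d n N : ℕ} {J : Type*} (ψ : Bits d → Bits n → ℂ) (e : Fin d ↪ Fin N)
    (L : Matrix (Bits N) J ℂ) (u : Bits (N + n)) (j : J) :
    (stateKraus ψ e * L) u j = ψ (fstBits u ∘ e) (sndBits u) * L (fstBits u) j := by
  simp [Matrix.mul_apply, stateKraus]

/-- The squared Hilbert–Schmidt norm. -/
def normSqSum {α J : Type*} [Fintype α] [Fintype J] (L : Matrix α J ℂ) : ℝ :=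
  ∑ u, ∑ j, Complex.normSq (L u j)

theorem normSqSum_eq_trace {α J : Type*} [Fintype α] [Fintype J] (L : Matrix α J ℂ) :
    (normSqSum L : ℂ) = (Lᴴ * L).trace := by
  simp only [normSqSum, Matrix.trace, Matrix.diag, Matrix.mul_apply, Matrix.conjTranspose_apply,
    Complex.ofReal_sum, Complex.normSq_eq_conj_mul_self]
  rw [Finset.sum_comm]
  rfl

theorem normSqSum_mul {α β J : Type*} [Fintype α] [Fintype β] [DecidableEq β] [Fintype J]
    {K : Matrix α β ℂ} (hK : Kᴴ * K = 1) (L : Matrix β J ℂ) :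
    normSqSum (K * L) = normSqSum L := by
  have : (normSqSum (K * L) : ℂ) = normSqSum L := by
    rw [normSqSum_eq_trace, normSqSum_eq_trace, Matrix.conjTranspose_mul, Matrix.mul_assoc,
      ← Matrix.mul_assoc Kᴴ, hK, Matrix.one_mul]
  exact_mod_cast this

theorem normSqSum_stateKraus_mul {d n N : ℕ} {J : Type*} [Fintype J] {ψ : Bits d → Bits n → ℂ}
    (hψ : ∀ x, ∑ y, Complex.normSq (ψ x y) = 1) (e : Fin d ↪ Fin N) (L : Matrix (Bits N) J ℂ) :
    normSqSum (stateKraus ψ e * L) = normSqSum L := by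
  simp only [normSqSum, stateKraus_mul_apply, Complex.normSq_mul]
  rw [sum_splitBits fun v y => ∑ j, Complex.normSq (ψ (v ∘ e) y) * Complex.normSq (L v j)]
  refine Finset.sum_congr rfl fun v _ => ?_
  simp only [← Finset.mul_sum, ← Finset.sum_mul, hψ, one_mul]

/-- The expectation of `P` of the output bit of a circuit with a state oracle, as a function of a
purification of the input. -/
def OracleCircuit.ampWeight {d n : ℕ} {J : Type*} [Fintype J] (P : Bool → ℝ)
    (ψ : Bits d → Bits n → ℂ) : {N : ℕ} → OracleCircuit d n N → Matrix (Bits N) J ℂ → ℝ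
  | _, .measure i, L => ∑ w, P (w i) * ∑ j, Complex.normSq (L w j)
  | _, .gate g C, L => C.ampWeight P ψ (g.mat * L)
  | _, .query e C, L => C.ampWeight P ψ (stateKraus ψ e * L)

/-- The indicator of the output bit `b`. -/
def outcomeIs (b c : Bool) : ℝ := if c = b then 1 else 0

theorem outcomeIs_nonneg (b c : Bool) : 0 ≤ outcomeIs b c := by
  unfold outcomeIs; split_ifs <;> norm_num

theorem conj_mul_conj {α β J : Type*} [Fintype α] [Fintype β] [Fintype J] (K : Matrix β α ℂ)
    (L : Matrix α J ℂ) : K * (L * Lᴴ) * Kᴴ = (K * L) * (K * L)ᴴ := by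
  rw [Matrix.conjTranspose_mul]; simp only [Matrix.mul_assoc]

/-- Passing to a factor `L` of the density matrix, with columns indexed by a purifying system, makes
a query act linearly on amplitudes. This is what the expansion in characters needs. -/
theorem accept_eq_ampWeight {d n N : ℕ} {J : Type*} [Fintype J] (ψ : Bits d → Bits n → ℂ)
    (C : OracleCircuit d n N) (L : Matrix (Bits N) J ℂ) :
    C.accept (stateOracle ψ) (L * Lᴴ) = C.ampWeight (outcomeIs true) ψ L := by
  induction C with
  | measure i =>
    simp only [OracleCircuit.accept, OracleCircuit.ampWeight, outcomeIs, ite_mul, one_mul, zero_mul]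
    refine Finset.sum_congr rfl fun w _ => ?_
    simp [Matrix.mul_apply, Complex.normSq_apply]
  | gate g C ih => rw [OracleCircuit.accept, conj_mul_conj, ih]; rfl
  | query e C ih => rw [OracleCircuit.accept, applyAt_stateOracle, conj_mul_conj, ih]; rfl

/-! ### Unitarity of the gates -/

theorem update_ne_update_not {N : ℕ} (u : Bits N) (i : Fin N) : Function.update u i (!u i) ≠ u := by
  intro h
  have := congrFun h i
  simp at this

theorem agreeOff_singleton_iff {N : ℕ} (i : Fin N) (u v : Bits N) :
    AgreeOff {i} u v ↔ u = v ∨ u = Function.update v i (!v i) := by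
  constructor
  · intro h
    by_cases hi : u i = v i
    · left
      funext j
      by_cases hj : j = i
      · rw [hj, hi]
      · exact h j hj
    · right
      funext j
      by_cases hj : j = i
      · subst hj
        simp only [Function.update_self]
        revert hi
        cases u j <;> cases v j <;> simp
      · rw [Function.update_of_ne hj]
        exact h j hj
  · rintro (rfl | rfl) j hj
    · rfl
    · exact Function.update_of_ne hj _ _

/-- The basis vector `|u⟩`. -/
def ket {N : ℕ} (u : Bits N) : Bits N → ℂ := Pi.single u 1

theorem mulVec_ket {α : Type*} {N : ℕ} (M : Matrix α (Bits N) ℂ) (u : Bits N) :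
    M *ᵥ ket u = fun v => M v u := by
  rw [ket, Matrix.mulVec_single_one]; rfl

theorem ket_apply {N : ℕ} (u v : Bits N) : ket u v = if v = u then 1 else 0 := by
  rw [ket, Pi.single_apply]

theorem H_mulVec_ket {N : ℕ} (i : Fin N) (u : Bits N) :
    (Gate.H i).mat *ᵥ ket u =
      (1 / (Real.sqrt 2 : ℂ)) • ((if u i then (-1 : ℂ) else 1) • ket u +
        ket (Function.update u i (!u i))) := by
  rw [mulVec_ket]
  funext v
  have hne := update_ne_update_not u i
  simp only [Gate.mat, Matrix.of_apply, agreeOff_singleton_iff, Pi.smul_apply, Pi.add_apply,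
    ket_apply, smul_eq_mul]
  by_cases h1 : v = u
  · subst h1
    simp only [true_or, if_true, hne.symm, if_false, Bool.and_self]
    ring
  · by_cases h2 : v = Function.update u i (!u i)
    · subst h2
      simp only [or_true, if_true, hne, if_false, Function.update_self, Bool.not_and_self]
      simp
    · simp [h1, h2]

theorem T_mulVec_ket {N : ℕ} (i : Fin N) (u : Bits N) :
    (Gate.T i).mat *ᵥ ket u =
      (if u i then Complex.exp (Complex.I * (Real.pi / 4 : ℝ)) else 1) • ket u := by
  rw [mulVec_ket]
  funext v
  by_cases h : v = u
  · subst h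
    simp [Gate.mat, ket_apply]
  · simp [Gate.mat, ket_apply, h]

theorem CNOT_mulVec_ket {N : ℕ} (c t : Fin N) (h : c ≠ t) (u : Bits N) :
    (Gate.CNOT c t h).mat *ᵥ ket u = ket (Function.update u t (xor (u t) (u c))) := by
  rw [mulVec_ket]
  funext v
  simp [Gate.mat, ket_apply]

theorem matrix_ext_ket {α : Type*} {N : ℕ} {A B : Matrix α (Bits N) ℂ}
    (h : ∀ u, A *ᵥ ket u = B *ᵥ ket u) : A = B := by
  ext v u
  have := congrFun (h u) v
  simpa [mulVec_ket] using this

theorem H_mul_self {N : ℕ} (i : Fin N) : (Gate.H i).mat * (Gate.H i).mat = 1 := by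
  refine matrix_ext_ket fun u => ?_
  rw [← Matrix.mulVec_mulVec, H_mulVec_ket, Matrix.mulVec_smul, Matrix.mulVec_add,
    Matrix.mulVec_smul, H_mulVec_ket, H_mulVec_ket, Matrix.one_mulVec]
  have h0 := sqrt_two_ne_zero
  have h2 := sqrt_two_mul_self
  have hh : (1 / (Real.sqrt 2 : ℂ)) * (1 / (Real.sqrt 2 : ℂ)) = 1 / 2 := by
    rw [div_mul_div_comm, h2]; norm_num
  simp only [Function.update_self, Function.update_idem, Bool.not_not, Function.update_eq_self]
  rw [smul_comm, ← smul_add, smul_smul, hh]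
  cases u i <;> simp only [Bool.not_true, Bool.not_false, if_true, Bool.false_eq_true, if_false] <;> module

theorem H_conjTranspose {N : ℕ} (i : Fin N) : (Gate.H i).matᴴ = (Gate.H i).mat := by
  ext u v
  simp only [Matrix.conjTranspose_apply, Gate.mat, Matrix.of_apply]
  have : AgreeOff {i} v u ↔ AgreeOff {i} u v :=
    ⟨fun h j hj => (h j hj).symm, fun h j hj => (h j hj).symm⟩
  rw [Bool.and_comm]
  by_cases h : AgreeOff {i} u v
  · rw [if_pos h, if_pos (this.2 h)]
    split_ifs <;> simp
  · rw [if_neg h, if_neg fun h' => h (this.1 h'), star_zero]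

theorem gate_conjTranspose_mul {N : ℕ} (g : Gate N) : g.matᴴ * g.mat = 1 := by
  cases g with
  | H i => rw [H_conjTranspose, H_mul_self]
  | T i =>
    rw [show (Gate.T i).mat = Matrix.diagonal fun u : Bits N =>
      if u i then Complex.exp (Complex.I * (Real.pi / 4 : ℝ)) else 1 from rfl,
      Matrix.diagonal_conjTranspose, Matrix.diagonal_mul_diagonal, ← Matrix.diagonal_one]
    congr 1
    funext u
    simp only [Pi.star_apply]
    split_ifs
    · rw [Complex.star_def, ← Complex.exp_conj, ← Complex.exp_add, map_mul, Complex.conj_I,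
        Complex.conj_ofReal, neg_mul, neg_add_cancel, Complex.exp_zero]
    · simp
  | CNOT c t h =>
    refine matrix_ext_ket fun u => ?_
    rw [← Matrix.mulVec_mulVec, CNOT_mulVec_ket, Matrix.one_mulVec, mulVec_ket]
    funext v
    simp only [Matrix.conjTranspose_apply, Gate.mat, Matrix.of_apply, ket_apply]
    have hinj : Function.update u t (xor (u t) (u c)) = Function.update v t (xor (v t) (v c)) ↔
        v = u := by
      constructor
      · intro he
        have hj : ∀ j, j ≠ t → u j = v j := fun j hj => by
          have := congrFun he j
          rwa [Function.update_of_ne hj, Function.update_of_ne hj] at this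
        funext j
        by_cases hjt : j = t
        · subst hjt
          have := congrFun he j
          rw [Function.update_self, Function.update_self, hj c h] at this
          exact (Bool.xor_left_inj.1 this).symm
        · exact (hj j hjt).symm
      · rintro rfl; rfl
    simp only [hinj]
    split_ifs <;> simp

/-- Conservation of total probability. It ties the two outcomes together, so that lower bounds for
both give upper bounds as well. -/
theorem ampWeight_one {d n N : ℕ} {J : Type*} [Fintype J] {ψ : Bits d → Bits n → ℂ}
    (hψ : ∀ x, ∑ y, Complex.normSq (ψ x y) = 1) (C : OracleCircuit d n N)
    (L : Matrix (Bits N) J ℂ) :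
    C.ampWeight (fun _ => 1) ψ L = normSqSum L := by
  induction C with
  | measure i => simp [OracleCircuit.ampWeight, normSqSum]
  | gate g C ih => rw [OracleCircuit.ampWeight, ih, normSqSum_mul (gate_conjTranspose_mul g)]
  | query e C ih => rw [OracleCircuit.ampWeight, ih, normSqSum_stateKraus_mul hψ]

theorem ampWeight_add {d n N : ℕ} {J : Type*} [Fintype J] (ψ : Bits d → Bits n → ℂ)
    (P Q : Bool → ℝ) (C : OracleCircuit d n N) (L : Matrix (Bits N) J ℂ) :
    C.ampWeight (fun b => P b + Q b) ψ L = C.ampWeight P ψ L + C.ampWeight Q ψ L := by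
  induction C with
  | measure i => simp [OracleCircuit.ampWeight, add_mul, Finset.sum_add_distrib]
  | gate g C ih => exact ih _
  | query e C ih => exact ih _

theorem outcomeIs_add (b : Bool) : outcomeIs true b + outcomeIs false b = 1 := by
  cases b <;> simp [outcomeIs]

/-! ### Averages over random signs -/

/-- The sign `(-1)^b`. -/
def boolSign (b : Bool) : ℂ := if b then -1 else 1

theorem boolSign_mul_self (b : Bool) : boolSign b * boolSign b = 1 := by
  cases b <;> simp [boolSign]

theorem star_boolSign (b : Bool) : star (boolSign b) = boolSign b := by
  cases b <;> simp [boolSign]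

theorem normSq_boolSign (b : Bool) : Complex.normSq (boolSign b) = 1 := by
  cases b <;> simp [boolSign]

/-- The character `g ↦ ∏_{w ∈ S} (-1)^{g w}`. -/
def signChar {W : Type*} (S : Finset W) (g : W → Bool) : ℂ := ∏ w ∈ S, boolSign (g w)

theorem signChar_mul_self {W : Type*} (S : Finset W) (g : W → Bool) :
    signChar S g * signChar S g = 1 := by
  rw [signChar, ← Finset.prod_mul_distrib]
  exact Finset.prod_eq_one fun w _ => boolSign_mul_self _

theorem star_signChar {W : Type*} (S : Finset W) (g : W → Bool) :
    star (signChar S g) = signChar S g := by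
  rw [signChar, star_prod]
  exact Finset.prod_congr rfl fun w _ => star_boolSign _

theorem symmDiff_singleton_of_mem {W : Type*} [DecidableEq W] {S : Finset W} {w : W} (h : w ∈ S) :
    symmDiff S {w} = S.erase w := by
  ext v
  simp only [Finset.mem_symmDiff, Finset.mem_singleton, Finset.mem_erase]
  by_cases hv : v = w
  · subst hv; simp [h]
  · simp [hv]

theorem symmDiff_singleton_of_notMem {W : Type*} [DecidableEq W] {S : Finset W} {w : W}
    (h : w ∉ S) : symmDiff S {w} = insert w S := by
  ext v
  simp only [Finset.mem_symmDiff, Finset.mem_singleton, Finset.mem_insert]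
  by_cases hv : v = w
  · subst hv; simp [h]
  · simp [hv]

/-- Signs square to 1, so a record matters only through the parity of its number of occurrences.
Hence a query acts on index sets by symmetric difference. -/
theorem signChar_symmDiff_singleton {W : Type*} [DecidableEq W] (S : Finset W) (w : W)
    (g : W → Bool) : signChar (symmDiff S {w}) g = boolSign (g w) * signChar S g := by
  by_cases h : w ∈ S
  · rw [symmDiff_singleton_of_mem h, signChar, signChar, ← Finset.mul_prod_erase S _ h, ← mul_assoc,
      boolSign_mul_self, one_mul]
  · rw [symmDiff_singleton_of_notMem h, signChar, signChar, Finset.prod_insert h]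

/-- The sum over g factorizes over the points of `W`, and the factor at a point that lies in exactly
one of the two sets vanishes. -/
theorem sum_signChar_mul {W : Type*} [Fintype W] [DecidableEq W] (S T : Finset W) (hST : S ≠ T) :
    ∑ g : W → Bool, signChar S g * signChar T g = 0 := by
  have h1 : ∀ g : W → Bool, signChar S g * signChar T g =
      ∏ w, ((if w ∈ S then boolSign (g w) else 1) * (if w ∈ T then boolSign (g w) else 1)) := by
    intro g
    rw [Finset.prod_mul_distrib, Finset.prod_ite_mem, Finset.prod_ite_mem, Finset.univ_inter,
      Finset.univ_inter]
    rfl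
  simp only [h1]
  have h2 := Finset.prod_univ_sum (fun _ : W => (Finset.univ : Finset Bool))
    (fun w b => (if w ∈ S then boolSign b else 1) * (if w ∈ T then boolSign b else 1))
  rw [Fintype.piFinset_univ] at h2
  rw [← h2]
  obtain ⟨w, hw⟩ : ∃ w, ¬ (w ∈ S ↔ w ∈ T) := by
    by_contra! h
    exact hST (Finset.ext h)
  refine Finset.prod_eq_zero (Finset.mem_univ w) ?_
  rw [Fintype.sum_bool]
  by_cases h3 : w ∈ S <;> by_cases h4 : w ∈ T
  · exact absurd (iff_of_true h3 h4) hw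
  · simp [h3, h4, boolSign]
  · simp [h3, h4, boolSign]
  · exact absurd (iff_of_false h3 h4) hw

/-- Parseval's identity for random signs. -/
theorem sum_normSq_signChar {W : Type*} [Fintype W] [DecidableEq W] (a : Finset W → ℂ) :
    ∑ g : W → Bool, Complex.normSq (∑ S, signChar S g * a S) =
      Fintype.card (W → Bool) * ∑ S, Complex.normSq (a S) := by
  have key : (∑ g : W → Bool, Complex.normSq (∑ S, signChar S g * a S) : ℂ) =
      Fintype.card (W → Bool) * ∑ S, (Complex.normSq (a S) : ℂ) := by
    have h1 : ∀ g : W → Bool, (Complex.normSq (∑ S, signChar S g * a S) : ℂ) =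
        ∑ S, ∑ T, (signChar S g * signChar T g) * (star (a S) * a T) := by
      intro g
      rw [Complex.normSq_eq_conj_mul_self, ← Complex.star_def, star_sum, Finset.sum_mul_sum]
      refine Finset.sum_congr rfl fun S _ => Finset.sum_congr rfl fun T _ => ?_
      rw [star_mul', star_signChar]
      ring
    simp only [h1]
    rw [Finset.sum_comm, Finset.mul_sum]
    refine Finset.sum_congr rfl fun S _ => ?_
    rw [Finset.sum_comm, Finset.sum_eq_single S]
    · simp only [signChar_mul_self, one_mul, Finset.sum_const, nsmul_eq_mul]
      rw [Complex.normSq_eq_conj_mul_self]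
      rfl
    · intro T _ hT
      rw [← Finset.sum_mul, sum_signChar_mul S T hT.symm, zero_mul]
    · simp
  exact_mod_cast key

/-! ### Collision-free query records -/

/-- The pairs of a query and a basis state of the reply. -/
abbrev Record (d n : ℕ) : Type := Bits d × Bits n

/-- The component of a query in which the record `w` occurs. -/
def recordKraus {d n N : ℕ} (w : Record d n) (e : Fin d ↪ Fin N) :
    Matrix (Bits (N + n)) (Bits N) ℂ :=
  stateKraus (fun x y => if (x, y) = w then 1 else 0) e

theorem recordKraus_mul_apply {d n N : ℕ} {J : Type*} (w : Record d n) (e : Fin d ↪ Fin N)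
    (L : Matrix (Bits N) J ℂ) (u : Bits (N + n)) (j : J) :
    (recordKraus w e * L) u j =
      if (fstBits u ∘ e, sndBits u) = w then L (fstBits u) j else 0 := by
  rw [recordKraus, stateKraus_mul_apply, ite_mul, one_mul, zero_mul]

theorem stateKraus_eq_sum {d n N : ℕ} (ψ : Bits d → Bits n → ℂ) (e : Fin d ↪ Fin N) :
    stateKraus ψ e = ∑ w : Record d n, ψ w.1 w.2 • recordKraus w e := by
  ext u v
  rw [Matrix.sum_apply]
  simp only [stateKraus, recordKraus, Matrix.smul_apply, Matrix.of_apply, smul_eq_mul]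
  by_cases h : fstBits u = v
  · simp [h]
  · simp [h]

/-- The contribution of the records `S`, each occurring exactly once, to the expectation of `P` of
the output bit. -/
def OracleCircuit.recordWeight {d n : ℕ} {J : Type*} [Fintype J] (P : Bool → ℝ) :
    {N : ℕ} → OracleCircuit d n N → (Finset (Record d n) → Matrix (Bits N) J ℂ) →
      Finset (Record d n) → ℝ
  | _, .measure i, L => fun S => ∑ w, P (w i) * ∑ j, Complex.normSq (L S w j)
  | _, .gate g C, L => C.recordWeight P fun S => g.mat * L S
  | _, .query e C, L => C.recordWeight P fun S => ∑ w ∈ S, recordKraus w e * L (S.erase w)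

theorem recordWeight_nonneg {d n N : ℕ} {J : Type*} [Fintype J] {P : Bool → ℝ} (hP : ∀ b, 0 ≤ P b)
    (C : OracleCircuit d n N) (L : Finset (Record d n) → Matrix (Bits N) J ℂ)
    (S : Finset (Record d n)) : 0 ≤ C.recordWeight P L S := by
  induction C with
  | measure i =>
    exact Finset.sum_nonneg fun w _ => mul_nonneg (hP _) <| Finset.sum_nonneg fun j _ =>
      Complex.normSq_nonneg _
  | gate g C ih => exact ih _
  | query e C ih => exact ih _

theorem recordWeight_add {d n N : ℕ} {J : Type*} [Fintype J] (P Q : Bool → ℝ)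
    (C : OracleCircuit d n N) (L : Finset (Record d n) → Matrix (Bits N) J ℂ)
    (S : Finset (Record d n)) :
    C.recordWeight (fun b => P b + Q b) L S = C.recordWeight P L S + C.recordWeight Q L S := by
  induction C with
  | measure i => simp [OracleCircuit.recordWeight, add_mul, Finset.sum_add_distrib]
  | gate g C ih => exact ih _
  | query e C ih => exact ih _

/-- The amplitudes `(-1)^{g(x, y)} ϑ_x(y)`. -/
def signedState {d n : ℕ} (ϑ : Bits d → Bits n → ℂ) (g : Record d n → Bool) (x : Bits d)
    (y : Bits n) : ℂ := boolSign (g (x, y)) * ϑ x y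

/-- An expansion in sign characters stays one after a query: the record w multiplies the character
of S by its sign, and reindexing along the involution S ↦ S ∆ {w} collects the coefficients. -/
theorem stateKraus_signedState_mul {d n N : ℕ} {J : Type*} (ϑ : Bits d → Bits n → ℂ)
    (g : Record d n → Bool) (e : Fin d ↪ Fin N)
    (M : Finset (Record d n) → Matrix (Bits N) J ℂ) :
    stateKraus (signedState ϑ g) e * ∑ S, signChar S g • M S =
      ∑ S, signChar S g • ∑ w : Record d n, ϑ w.1 w.2 • (recordKraus w e * M (symmDiff S {w})) := by
  rw [stateKraus_eq_sum, Matrix.sum_mul]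
  simp only [Finset.smul_sum]
  rw [Finset.sum_comm]
  refine Finset.sum_congr rfl fun w _ => ?_
  rw [Matrix.mul_sum]
  have hinv : Function.Involutive fun S : Finset (Record d n) => symmDiff S {w} := fun S =>
    symmDiff_symmDiff_cancel_right _ _
  rw [← Equiv.sum_comp hinv.toPerm]
  refine Finset.sum_congr rfl fun S _ => ?_
  simp only [Function.Involutive.coe_toPerm,
    signChar_symmDiff_singleton, signedState]
  rw [Matrix.smul_mul, Matrix.mul_smul, smul_smul, smul_smul]
  congr 1
  rw [Prod.mk.eta]
  linear_combination (ϑ w.1 w.2 * signChar S g) * boolSign_mul_self (g w)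

/-- After k queries only characters of sets with at most k elements occur. A set with exactly k
elements can arise only from histories without a repeated record, so its coefficient is the product
of the amplitudes over the set times a matrix `L` that does not know ϑ. Both facts are the invariant
of the induction over the remaining circuit. At the measurement Parseval removes the interference
between different sets, and the sets of full size alone give the lower bound. -/
theorem sum_ampWeight_signed_ge {d n N : ℕ} {J : Type*} [Fintype J] {P : Bool → ℝ}
    (hP : ∀ b, 0 ≤ P b) (ϑ : Bits d → Bits n → ℂ) (C : OracleCircuit d n N) (k : ℕ)
    (M L : Finset (Record d n) → Matrix (Bits N) J ℂ) (hM : ∀ S, k < S.card → M S = 0)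
    (hML : ∀ S, S.card = k → M S = (∏ w ∈ S, ϑ w.1 w.2) • L S) :
    Fintype.card (Record d n → Bool) *
        ∑ S ∈ Finset.powersetCard (k + C.queries) Finset.univ,
          Complex.normSq (∏ w ∈ S, ϑ w.1 w.2) * C.recordWeight P L S ≤
      ∑ g : Record d n → Bool, C.ampWeight P (signedState ϑ g) (∑ S, signChar S g • M S) := by
  induction C generalizing k with
  | measure i =>
    simp only [OracleCircuit.queries, OracleCircuit.recordWeight, OracleCircuit.ampWeight, add_zero]
    have h1 : ∀ (g : Record d n → Bool) w j, (∑ S, signChar S g • M S) w j =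
        ∑ S, signChar S g * M S w j := by
      intro g w j
      rw [Matrix.sum_apply]; rfl
    simp only [h1]
    rw [Finset.sum_comm]
    simp only [← Finset.mul_sum]
    have h2 : ∀ w, ∑ g : Record d n → Bool, ∑ j, Complex.normSq (∑ S, signChar S g * M S w j) =
        Fintype.card (Record d n → Bool) * ∑ S, ∑ j, Complex.normSq (M S w j) := by
      intro w
      rw [Finset.sum_comm]
      simp only [sum_normSq_signChar fun S => M S w _, ← Finset.mul_sum]
      rw [Finset.sum_comm]
    simp only [h2]
    have h3 : ∑ w : Bits _, P (w i) * (Fintype.card (Record d n → Bool) *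
        ∑ S, ∑ j, Complex.normSq (M S w j)) =
        Fintype.card (Record d n → Bool) * ∑ S, ∑ w : Bits _, P (w i) *
          ∑ j, Complex.normSq (M S w j) := by
      rw [Finset.sum_comm, Finset.mul_sum]
      refine Finset.sum_congr rfl fun w _ => ?_
      rw [← Finset.mul_sum]; ring
    rw [h3]
    refine mul_le_mul_of_nonneg_left ?_ (Nat.cast_nonneg _)
    -- The smaller sets stem from histories with collisions; their contribution is nonnegative and
    -- is dropped.
    refine le_trans (le_of_eq ?_) (Finset.sum_le_sum_of_subset_of_nonneg
      (Finset.subset_univ (Finset.powersetCard k Finset.univ)) fun S _ _ =>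
        Finset.sum_nonneg fun w _ => mul_nonneg (hP _) <| Finset.sum_nonneg fun j _ =>
          Complex.normSq_nonneg _)
    refine Finset.sum_congr rfl fun S hS => ?_
    rw [hML S (Finset.mem_powersetCard.1 hS).2, Finset.mul_sum]
    refine Finset.sum_congr rfl fun w _ => ?_
    simp only [Matrix.smul_apply, smul_eq_mul, Complex.normSq_mul, ← Finset.mul_sum]
    ring
  | gate g C ih =>
    have h := ih k (fun S => g.mat * M S) (fun S => g.mat * L S)
      (fun S hS => by rw [hM S hS, Matrix.mul_zero])
      (fun S hS => by rw [hML S hS, Matrix.mul_smul])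
    simpa only [OracleCircuit.queries, OracleCircuit.recordWeight, OracleCircuit.ampWeight,
      Matrix.mul_sum, Matrix.mul_smul] using h
  | query e C ih =>
    have h := ih (k + 1)
      (fun S => ∑ w : Record d n, ϑ w.1 w.2 • (recordKraus w e * M (symmDiff S {w})))
      (fun S => ∑ w ∈ S, recordKraus w e * L (S.erase w)) ?_ ?_
    · simp only [OracleCircuit.queries, OracleCircuit.recordWeight, OracleCircuit.ampWeight,
        stateKraus_signedState_mul]
      rwa [← add_assoc, add_right_comm]
    · intro S hS
      refine Finset.sum_eq_zero fun w _ => ?_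
      rw [hM, Matrix.mul_zero, smul_zero]
      by_cases hw : w ∈ S
      · rw [symmDiff_singleton_of_mem hw, Finset.card_erase_of_mem hw]; omega
      · rw [symmDiff_singleton_of_notMem hw, Finset.card_insert_of_notMem hw]; omega
    -- For a set of full size k + 1, a record outside it would have to come from a set of size k +
    -- 2, whose coefficient vanishes. So only the removal of an element of S contributes.
    · intro S hS
      rw [← Finset.sum_subset (Finset.subset_univ S), Finset.smul_sum]
      · refine Finset.sum_congr rfl fun w hw => ?_
        rw [symmDiff_singleton_of_mem hw, hML _ (by rw [Finset.card_erase_of_mem hw]; omega),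
          Matrix.mul_smul, smul_smul, Finset.mul_prod_erase S (fun w => ϑ w.1 w.2) hw]
      · intro w _ hw
        rw [symmDiff_singleton_of_notMem hw, hM _ (by rw [Finset.card_insert_of_notMem hw]; omega),
          Matrix.mul_zero, smul_zero]

theorem sum_four_comm {α β γ δ M : Type*} [AddCommMonoid M] (s : Finset α) (t : Finset β)
    (u : Finset γ) (v : Finset δ) (f : α → β → γ → δ → M) :
    ∑ a ∈ s, ∑ b ∈ t, ∑ c ∈ u, ∑ x ∈ v, f a b c x =
      ∑ b ∈ t, ∑ x ∈ v, ∑ c ∈ u, ∑ a ∈ s, f a b c x := by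
  rw [Finset.sum_comm]
  refine Finset.sum_congr rfl fun b _ => ?_
  rw [Finset.sum_comm, Finset.sum_comm (s := v)]
  refine Finset.sum_congr rfl fun c _ => ?_
  rw [Finset.sum_comm]

/-- Each basis state after the query determines the record that was added, so different records do
not interfere. A set of size k contains at most k records with the current query, which leaves at
least 2^n - k replies that extend it without collision. -/
theorem normSqSum_record_step {d n N : ℕ} {J : Type*} [Fintype J] (e : Fin d ↪ Fin N)
    (L : Finset (Record d n) → Matrix (Bits N) J ℂ) (k : ℕ) :
    ((2 : ℝ) ^ n - k) * ∑ S ∈ Finset.powersetCard k Finset.univ, normSqSum (L S) ≤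
      ∑ S ∈ Finset.powersetCard (k + 1) Finset.univ,
        normSqSum (∑ w ∈ S, recordKraus w e * L (S.erase w)) := by
  have h1 : ∀ S : Finset (Record d n), normSqSum (∑ w ∈ S, recordKraus w e * L (S.erase w)) =
      ∑ v : Bits N, ∑ y : Bits n, ∑ j, if (v ∘ e, y) ∈ S then
        Complex.normSq (L (S.erase (v ∘ e, y)) v j) else 0 := by
    intro S
    rw [← sum_splitBits fun v y => ∑ j, if (v ∘ e, y) ∈ S then
      Complex.normSq (L (S.erase (v ∘ e, y)) v j) else 0]
    refine Finset.sum_congr rfl fun u _ => Finset.sum_congr rfl fun j _ => ?_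
    rw [Matrix.sum_apply]
    simp only [recordKraus_mul_apply, Finset.sum_ite_eq]
    split_ifs <;> simp
  simp only [h1]
  -- Removing w matches the (k+1)-sets that contain w with the k-sets that avoid it.
  have h2 : ∀ (w : Record d n) (f : Finset (Record d n) → ℝ),
      (∑ S ∈ Finset.powersetCard (k + 1) Finset.univ, if w ∈ S then f (S.erase w) else 0) =
        ∑ S ∈ Finset.powersetCard k Finset.univ, if w ∈ S then 0 else f S := by
    intro w f
    have h0 : (∑ S ∈ Finset.powersetCard k Finset.univ, if w ∈ S then 0 else f S) =
        ∑ S ∈ (Finset.powersetCard k Finset.univ).filter fun S => w ∉ S, f S := by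
      rw [Finset.sum_filter]
      exact Finset.sum_congr rfl fun S _ => (ite_not _ _ _).symm
    rw [← Finset.sum_filter, h0]
    refine Finset.sum_bij' (fun S _ => S.erase w) (fun S _ => insert w S) ?_ ?_ ?_ ?_ ?_
    · intro S hS
      simp only [Finset.mem_filter, Finset.mem_powersetCard_univ] at hS ⊢
      exact ⟨by rw [Finset.card_erase_of_mem hS.2, hS.1]; rfl, Finset.notMem_erase _ _⟩
    · intro S hS
      simp only [Finset.mem_filter, Finset.mem_powersetCard_univ] at hS ⊢
      exact ⟨by rw [Finset.card_insert_of_notMem hS.2, hS.1], Finset.mem_insert_self _ _⟩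
    · intro S hS
      exact Finset.insert_erase (Finset.mem_filter.1 hS).2
    · intro S hS
      exact Finset.erase_insert (Finset.mem_filter.1 hS).2
    · intro S _; rfl
  have h3 : ∑ S ∈ Finset.powersetCard (k + 1) (Finset.univ : Finset (Record d n)),
      ∑ v : Bits N, ∑ y : Bits n, ∑ j, (if (v ∘ e, y) ∈ S then
        Complex.normSq (L (S.erase (v ∘ e, y)) v j) else 0) =
      ∑ S ∈ Finset.powersetCard k (Finset.univ : Finset (Record d n)),
        ∑ v : Bits N, ∑ j, ∑ y : Bits n, (if (v ∘ e, y) ∈ S then 0 else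
          Complex.normSq (L S v j)) := by
    rw [sum_four_comm]
    conv_rhs => rw [Finset.sum_comm]
    refine Finset.sum_congr rfl fun v _ => ?_
    conv_rhs => rw [Finset.sum_comm]
    refine Finset.sum_congr rfl fun j _ => ?_
    conv_rhs => rw [Finset.sum_comm]
    exact Finset.sum_congr rfl fun y _ => h2 (v ∘ e, y) fun S => Complex.normSq (L S v j)
  rw [h3, Finset.mul_sum]
  refine Finset.sum_le_sum fun S hS => ?_
  rw [normSqSum, Finset.mul_sum]
  refine Finset.sum_le_sum fun v _ => ?_
  rw [Finset.mul_sum]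
  refine Finset.sum_le_sum fun j _ => ?_
  rw [Finset.sum_ite, Finset.sum_const_zero, zero_add, Finset.sum_const, nsmul_eq_mul]
  refine mul_le_mul_of_nonneg_right ?_ (Complex.normSq_nonneg _)
  have h4 : (Finset.univ.filter fun y : Bits n => (v ∘ e, y) ∈ S).card ≤ k := by
    rw [← (Finset.mem_powersetCard.1 hS).2]
    exact Finset.card_le_card_of_injOn (fun y => (v ∘ e, y))
      (fun y hy => (Finset.mem_filter.1 hy).2) fun y _ z _ h => (Prod.mk.inj h).2
  have h5 := Finset.card_filter_add_card_filter_not (s := (Finset.univ : Finset (Bits n)))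
    (fun y : Bits n => (v ∘ e, y) ∈ S)
  have h6 : (Finset.univ : Finset (Bits n)).card = 2 ^ n := by simp
  rw [h6] at h5
  have h7 : (2 : ℝ) ^ n = (Finset.univ.filter fun y : Bits n => (v ∘ e, y) ∈ S).card +
    (Finset.univ.filter fun y : Bits n => ¬ (v ∘ e, y) ∈ S).card := by exact_mod_cast h5.symm
  have h8 : ((Finset.univ.filter fun y : Bits n => (v ∘ e, y) ∈ S).card : ℝ) ≤ k := by
    exact_mod_cast h4
  linarith

theorem sum_normSqSum_nonneg {d n N : ℕ} {J : Type*} [Fintype J]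
    (L : Finset (Record d n) → Matrix (Bits N) J ℂ) (k : ℕ) :
    0 ≤ ∑ S ∈ Finset.powersetCard k Finset.univ, normSqSum (L S) :=
  Finset.sum_nonneg fun _ _ => Finset.sum_nonneg fun _ _ => Finset.sum_nonneg fun _ _ =>
    Complex.normSq_nonneg _

/-- Iterating `normSqSum_record_step` gives a product of factors 2^n - k. The upper limit K for all
record sizes bounds every factor below by the same nonnegative number. -/
theorem sum_recordWeight_one_ge {d n N : ℕ} {J : Type*} [Fintype J] (C : OracleCircuit d n N)
    (k K : ℕ) (hK : k + C.queries ≤ K) (hKn : (K : ℝ) ≤ 2 ^ n)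
    (L : Finset (Record d n) → Matrix (Bits N) J ℂ) :
    ((2 : ℝ) ^ n - K) ^ C.queries * ∑ S ∈ Finset.powersetCard k Finset.univ, normSqSum (L S) ≤
      ∑ S ∈ Finset.powersetCard (k + C.queries) Finset.univ,
        C.recordWeight (fun _ => 1) L S := by
  induction C generalizing k with
  | measure i => simp [OracleCircuit.queries, OracleCircuit.recordWeight, normSqSum]
  | gate g C ih =>
    have h := ih k hK (fun S => g.mat * L S)
    simpa only [normSqSum_mul (gate_conjTranspose_mul g), OracleCircuit.queries,
      OracleCircuit.recordWeight] using h
  | query e C ih =>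
    simp only [OracleCircuit.queries] at hK ⊢
    have h := ih (k + 1) (by omega) (fun S => ∑ w ∈ S, recordKraus w e * L (S.erase w))
    have h2 := normSqSum_record_step e L k
    rw [← add_assoc, add_right_comm]
    refine le_trans ?_ h
    rw [pow_succ, mul_assoc]
    refine mul_le_mul_of_nonneg_left (le_trans ?_ h2) (pow_nonneg (by linarith) _)
    refine mul_le_mul_of_nonneg_right ?_ (sum_normSqSum_nonneg L k)
    have : (k : ℝ) ≤ K := by exact_mod_cast (by omega : k ≤ K)
    linarith

/-! ### Random signs versus Haar random states -/

/-- The amplitudes of a family of pure states. -/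
def stateAmp {d n : ℕ} (θ : Bits d → PureState n) (x : Bits d) (y : Bits n) : ℂ :=
  (θ x : EuclideanSpace ℂ (Bits n)) y

theorem continuous_ampWeight {Θ : Type*} [TopologicalSpace Θ] {d n N : ℕ} {J : Type*} [Fintype J]
    (P : Bool → ℝ) {ψ : Θ → Bits d → Bits n → ℂ} (hψ : ∀ x y, Continuous fun θ => ψ θ x y)
    (C : OracleCircuit d n N) {L : Θ → Matrix (Bits N) J ℂ} (hL : Continuous L) :
    Continuous fun θ => C.ampWeight P (ψ θ) (L θ) := by
  induction C with
  | measure i =>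
    exact continuous_finsetSum _ fun w _ => continuous_const.mul <|
      continuous_finsetSum _ fun j _ => Complex.continuous_normSq.comp (hL.matrix_elem w j)
  | gate g C ih => exact ih (continuous_const.matrix_mul hL)
  | query e C ih =>
    refine ih (Continuous.matrix_mul (continuous_matrix fun u v => ?_) hL)
    simp only [stateKraus, Matrix.of_apply]
    split_ifs
    · exact hψ _ _
    · exact continuous_const

theorem continuous_stateAmp {d n : ℕ} (x : Bits d) (y : Bits n) :
    Continuous fun θ : Bits d → PureState n => stateAmp θ x y :=
  (continuous_coord y).comp (continuous_apply x)

theorem integrable_pi_haarState {d n : ℕ} {f : (Bits d → PureState n) → ℝ} (hf : Continuous f) :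
    Integrable f (Measure.pi fun _ : Bits d => haarState n) :=
  hf.integrable_of_hasCompactSupport (HasCompactSupport.of_compactSpace f)

/-- The sign `(-1)^b` as an element of the unit circle. -/
def circleSign (b : Bool) : Circle :=
  ⟨boolSign b, by cases b <;> simp [boolSign, Submonoid.unitSphere]⟩

/-- Multiplication of the amplitudes of a family of pure states by signs. -/
def flipSigns {d n : ℕ} (g : Record d n → Bool) (θ : Bits d → PureState n) (x : Bits d) :
    PureState n :=
  sphereMap (phaseIso fun y => circleSign (g (x, y))) (θ x)

theorem stateAmp_flipSigns {d n : ℕ} (g : Record d n → Bool) (θ : Bits d → PureState n) :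
    stateAmp (flipSigns g θ) = signedState (stateAmp θ) g := by
  funext x y
  change phaseIso (fun y => circleSign (g (x, y))) (θ x : EuclideanSpace ℂ (Bits n)) y = _
  rw [phaseIso_apply]
  rfl

/-- A sign change is a linear isometry in each component, so random signs can be inserted into Haar
random states at no cost. -/
theorem integral_flipSigns {d n : ℕ} (g : Record d n → Bool) {f : (Bits d → PureState n) → ℝ}
    (hf : Continuous f) :
    ∫ θ, f (flipSigns g θ) ∂(Measure.pi fun _ : Bits d => haarState n) =
      ∫ θ, f θ ∂(Measure.pi fun _ : Bits d => haarState n) := by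
  have h : MeasurePreserving (flipSigns g) (Measure.pi fun _ : Bits d => haarState n)
      (Measure.pi fun _ : Bits d => haarState n) :=
    measurePreserving_pi _ _ fun x =>
      measurePreserving_sphereMap (phaseIso fun y => circleSign (g (x, y)))
  conv_rhs => rw [← h.map_eq]
  rw [integral_map h.measurable.aemeasurable hf.aestronglyMeasurable]

theorem sum_signChar_single {W : Type*} [Fintype W] [DecidableEq W] {α J : Type*}
    (g : W → Bool) (L : Matrix α J ℂ) :
    ∑ S : Finset W, signChar S g • (if S = ∅ then L else 0) = L := by
  rw [Finset.sum_eq_single ∅]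
  · simp [signChar]
  · intro S _ hS
    rw [if_neg hS, smul_zero]
  · simp

/-- The contribution of collision-free records to the expectation of `P` of the output bit. -/
def OracleCircuit.freeWeight {d n N : ℕ} {J : Type*} [Fintype J] (P : Bool → ℝ)
    (C : OracleCircuit d n N) (L : Matrix (Bits N) J ℂ) : ℝ :=
  ∑ S ∈ Finset.powersetCard C.queries Finset.univ,
    C.recordWeight P (fun S => if S = ∅ then L else 0) S

theorem expect_ampWeight_ge {d n N : ℕ} {J : Type*} [Fintype J] {P : Bool → ℝ}
    (hP : ∀ b, 0 ≤ P b) (ϑ : Bits d → Bits n → ℂ) (C : OracleCircuit d n N)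
    (L : Matrix (Bits N) J ℂ) :
    ∑ S ∈ Finset.powersetCard C.queries Finset.univ, Complex.normSq (∏ w ∈ S, ϑ w.1 w.2) *
        C.recordWeight P (fun S => if S = ∅ then L else 0) S ≤
      𝔼 g : Record d n → Bool, C.ampWeight P (signedState ϑ g) L := by
  have h := sum_ampWeight_signed_ge hP ϑ C 0 (fun S => if S = ∅ then L else 0)
    (fun S => if S = ∅ then L else 0)
    (fun S hS => by rw [if_neg]; rintro rfl; simp at hS)
    (fun S hS => by rw [Finset.card_eq_zero.1 hS]; simp)
  simp only [sum_signChar_single, zero_add] at h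
  rw [Fintype.expect_eq_sum_div_card, le_div_iff₀ (by exact_mod_cast Fintype.card_pos), mul_comm]
  exact h

/-- The amplitudes `(-1)^{g(x, y)} / 2^{n/2}`. -/
def signState {d n : ℕ} (g : Record d n → Bool) : Bits d → Bits n → ℂ :=
  signedState (fun _ _ => 1 / (Real.sqrt 2 : ℂ) ^ n) g

theorem normSq_inv_sqrt_pow (n : ℕ) :
    Complex.normSq (1 / (Real.sqrt 2 : ℂ) ^ n) = 1 / (2 : ℝ) ^ n := by
  rw [map_div₀, map_pow, Complex.normSq_ofReal, Real.mul_self_sqrt (by norm_num), map_one]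

theorem sum_normSq_signState {d n : ℕ} (g : Record d n → Bool) (x : Bits d) :
    ∑ y, Complex.normSq (signState g x y) = 1 := by
  simp only [signState, signedState, map_mul, normSq_boolSign, normSq_inv_sqrt_pow]
  simp

theorem sum_normSq_stateAmp {d n : ℕ} (θ : Bits d → PureState n) (x : Bits d) :
    ∑ y, Complex.normSq (stateAmp θ x y) = 1 :=
  sum_weightAt (θ x)

/-- With uniform amplitudes each of the q distinct records has weight 2^{-n}. -/
theorem expect_signState_ge {d n N : ℕ} {J : Type*} [Fintype J] {P : Bool → ℝ}
    (hP : ∀ b, 0 ≤ P b) (C : OracleCircuit d n N) (L : Matrix (Bits N) J ℂ) :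
    (((2 : ℝ) ^ n) ^ C.queries)⁻¹ * C.freeWeight P L ≤
      𝔼 g : Record d n → Bool, C.ampWeight P (signState g) L := by
  refine le_trans (le_of_eq ?_) (expect_ampWeight_ge hP _ C L)
  rw [OracleCircuit.freeWeight, Finset.mul_sum]
  refine Finset.sum_congr rfl fun S hS => ?_
  rw [map_prod]
  simp only [normSq_inv_sqrt_pow, Finset.prod_const, (Finset.mem_powersetCard.1 hS).2]
  simp

theorem integral_prod_record {d n : ℕ} (S : Finset (Record d n)) :
    ∫ θ, Complex.normSq (∏ w ∈ S, stateAmp θ w.1 w.2) ∂(Measure.pi fun _ : Bits d => haarState n) =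
      ∏ x, haarMoment (Finset.univ.filter fun y => (x, y) ∈ S) := by
  have h : ∀ θ : Bits d → PureState n, Complex.normSq (∏ w ∈ S, stateAmp θ w.1 w.2) =
      ∏ x, ∏ y ∈ Finset.univ.filter (fun y => (x, y) ∈ S), weightAt y (θ x) := by
    intro θ
    rw [map_prod]
    simp only [Finset.prod_filter]
    rw [← Fintype.prod_prod_type' fun x y => if (x, y) ∈ S then weightAt y (θ x) else 1,
      Finset.prod_ite_mem, Finset.univ_inter]
    rfl
  simp only [h]
  exact integral_fintype_prod_eq_prod fun x (v : PureState n) =>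
    ∏ y ∈ Finset.univ.filter (fun y => (x, y) ∈ S), weightAt y v

/-- The states for different queries are independent, so the mean is a product of single-state
moments. All of them are bounded with the common base 2^n + |S|, and the exponents add up to |S|. -/
theorem integral_prod_record_ge {d n : ℕ} (S : Finset (Record d n)) :
    (((2 : ℝ) ^ n + S.card) ^ S.card)⁻¹ ≤
      ∫ θ, Complex.normSq (∏ w ∈ S, stateAmp θ w.1 w.2)
        ∂(Measure.pi fun _ : Bits d => haarState n) := by
  rw [integral_prod_record]
  have hc : S.card = ∑ x, (Finset.univ.filter fun y => (x, y) ∈ S).card := by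
    simp only [Finset.card_filter]
    rw [← Fintype.sum_prod_type' fun x y => if (x, y) ∈ S then 1 else 0]
    simp
  have hle : ∀ x, (Finset.univ.filter fun y => (x, y) ∈ S).card ≤ S.card := fun x => by
    rw [hc]
    exact Finset.single_le_sum (f := fun x => (Finset.univ.filter fun y => (x, y) ∈ S).card)
      (fun _ _ => Nat.zero_le _) (Finset.mem_univ x)
  have hprod : (((2 : ℝ) ^ n + S.card) ^ S.card)⁻¹ =
      ∏ x, (((2 : ℝ) ^ n + S.card) ^ (Finset.univ.filter fun y => (x, y) ∈ S).card)⁻¹ := by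
    rw [Finset.prod_inv_distrib, Finset.prod_pow_eq_pow_sum, ← hc]
  rw [hprod]
  refine Finset.prod_le_prod (fun x _ => by positivity) fun x _ => haarMoment_ge _ ?_
  have : ((Finset.univ.filter fun y => (x, y) ∈ S).card : ℝ) ≤ S.card := by exact_mod_cast hle x
  linarith

/-- By sign invariance the integrand may be averaged over random signs. Then the bound by
collision-free records holds for every fixed family of states, and integrating it leaves only
moments. -/
theorem integral_ampWeight_ge {d n N : ℕ} {J : Type*} [Fintype J] {P : Bool → ℝ}
    (hP : ∀ b, 0 ≤ P b) (C : OracleCircuit d n N) (L : Matrix (Bits N) J ℂ) :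
    (((2 : ℝ) ^ n + C.queries) ^ C.queries)⁻¹ * C.freeWeight P L ≤
      ∫ θ, C.ampWeight P (stateAmp θ) L ∂(Measure.pi fun _ : Bits d => haarState n) := by
  have hcont : Continuous fun θ : Bits d → PureState n => C.ampWeight P (stateAmp θ) L :=
    continuous_ampWeight P continuous_stateAmp C continuous_const
  have hS : ∀ S : Finset (Record d n), Continuous fun θ : Bits d → PureState n =>
      Complex.normSq (∏ w ∈ S, stateAmp θ w.1 w.2) := fun S =>
    Complex.continuous_normSq.comp (continuous_finsetProd _ fun w _ => continuous_stateAmp _ _)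
  have h1 : ∫ θ, C.ampWeight P (stateAmp θ) L ∂(Measure.pi fun _ : Bits d => haarState n) =
      ∫ θ, 𝔼 g : Record d n → Bool, C.ampWeight P (signedState (stateAmp θ) g) L
        ∂(Measure.pi fun _ : Bits d => haarState n) := by
    simp only [Fintype.expect_eq_sum_div_card]
    have hg : ∀ g ∈ (Finset.univ : Finset (Record d n → Bool)),
        Integrable (fun θ => C.ampWeight P (signedState (stateAmp θ) g) L)
          (Measure.pi fun _ : Bits d => haarState n) := fun g _ =>
      integrable_pi_haarState <| continuous_ampWeight P
        (fun x y => continuous_const.mul (continuous_stateAmp x y)) C continuous_const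
    rw [integral_div, integral_finsetSum _ hg]
    simp only [← stateAmp_flipSigns, integral_flipSigns _ hcont]
    simp
  rw [h1]
  have h2 : ∫ θ, ∑ S ∈ Finset.powersetCard C.queries Finset.univ,
      Complex.normSq (∏ w ∈ S, stateAmp θ w.1 w.2) *
        C.recordWeight P (fun S => if S = ∅ then L else 0) S
      ∂(Measure.pi fun _ : Bits d => haarState n) ≤
      ∫ θ, 𝔼 g : Record d n → Bool, C.ampWeight P (signedState (stateAmp θ) g) L
        ∂(Measure.pi fun _ : Bits d => haarState n) := by
    refine integral_mono ?_ ?_ fun θ => expect_ampWeight_ge hP _ C L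
    · exact integrable_pi_haarState <| continuous_finsetSum _ fun S _ => (hS S).mul continuous_const
    · simp only [Fintype.expect_eq_sum_div_card]
      exact integrable_pi_haarState <| (continuous_finsetSum _ fun g _ => continuous_ampWeight P
        (fun x y => continuous_const.mul (continuous_stateAmp x y)) C continuous_const).div_const _
  refine le_trans ?_ h2
  rw [integral_finsetSum _ fun S _ => (integrable_pi_haarState (hS S)).mul_const _,
    OracleCircuit.freeWeight, Finset.mul_sum]
  refine Finset.sum_le_sum fun S hS' => ?_
  rw [integral_mul_const]
  refine mul_le_mul_of_nonneg_right ?_ (recordWeight_nonneg hP C _ S)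
  have := integral_prod_record_ge S
  rwa [(Finset.mem_powersetCard.1 hS').2] at this

theorem freeWeight_add {d n N : ℕ} {J : Type*} [Fintype J] (C : OracleCircuit d n N)
    (L : Matrix (Bits N) J ℂ) :
    C.freeWeight (outcomeIs true) L + C.freeWeight (outcomeIs false) L =
      C.freeWeight (fun _ => 1) L := by
  simp only [OracleCircuit.freeWeight, ← Finset.sum_add_distrib, ← recordWeight_add, outcomeIs_add]

theorem freeWeight_one_ge {d n N : ℕ} {J : Type*} [Fintype J] (C : OracleCircuit d n N)
    (L : Matrix (Bits N) J ℂ) (hq : (C.queries : ℝ) ≤ 2 ^ n) :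
    ((2 : ℝ) ^ n - C.queries) ^ C.queries * normSqSum L ≤ C.freeWeight (fun _ => 1) L := by
  have h := sum_recordWeight_one_ge C 0 C.queries (by omega) hq
    (fun S : Finset (Record d n) => if S = ∅ then L else 0)
  simpa [OracleCircuit.freeWeight] using h

theorem freeWeight_nonneg {d n N : ℕ} {J : Type*} [Fintype J] {P : Bool → ℝ}
    (hP : ∀ b, 0 ≤ P b) (C : OracleCircuit d n N) (L : Matrix (Bits N) J ℂ) :
    0 ≤ C.freeWeight P L :=
  Finset.sum_nonneg fun S _ => recordWeight_nonneg hP C _ S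

/-- Since a ≤ 1 - R and a' ≥ κ A, the difference a - a' is at most 1 - (A + R) + (1 - κ) A, hence at
most 2t. The opposite difference is bounded the same way with R in place of A. -/
theorem abs_sub_le_of_two_outcomes {a b a' b' A R κ t : ℝ} (hab : a + b = 1) (hab' : a' + b' = 1)
    (hA : A ≤ a) (hR : R ≤ b) (hA' : κ * A ≤ a') (hR' : κ * R ≤ b') (hA0 : 0 ≤ A) (hR0 : 0 ≤ R)
    (hκ : 1 - t ≤ κ) (hκ1 : κ ≤ 1) (hAR : 1 - t ≤ A + R) : |a - a'| ≤ 2 * t := by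
  have hAR1 : A + R ≤ 1 := by linarith
  rw [abs_le]
  constructor <;> nlinarith

/-- Bernoulli's inequality for (1 - q/N)^q, the guaranteed mass of collision-free records when the
amplitudes are uniform. -/
theorem one_sub_sq_div_le {N : ℝ} (hN : 0 < N) (q : ℕ) (hq : (q : ℝ) ≤ N) :
    1 - (q : ℝ) ^ 2 / N ≤ (N ^ q)⁻¹ * (N - q) ^ q := by
  have h : (N ^ q)⁻¹ * (N - q) ^ q = (1 + (-(q / N))) ^ q := by
    rw [← inv_pow, ← mul_pow]
    congr 1
    field_simp
    ring
  rw [h]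
  have hd : (q : ℝ) / N ≤ 1 := (div_le_one hN).2 hq
  refine le_trans (le_of_eq ?_) (one_add_mul_le_pow (by linarith) q)
  ring

/-- Bernoulli's inequality again, for the ratio of the Haar bound to the weight with uniform
amplitudes. -/
theorem one_sub_sq_div_le' {N : ℝ} (hN : 0 < N) (q : ℕ) :
    1 - (q : ℝ) ^ 2 / N ≤ ((N + q) ^ q)⁻¹ * N ^ q := by
  have hq : (0 : ℝ) ≤ q := Nat.cast_nonneg q
  have hNq : 0 < N + q := by linarith
  have h : ((N + q) ^ q)⁻¹ * N ^ q = (1 + (-(q / (N + q)))) ^ q := by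
    rw [← inv_pow, ← mul_pow]
    congr 1
    field_simp
    ring
  rw [h]
  have hd : (q : ℝ) / (N + q) ≤ 1 := (div_le_one hNq).2 (by linarith)
  refine le_trans ?_ (one_add_mul_le_pow (by linarith) q)
  have : (q : ℝ) / (N + q) ≤ q / N := div_le_div_of_nonneg_left hq hN (by linarith)
  have h2 : (q : ℝ) ^ 2 / N = q * (q / N) := by ring
  rw [h2]
  nlinarith

theorem ampWeight_expect_close {d n N : ℕ} {J : Type*} [Fintype J] (C : OracleCircuit d n N)
    (L : Matrix (Bits N) J ℂ) (hL : normSqSum L = 1) :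
    |(𝔼 g : Record d n → Bool, C.ampWeight (outcomeIs true) (signState g) L) -
        ∫ θ, C.ampWeight (outcomeIs true) (stateAmp θ) L
          ∂(Measure.pi fun _ : Bits d => haarState n)| ≤
      2 * (C.queries / (2 : ℝ) ^ ((n : ℝ) / 2)) := by
  set a := 𝔼 g : Record d n → Bool, C.ampWeight (outcomeIs true) (signState g) L
  set b := 𝔼 g : Record d n → Bool, C.ampWeight (outcomeIs false) (signState g) L
  set a' := ∫ θ, C.ampWeight (outcomeIs true) (stateAmp θ) L
          ∂(Measure.pi fun _ : Bits d => haarState n)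
  set b' := ∫ θ, C.ampWeight (outcomeIs false) (stateAmp θ) L
          ∂(Measure.pi fun _ : Bits d => haarState n)
  have hsum : ∀ ψ : Bits d → Bits n → ℂ, (∀ x, ∑ y, Complex.normSq (ψ x y) = 1) →
      C.ampWeight (outcomeIs true) ψ L + C.ampWeight (outcomeIs false) ψ L = 1 := by
    intro ψ hψ
    rw [← ampWeight_add]
    simp only [outcomeIs_add]
    rw [ampWeight_one hψ, hL]
  have hab : a + b = 1 := by
    rw [← Finset.expect_add_distrib]
    simp only [hsum _ (sum_normSq_signState _)]
    exact Fintype.expect_const 1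
  have hab' : a' + b' = 1 := by
    rw [← integral_add
      (integrable_pi_haarState (continuous_ampWeight _ continuous_stateAmp C continuous_const))
      (integrable_pi_haarState (continuous_ampWeight _ continuous_stateAmp C continuous_const))]
    simp only [hsum _ (sum_normSq_stateAmp _)]
    simp
  set M : ℝ := 2 ^ n with hM
  have hM0 : 0 < M := by positivity
  have hMq : 0 < M + C.queries := by positivity
  have hF : ∀ b, 0 ≤ C.freeWeight (outcomeIs b) L := fun b => freeWeight_nonneg (outcomeIs_nonneg b) C L
  set A := (M ^ C.queries)⁻¹ * C.freeWeight (outcomeIs true) L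
  set R := (M ^ C.queries)⁻¹ * C.freeWeight (outcomeIs false) L
  have hA : A ≤ a := expect_signState_ge (outcomeIs_nonneg true) C L
  have hR : R ≤ b := expect_signState_ge (outcomeIs_nonneg false) C L
  have hA0 : 0 ≤ A := mul_nonneg (by positivity) (hF true)
  have hR0 : 0 ≤ R := mul_nonneg (by positivity) (hF false)
  set κ := ((M + C.queries) ^ C.queries)⁻¹ * M ^ C.queries
  have hκ : ∀ f : ℝ, κ * ((M ^ C.queries)⁻¹ * f) = ((M + C.queries) ^ C.queries)⁻¹ * f := by
    intro f
    have : M ^ C.queries ≠ 0 := by positivity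
    rw [← mul_assoc, mul_assoc _ (M ^ C.queries), mul_inv_cancel₀ this, mul_one]
  have hA' : κ * A ≤ a' := by
    rw [hκ]; exact integral_ampWeight_ge (outcomeIs_nonneg true) C L
  have hR' : κ * R ≤ b' := by
    rw [hκ]; exact integral_ampWeight_ge (outcomeIs_nonneg false) C L
  have hκ1 : κ ≤ 1 := by
    rw [inv_mul_le_iff₀ (by positivity), mul_one]
    exact pow_le_pow_left₀ hM0.le (by linarith [(Nat.cast_nonneg C.queries : (0 : ℝ) ≤ _)]) _
  have hκ0 : 0 ≤ κ := by positivity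
  have hs : (2 : ℝ) ^ ((n : ℝ) / 2) * (2 : ℝ) ^ ((n : ℝ) / 2) = M := by
    rw [← Real.rpow_add (by norm_num), add_halves, Real.rpow_natCast]
  have hs0 : (0 : ℝ) < (2 : ℝ) ^ ((n : ℝ) / 2) := by positivity
  set s := (2 : ℝ) ^ ((n : ℝ) / 2)
  have hq0 : (0 : ℝ) ≤ C.queries := Nat.cast_nonneg _
  -- If q ≤ s = 2^{n/2}, then q²/2^n = (q/s)² ≤ q/s. Otherwise the claimed bound exceeds 1 and holds
  -- for any two probabilities.
  rcases le_or_gt (C.queries : ℝ) s with hqs | hqs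
  · have hs1 : 1 ≤ s := Real.one_le_rpow (by norm_num) (by positivity)
    have hqM : (C.queries : ℝ) ≤ M := by nlinarith
    have hAR : 1 - (C.queries : ℝ) ^ 2 / M ≤ A + R := by
      rw [← mul_add, freeWeight_add]
      refine (one_sub_sq_div_le hM0 _ hqM).trans (mul_le_mul_of_nonneg_left ?_ (by positivity))
      have := freeWeight_one_ge C L hqM
      rwa [hL, mul_one] at this
    refine (abs_sub_le_of_two_outcomes hab hab' hA hR hA' hR' hA0 hR0 (one_sub_sq_div_le' hM0 _) hκ1
      hAR).trans (mul_le_mul_of_nonneg_left ?_ (by norm_num))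
    rw [← hs, pow_two, mul_div_mul_comm]
    have h1 : (C.queries : ℝ) / s ≤ 1 := (div_le_one hs0).2 hqs
    have h2 : 0 ≤ (C.queries : ℝ) / s := by positivity
    nlinarith
  · have h1 : 1 ≤ (C.queries : ℝ) / s := (one_le_div hs0).2 hqs.le
    have ha : 0 ≤ a := hA0.trans hA
    have hb : 0 ≤ b := hR0.trans hR
    have ha' : 0 ≤ a' := (mul_nonneg hκ0 hA0).trans hA'
    have hb' : 0 ≤ b' := (mul_nonneg hκ0 hR0).trans hR'
    rw [abs_le]
    constructor <;> linarith

open scoped MatrixOrder in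
theorem exists_eq_conjTranspose_mul {α : Type*} [Fintype α] [DecidableEq α] {ρ : Matrix α α ℂ}
    (h : ρ.PosSemidef) : ∃ B : Matrix α α ℂ, ρ = Bᴴ * B :=
  CStarAlgebra.nonneg_iff_eq_star_mul_self.mp h.nonneg

/-- A purification of the input of an adversary. -/
theorem exists_purification {d n : ℕ} (A : Adversary d n) :
    ∃ L : Matrix (Bits (A.m + A.anc)) (Bits A.m) ℂ,
      L * Lᴴ = tensor A.advice (ketbra (zeroBits A.anc)) ∧ normSqSum L = 1 := by
  obtain ⟨B, hB⟩ := exists_eq_conjTranspose_mul A.posSemidef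
  let L : Matrix (Bits (A.m + A.anc)) (Bits A.m) ℂ := Matrix.of fun u j =>
    if sndBits u = zeroBits A.anc then Bᴴ (fstBits u) j else 0
  refine ⟨L, ?_, ?_⟩
  · ext u v
    simp only [Matrix.mul_apply, L, Matrix.conjTranspose_apply, Matrix.of_apply, tensor, ketbra, hB,
      Matrix.single_apply]
    by_cases hu : sndBits u = zeroBits A.anc <;> by_cases hv : sndBits v = zeroBits A.anc
    · simp [hu, hv]
    · simp [hv, Ne.symm hv]
    · simp [hu, Ne.symm hu]
    · simp [hu, Ne.symm hu]
  · have h1 : normSqSum L = normSqSum Bᴴ := by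
      rw [normSqSum, normSqSum, ← Finset.sum_congr rfl fun u _ => rfl]
      have := sum_splitBits (a := A.m) (b := A.anc) fun v y =>
        ∑ j, Complex.normSq (if y = zeroBits A.anc then Bᴴ v j else 0)
      refine (Finset.sum_congr rfl fun u _ => rfl).trans (this.trans ?_)
      refine Finset.sum_congr rfl fun v _ => ?_
      rw [Finset.sum_eq_single (zeroBits A.anc)]
      · simp
      · intro y _ hy
        simp [hy]
      · simp
    have h2 : (normSqSum L : ℂ) = 1 := by
      rw [h1, normSqSum_eq_trace, Matrix.conjTranspose_conjTranspose, Matrix.trace_mul_comm, ← hB,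
        A.trace_eq_one]
    exact_mod_cast h2

theorem signState_haar_close {d n : ℕ} (A : Adversary d n) :
    |(𝔼 g : Record d n → Bool, A.prob (stateOracle (signState g))) - haarProb A| ≤
      2 * (A.queries / (2 : ℝ) ^ ((n : ℝ) / 2)) := by
  obtain ⟨L, hL, hL1⟩ := exists_purification A
  have h := ampWeight_expect_close A.circ L hL1
  simp only [← accept_eq_ampWeight, hL] at h
  exact h

/-! ### Composition of Boolean circuits -/

/-- Extend a renaming of wires to one more wire. -/
def extendWires {w w' : ℕ} (e : Fin w → Fin w') : Fin (w + 1) → Fin (w' + 1) :=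
  Fin.snoc (α := fun _ => Fin (w' + 1)) (fun i => (e i).castSucc) (Fin.last w')

theorem snoc_comp_extendWires {w w' : ℕ} (e : Fin w → Fin w') (v : Bits w') (b : Bool) :
    (fun i => Fin.snoc (α := fun _ => Bool) v b (extendWires e i)) =
      Fin.snoc (α := fun _ => Bool) (fun i => v (e i)) b := by
  funext i
  refine Fin.lastCases ?_ (fun j => ?_) i <;> simp [extendWires]

/-- Renaming the input wires of a Boolean circuit. -/
def BoolCircuit.relocate {out : ℕ} :
    {w : ℕ} → BoolCircuit out w → {w' : ℕ} → (Fin w → Fin w') → BoolCircuit out w'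
  | _, .output o, _, e => .output fun i => e (o i)
  | _, .const b C, _, e => .const b (C.relocate (extendWires e))
  | _, .nand i j C, _, e => .nand (e i) (e j) (C.relocate (extendWires e))

theorem BoolCircuit.eval_relocate {out w w' : ℕ} (C : BoolCircuit out w) (e : Fin w → Fin w')
    (v : Bits w') : (C.relocate e).eval v = C.eval fun i => v (e i) := by
  induction C generalizing w' with
  | output o => rfl
  | const b C ih => simp only [relocate, eval, ih, snoc_comp_extendWires]
  | nand i j C ih => simp only [relocate, eval, ih, snoc_comp_extendWires]

theorem BoolCircuit.gates_relocate {out w w' : ℕ} (C : BoolCircuit out w) (e : Fin w → Fin w') :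
    (C.relocate e).gates = C.gates := by
  induction C generalizing w' with
  | output o => rfl
  | const b C ih => simp only [relocate, gates, ih]
  | nand i j C ih => simp only [relocate, gates, ih]

/-- Run `C`, then run `D` on the wires selected by `e` and the outputs of `C`. -/
def BoolCircuit.seq {out v w : ℕ} (D : BoolCircuit out (w + v)) :
    {w' : ℕ} → BoolCircuit v w' → (Fin w → Fin w') → BoolCircuit out w'
  | w', .output o, e => D.relocate (Fin.append e o : Fin (w + v) → Fin w')
  | _, .const b C, e => .const b (D.seq C fun i => (e i).castSucc)
  | _, .nand i j C, e => .nand i j (D.seq C fun i => (e i).castSucc)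

theorem BoolCircuit.eval_seq {out v w w' : ℕ} (D : BoolCircuit out (w + v)) (C : BoolCircuit v w')
    (e : Fin w → Fin w') (u : Bits w') :
    (D.seq C e).eval u = D.eval (Fin.append (fun i => u (e i)) (C.eval u)) := by
  induction C with
  | output o =>
    rw [seq, eval_relocate, eval]
    congr 1
    funext i
    refine Fin.addCases (fun j => ?_) (fun j => ?_) i <;> simp
  | const b C ih => simp [seq, eval, ih]
  | nand i j C ih => simp [seq, eval, ih]

theorem BoolCircuit.gates_seq {out v w w' : ℕ} (D : BoolCircuit out (w + v)) (C : BoolCircuit v w')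
    (e : Fin w → Fin w') : (D.seq C e).gates = C.gates + D.gates := by
  induction C with
  | output o => rw [seq, gates_relocate, gates, zero_add]
  | const b C ih => simp only [seq, gates, ih]; omega
  | nand i j C ih => simp only [seq, gates, ih]; omega

/-- `f` is computed by a Boolean circuit with at most `s` gates. -/
def Computes {w v : ℕ} (s : ℕ) (f : Bits w → Bits v) : Prop :=
  ∃ C : BoolCircuit v w, C.gates ≤ s ∧ C.eval = f

theorem Computes.mono {w v s t : ℕ} {f : Bits w → Bits v} (h : Computes s f) (hst : s ≤ t) :
    Computes t f := by
  obtain ⟨C, hC, rfl⟩ := h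
  exact ⟨C, hC.trans hst, rfl⟩

theorem computes_select {w v : ℕ} (o : Fin v → Fin w) :
    Computes 0 fun (x : Bits w) (i : Fin v) => x (o i) :=
  ⟨.output o, le_rfl, rfl⟩

theorem Computes.bind {w v out s t : ℕ} {f : Bits w → Bits v} {g : Bits (w + v) → Bits out}
    (hf : Computes s f) (hg : Computes t g) :
    Computes (s + t) fun x => g (Fin.append x (f x)) := by
  obtain ⟨C, hC, rfl⟩ := hf
  obtain ⟨D, hD, rfl⟩ := hg
  refine ⟨D.seq C id, ?_, ?_⟩
  · rw [BoolCircuit.gates_seq]; omega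
  · funext x
    rw [BoolCircuit.eval_seq]
    rfl

theorem Computes.relabel {w w' out s : ℕ} {g : Bits w → Bits out} (hg : Computes s g)
    (e : Fin w → Fin w') : Computes s fun x => g fun i => x (e i) := by
  obtain ⟨D, hD, rfl⟩ := hg
  exact ⟨D.relocate e, (BoolCircuit.gates_relocate D e).le.trans hD,
    funext fun x => BoolCircuit.eval_relocate D e x⟩

theorem Computes.comp {w v out s t : ℕ} {f : Bits w → Bits v} {g : Bits v → Bits out}
    (hg : Computes t g) (hf : Computes s f) : Computes (s + t) fun x => g (f x) := by
  have h := hf.bind (hg.relabel (Fin.natAdd w))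
  simpa using h

theorem Computes.append {w a b s t : ℕ} {f : Bits w → Bits a} {g : Bits w → Bits b}
    (hf : Computes s f) (hg : Computes t g) :
    Computes (s + t) fun x => (Fin.append (f x) (g x) : Bits (a + b)) := by
  have h := hf.bind ((hg.relabel (Fin.castAdd a)).bind
    (computes_select (Fin.append (fun i => Fin.castAdd b (Fin.natAdd w i))
      (fun i => Fin.natAdd (w + a) i) : Fin (a + b) → Fin (w + a + b))))
  rw [add_zero] at h
  convert h using 1
  funext x i
  refine Fin.addCases (fun j => ?_) (fun j => ?_) i <;> simp

/-- The bit-valued function `f` is computed by a Boolean circuit with at most `s` gates. -/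
def ComputesBit {w : ℕ} (s : ℕ) (f : Bits w → Bool) : Prop :=
  Computes s fun (x : Bits w) (_ : Fin 1) => f x

theorem Computes.bit {w v s : ℕ} {f : Bits w → Bits v} (hf : Computes s f) (i : Fin v) :
    ComputesBit s fun x => f x i := by
  have h := (computes_select fun _ : Fin 1 => i).comp hf
  rwa [add_zero] at h

theorem ComputesBit.mono {w s t : ℕ} {f : Bits w → Bool} (h : ComputesBit s f) (hst : s ≤ t) :
    ComputesBit t f := Computes.mono h hst

theorem ComputesBit.comp {w v s t : ℕ} {f : Bits w → Bits v} {g : Bits v → Bool}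
    (hg : ComputesBit t g) (hf : Computes s f) : ComputesBit (s + t) fun x => g (f x) :=
  Computes.comp hg hf

theorem computesBit_select {w : ℕ} (i : Fin w) : ComputesBit 0 fun x : Bits w => x i :=
  computes_select fun _ => i

theorem computesBit_const {w : ℕ} (b : Bool) : ComputesBit 1 fun _ : Bits w => b :=
  ⟨.const b (.output fun _ => Fin.last _), le_rfl, by funext x i; simp [BoolCircuit.eval]⟩

theorem ComputesBit.nand {w s t : ℕ} {f g : Bits w → Bool} (hf : ComputesBit s f)
    (hg : ComputesBit t g) : ComputesBit (s + t + 1) fun x => !(f x && g x) := by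
  have h : Computes 1 fun (x : Bits (1 + 1)) (_ : Fin 1) => !(x 0 && x 1) :=
    ⟨.nand 0 1 (.output fun _ => Fin.last _), le_rfl, by
      funext x i; rfl⟩
  exact h.comp (hf.append hg)

theorem ComputesBit.not {w s : ℕ} {f : Bits w → Bool} (hf : ComputesBit s f) :
    ComputesBit (s + 1) fun x => !(f x) := by
  have h : Computes 1 fun (x : Bits 1) (_ : Fin 1) => !(x 0) :=
    ⟨.nand 0 0 (.output fun _ => Fin.last _), le_rfl, by
      funext x i; exact congrArg Bool.not (Bool.and_self (x 0))⟩
  exact h.comp hf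

theorem ComputesBit.and {w s t : ℕ} {f g : Bits w → Bool} (hf : ComputesBit s f)
    (hg : ComputesBit t g) : ComputesBit (s + t + 2) fun x => f x && g x := by
  simpa using (hf.nand hg).not

theorem ComputesBit.or {w s t : ℕ} {f g : Bits w → Bool} (hf : ComputesBit s f)
    (hg : ComputesBit t g) : ComputesBit (s + t + 3) fun x => f x || g x := by
  have h := hf.not.nand hg.not
  simp only [Bool.not_and, Bool.not_not] at h
  exact h.mono (by omega)

theorem ComputesBit.xor {w s t : ℕ} {f g : Bits w → Bool} (hf : ComputesBit s f)
    (hg : ComputesBit t g) : ComputesBit (s + t + 4) fun x => Bool.xor (f x) (g x) := by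
  have h : Computes 4 fun (x : Bits (1 + 1)) (_ : Fin 1) => Bool.xor (x 0) (x 1) := by
    -- The exclusive or by four NAND gates; wires 2, 3 and 4 carry the results of the first three.
    refine ⟨.nand 0 1 (.nand 0 2 (.nand 1 2 (.nand 3 4 (.output fun _ => Fin.last _)))), le_rfl, ?_⟩
    funext x i
    have h0 : ∀ b : Bool, Fin.snoc (α := fun _ => Bool) x b (0 : Fin 3) = x 0 := fun b => rfl
    have h1 : ∀ b : Bool, Fin.snoc (α := fun _ => Bool) x b (1 : Fin 3) = x 1 := fun b => rfl
    have e : ∀ a b : Bool, (!(!(a && !(a && b)) && !(b && !(a && b)))) = Bool.xor a b := by decide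
    exact e (x 0) (x 1)
  exact h.comp (hf.append hg)

theorem ComputesBit.ite {w s t r : ℕ} {c f g : Bits w → Bool} (hc : ComputesBit r c)
    (hf : ComputesBit s f) (hg : ComputesBit t g) :
    ComputesBit (2 * r + s + t + 8) fun x => if c x then f x else g x := by
  have h := (hc.and hf).or (hc.not.and hg)
  have e : (fun x => if c x then f x else g x) = fun x => c x && f x || !(c x) && g x := by
    funext x
    cases c x <;> simp
  rw [e]
  exact h.mono (by omega)

theorem Computes.pi {w v s : ℕ} {f : Bits w → Bits v}
    (hf : ∀ i, ComputesBit s fun x => f x i) : Computes (v * s) f := by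
  induction v with
  | zero => exact ⟨.output fun i => i.elim0, by simp [BoolCircuit.gates], by
      funext x i; exact i.elim0⟩
  | succ v ih =>
    have h := (ih (f := fun x i => f x i.castSucc) fun i => hf i.castSucc).append (hf (Fin.last v))
    rw [Nat.succ_mul]
    convert h using 1
    funext x i
    refine Fin.lastCases ?_ (fun j => ?_) i
    · exact (Fin.append_right (fun i : Fin v => f x i.castSucc) (fun _ : Fin 1 => f x (Fin.last v))
        0).symm
    · exact (Fin.append_left (fun i : Fin v => f x i.castSucc) (fun _ : Fin 1 => f x (Fin.last v))
        j).symm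

theorem fstBits_append {a b : ℕ} (x : Bits a) (y : Bits b) : fstBits (Fin.append x y) = x :=
  funext fun i => Fin.append_left x y i

theorem sndBits_append {a b : ℕ} (x : Bits a) (y : Bits b) : sndBits (Fin.append x y) = y :=
  funext fun i => Fin.append_right x y i

/-! ### Arithmetic over the field with two elements -/

/-- The element of `ZMod 2` given by a bit. -/
def bitVal (b : Bool) : ZMod 2 := if b then 1 else 0

/-- The bit given by an element of `ZMod 2`. -/
def valBit (z : ZMod 2) : Bool := decide (z = 1)

theorem valBit_bitVal (b : Bool) : valBit (bitVal b) = b := by cases b <;> decide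

theorem bitVal_valBit (z : ZMod 2) : bitVal (valBit z) = z := by revert z; decide

theorem valBit_add (y z : ZMod 2) : valBit (y + z) = xor (valBit y) (valBit z) := by
  revert y z; decide

theorem valBit_mul (y z : ZMod 2) : valBit (y * z) = (valBit y && valBit z) := by
  revert y z; decide

theorem computesBit_sum {w s : ℕ} {I : Type*} (T : Finset I) {f : I → Bits w → ZMod 2}
    (hf : ∀ i, ComputesBit s fun x => valBit (f i x)) :
    ComputesBit (T.card * (s + 4) + 1) fun x => valBit (∑ i ∈ T, f i x) := by
  classical
  induction T using Finset.induction_on with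
  | empty =>
    simp only [Finset.sum_empty]
    exact (computesBit_const _).mono (by omega)
  | insert i T hi ih =>
    simp only [Finset.sum_insert hi, valBit_add, Finset.card_insert_of_notMem hi]
    exact ((hf i).xor ih).mono (by ring_nf; omega)

/-- A field with `2^m` elements. -/
abbrev BinField (m : ℕ) : Type := GaloisField 2 m

instance fintypeBinField (m : ℕ) : Fintype (BinField m) := Fintype.ofFinite _

/-- A basis of the field with `2 ^ (m + 1)` elements over the field with two elements. -/
def binBasis (m : ℕ) : Module.Basis (Fin (m + 1)) (ZMod 2) (BinField (m + 1)) :=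
  Module.finBasisOfFinrankEq _ _ (GaloisField.finrank 2 (Nat.succ_ne_zero m))

/-- The coordinates of a field element. -/
def fieldBits {m : ℕ} (z : BinField (m + 1)) : Bits (m + 1) :=
  fun i => valBit ((binBasis m).repr z i)

/-- The field element with given coordinates. -/
def bitsField {m : ℕ} (x : Bits (m + 1)) : BinField (m + 1) := ∑ i, bitVal (x i) • binBasis m i

theorem bitsField_fieldBits {m : ℕ} (z : BinField (m + 1)) : bitsField (fieldBits z) = z := by
  simp only [bitsField, fieldBits, bitVal_valBit]
  exact (binBasis m).sum_repr z

theorem fieldBits_bitsField {m : ℕ} (x : Bits (m + 1)) : fieldBits (bitsField x) = x := by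
  funext i
  rw [fieldBits, bitsField, Module.Basis.repr_sum_self, valBit_bitVal]

theorem fieldBits_add {m : ℕ} (y z : BinField (m + 1)) :
    fieldBits (y + z) = xorBits (fieldBits y) (fieldBits z) := by
  funext i
  simp [fieldBits, xorBits, valBit_add]

/-- `F` is computed, in coordinates, with at most `s` gates. -/
def ComputesField {w m : ℕ} (s : ℕ) (F : Bits w → BinField (m + 1)) : Prop :=
  Computes s fun x => fieldBits (F x)

theorem computesField_const {w m : ℕ} (c : BinField (m + 1)) :
    ComputesField (m + 1) fun _ : Bits w => c :=
  (Computes.pi fun i => computesBit_const (fieldBits c i)).mono (by omega)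

theorem ComputesField.add {w m s t : ℕ} {F G : Bits w → BinField (m + 1)} (hF : ComputesField s F)
    (hG : ComputesField t G) : ComputesField (s + t + (m + 1) * 4) fun x => F x + G x := by
  have h : Computes ((m + 1) * 4) fun x : Bits (m + 1 + (m + 1)) =>
      xorBits (fstBits x) (sndBits x) := by
    refine Computes.pi fun i => ?_
    exact ((computesBit_select (Fin.castAdd (m + 1) i)).xor
      (computesBit_select (Fin.natAdd (m + 1) i))).mono (by omega)
  have h2 := h.comp (Computes.append hF hG)
  unfold ComputesField
  simp only [fieldBits_add]
  simpa only [fstBits_append, sndBits_append] using h2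

/-- Multiplication is bilinear over the field with two elements, so each coordinate is a sum of
(m+1)² products of two bits with hardwired structure constants of the basis. A term costs 5 gates
and its addition 4, whence the 9. -/
theorem ComputesField.mul {w m s t : ℕ} {F G : Bits w → BinField (m + 1)} (hF : ComputesField s F)
    (hG : ComputesField t G) :
    ComputesField (s + t + (m + 1) * ((m + 1) * (m + 1) * 9 + 1)) fun x => F x * G x := by
  have h : Computes ((m + 1) * ((m + 1) * (m + 1) * 9 + 1)) fun x : Bits (m + 1 + (m + 1)) =>
      fieldBits (bitsField (fstBits x) * bitsField (sndBits x)) := by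
    refine Computes.pi fun i => ?_
    have e : ∀ x : Bits (m + 1 + (m + 1)),
        fieldBits (bitsField (fstBits x) * bitsField (sndBits x)) i =
        valBit (∑ p : Fin (m + 1) × Fin (m + 1),
          (binBasis m).repr (binBasis m p.1 * binBasis m p.2) i *
            (bitVal (fstBits x p.1) * bitVal (sndBits x p.2))) := by
      intro x
      rw [fieldBits, bitsField, bitsField, Finset.sum_mul_sum, Fintype.sum_prod_type]
      simp only [map_sum, Finsupp.coe_finsetSum, Finset.sum_apply, smul_mul_smul_comm, map_smul,
        Finsupp.coe_smul, Pi.smul_apply, smul_eq_mul]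
      congr 1
      exact Finset.sum_congr rfl fun j _ => Finset.sum_congr rfl fun k _ => by ring
    simp only [e]
    have hterm : ∀ p : Fin (m + 1) × Fin (m + 1), ComputesBit 5 fun x : Bits (m + 1 + (m + 1)) =>
        valBit ((binBasis m).repr (binBasis m p.1 * binBasis m p.2) i *
            (bitVal (fstBits x p.1) * bitVal (sndBits x p.2))) := by
      intro p
      simp only [valBit_mul, valBit_bitVal]
      exact ((computesBit_const _).and ((computesBit_select (Fin.castAdd (m + 1) p.1)).and
        (computesBit_select (Fin.natAdd (m + 1) p.2)))).mono (by omega)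
    refine (computesBit_sum Finset.univ hterm).mono ?_
    simp
  have h2 := h.comp (Computes.append hF hG)
  unfold ComputesField
  simpa only [fstBits_append, sndBits_append, bitsField_fieldBits] using h2

/-! ### Efficient functions with independent values at few points -/

/-- A string as a field element. -/
def embedField {a m : ℕ} (x : Bits a) : BinField (m + 1) :=
  bitsField fun i => if h : (i : ℕ) < a then x ⟨i, h⟩ else false

theorem embedField_injective {a m : ℕ} (ham : a ≤ m + 1) :
    Function.Injective (embedField : Bits a → BinField (m + 1)) := by
  intro x y hxy
  have h := congrArg fieldBits hxy
  rw [embedField, embedField, fieldBits_bitsField, fieldBits_bitsField] at h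
  funext i
  have := congrFun h ⟨i, by omega⟩
  simpa using this

theorem computesField_embed {a m : ℕ} :
    ComputesField (m + 1) (embedField : Bits a → BinField (m + 1)) := by
  unfold ComputesField
  simp only [embedField, fieldBits_bitsField]
  refine (Computes.pi (s := 1) fun i => ?_).mono (by omega)
  by_cases h : (i : ℕ) < a
  · simp only [h, dite_true]
    exact (computesBit_select _).mono (by omega)
  · simp only [h, dite_false]
    exact computesBit_const false

/-- The value of the polynomial with coefficients `c`. -/
def polyValue {m k : ℕ} (c : Fin k → BinField (m + 1)) (z : BinField (m + 1)) : BinField (m + 1) :=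
  ∑ j, c j * z ^ (j : ℕ)

theorem polyValue_add {m k : ℕ} (c c' : Fin k → BinField (m + 1)) (z : BinField (m + 1)) :
    polyValue (c + c') z = polyValue c z + polyValue c' z := by
  simp [polyValue, add_mul, Finset.sum_add_distrib]

/-- Horner's rule; the factor 20 (m+1)³ pays for one multiplication, one addition, the coefficient
and the embedding of the argument. -/
theorem computesField_poly {a m k : ℕ} (c : Fin k → BinField (m + 1)) :
    ComputesField ((k + 1) * (20 * (m + 1) ^ 3)) fun x : Bits a => polyValue c (embedField x) := by
  induction k with
  | zero =>
    simp only [polyValue, Finset.univ_eq_empty, Finset.sum_empty]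
    refine (computesField_const 0).mono ?_
    nlinarith [Nat.one_le_pow 2 (m + 1) (by omega), pow_succ (m + 1) 2]
  | succ k ih =>
    have e : ∀ x : Bits a, polyValue c (embedField x) = c 0 +
        embedField x * polyValue (fun j : Fin k => c j.succ) (embedField x) := by
      intro x
      simp only [polyValue]
      rw [Fin.sum_univ_succ, Finset.mul_sum]
      congr 1
      · simp
      · refine Finset.sum_congr rfl fun j _ => ?_
        simp only [Fin.val_succ, pow_succ]
        ring
    simp only [e]
    refine ((computesField_const (c 0)).add
      (computesField_embed.mul (ih fun j => c j.succ))).mono ?_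
    have h1 : 1 ≤ (m + 1) ^ 2 := Nat.one_le_pow _ _ (by omega)
    have h2 : m + 1 ≤ (m + 1) ^ 3 := Nat.le_self_pow (by omega) _
    have h3 : (m + 1) * ((m + 1) * (m + 1) * 9 + 1) = 9 * (m + 1) ^ 3 + (m + 1) := by ring
    rw [h3]
    nlinarith

/-- The hash function given by a polynomial. -/
def polyHash {a v m k : ℕ} (hv : v ≤ m + 1) (c : Fin k → BinField (m + 1)) (x : Bits a) : Bits v :=
  fun i => fieldBits (polyValue c (embedField x)) (Fin.castLE hv i)

theorem xorBits_self_left {v : ℕ} (x y : Bits v) : xorBits x (xorBits x y) = y := by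
  funext i
  simp [xorBits]

/-- Lagrange interpolation: prescribed values at |T| ≤ k points are attained by a polynomial with k
coefficients. The bits of the values beyond v are padded with zeros. -/
theorem exists_polyHash_eq {a v m k : ℕ} (ha : a ≤ m + 1) (hv : v ≤ m + 1) (f : Bits a → Bits v)
    (T : Finset (Bits a)) (hT : T.card ≤ k) :
    ∃ c : Fin k → BinField (m + 1), ∀ x ∈ T, polyHash hv c x = f x := by
  let r : Bits a → BinField (m + 1) := fun x =>
    bitsField fun i => if h : (i : ℕ) < v then f x ⟨i, h⟩ else false
  have hinj : Set.InjOn (embedField : Bits a → BinField (m + 1)) T :=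
    (embedField_injective ha).injOn
  let p := Lagrange.interpolate T (embedField : Bits a → BinField (m + 1)) r
  refine ⟨fun j => p.coeff j, fun x hx => ?_⟩
  have h1 : polyValue (fun j : Fin k => p.coeff j) (embedField x) = r x := by
    rw [← Lagrange.eval_interpolate_at_node r hinj hx]
    rcases Nat.eq_zero_or_pos k with rfl | hk
    · have : T = ∅ := Finset.card_eq_zero.1 (Nat.le_zero.1 hT)
      simp [this] at hx
    · have hdeg : p.natDegree < k := by
        by_cases hp : p = 0
        · rw [hp, Polynomial.natDegree_zero]; exact hk
        · rw [Polynomial.natDegree_lt_iff_degree_lt hp]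
          exact (Lagrange.degree_interpolate_lt r hinj).trans_le (by exact_mod_cast hT)
      rw [Polynomial.eval_eq_sum_range' hdeg, polyValue,
        Fin.sum_univ_eq_sum_range (fun j => p.coeff j * embedField x ^ j) k]
  funext i
  rw [polyHash, h1, fieldBits_bitsField]
  simp

theorem polyHash_add {a v m k : ℕ} (hv : v ≤ m + 1) (c c' : Fin k → BinField (m + 1))
    (x : Bits a) : polyHash hv (c + c') x = xorBits (polyHash hv c x) (polyHash hv c' x) := by
  funext i
  simp only [polyHash, polyValue_add, fieldBits_add, xorBits]

/-- k-wise independence by a symmetry argument. Adding to the coefficients those of an interpolant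
of f shifts the hash values on T by f and preserves the uniform distribution of coefficients.
Averaging over all f makes the shifted values uniform. -/
theorem expect_polyHash {a v m k : ℕ} (ha : a ≤ m + 1) (hv : v ≤ m + 1) (T : Finset (Bits a))
    (hT : T.card ≤ k) (Q : (Bits a → Bits v) → ℂ) (hQ : DependsOn Q T) :
    𝔼 c : Fin k → BinField (m + 1), Q (polyHash hv c) = 𝔼 f : Bits a → Bits v, Q f := by
  have h1 : ∀ f : Bits a → Bits v, 𝔼 c : Fin k → BinField (m + 1), Q (polyHash hv c) =
      𝔼 c : Fin k → BinField (m + 1), Q fun x => xorBits (polyHash hv c x) (f x) := by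
    intro f
    obtain ⟨c', hc'⟩ := exists_polyHash_eq ha hv f T hT
    rw [← Fintype.expect_equiv (Equiv.addRight c') (fun c => Q (polyHash hv (c + c')))
      (fun c => Q (polyHash hv c)) fun c => rfl]
    refine Finset.expect_congr rfl fun c _ => hQ fun x hx => ?_
    rw [polyHash_add, hc' x hx]
  have h2 : ∀ h : Bits a → Bits v, 𝔼 f : Bits a → Bits v, Q (fun x => xorBits (h x) (f x)) =
      𝔼 f : Bits a → Bits v, Q f := by
    intro h
    have hinv : Function.Involutive fun (f : Bits a → Bits v) x => xorBits (h x) (f x) := fun f =>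
      funext fun x => xorBits_self_left _ _
    exact Fintype.expect_equiv hinv.toPerm _ _ fun f => rfl
  calc 𝔼 c : Fin k → BinField (m + 1), Q (polyHash hv c)
      = 𝔼 f : Bits a → Bits v, 𝔼 c : Fin k → BinField (m + 1), Q (polyHash hv c) :=
        (Fintype.expect_const _).symm
    _ = 𝔼 f : Bits a → Bits v, 𝔼 c : Fin k → BinField (m + 1),
          Q fun x => xorBits (polyHash hv c x) (f x) :=
        Finset.expect_congr rfl fun f _ => h1 f
    _ = 𝔼 c : Fin k → BinField (m + 1), 𝔼 f : Bits a → Bits v,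
          Q fun x => xorBits (polyHash hv c x) (f x) := Finset.expect_comm _ _ _
    _ = 𝔼 f : Bits a → Bits v, Q f := by
        simp only [h2]
        exact Fintype.expect_const _

/-- The number of gates that suffices for functions with independent values at `k` points. -/
def hashGates (a v k : ℕ) : ℕ := (k + 1) * (20 * (a + v + 1) ^ 3)

/-- These functions stand in for random functions inside efficient adversaries. The field has
2^(a+v+1) elements so that both inputs and outputs fit into one element. -/
theorem exists_independent_family (a v k : ℕ) :
    ∃ (I : Type) (_ : Fintype I) (_ : Nonempty I) (h : I → Bits a → Bits v),
      (∀ s, Computes (hashGates a v k) (h s)) ∧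
      ∀ T : Finset (Bits a), T.card ≤ k → ∀ Q : (Bits a → Bits v) → ℂ, DependsOn Q T →
        𝔼 s, Q (h s) = 𝔼 f : Bits a → Bits v, Q f := by
  have ha : a ≤ a + v + 1 := by omega
  have hv : v ≤ a + v + 1 := by omega
  refine ⟨Fin k → BinField (a + v + 1), inferInstance, inferInstance, polyHash hv, fun c => ?_,
    fun T hT Q hQ => expect_polyHash ha hv T hT Q hQ⟩
  have h := (computes_select (Fin.castLE hv)).comp
    (computesField_poly (a := a) (m := a + v) c)
  exact h

/-! ### Initial segments -/

/-- The sets `T` in a chain of sets of strings which exhausts all strings, together with the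
element `p` that the next set of the chain contains in addition. -/
inductive Segment : (d : ℕ) → (Bits d → Bool) → Bits d → Prop
  | zero : Segment 0 (fun _ => false) (zeroBits 0)
  | left {d : ℕ} {T : Bits d → Bool} {p : Bits d} (h : Segment d T p) :
      Segment (d + 1) (fun x => !(x (Fin.last d)) && T (fun i => x i.castSucc))
        (Fin.snoc (α := fun _ => Bool) p false)
  | right {d : ℕ} {T : Bits d → Bool} {p : Bits d} (h : Segment d T p) :
      Segment (d + 1) (fun x => !(x (Fin.last d)) || T (fun i => x i.castSucc))
        (Fin.snoc (α := fun _ => Bool) p true)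

theorem Segment.apply_self {d : ℕ} {T : Bits d → Bool} {p : Bits d} (h : Segment d T p) :
    T p = false := by
  induction h with
  | zero => rfl
  | left h ih => simp [ih]
  | right h ih => simp [ih]

/-- Each level of the recursion adds the test of one bit, so all sets of a chain of exponential
length have circuits of linear size. -/
theorem Segment.computesBit {d : ℕ} {T : Bits d → Bool} {p : Bits d} (h : Segment d T p) :
    ComputesBit (4 * d + 1) T := by
  induction h with
  | zero => exact (computesBit_const false).mono (by omega)
  | left h ih =>
    exact ((computesBit_select (Fin.last _)).not.and (Computes.relabel ih Fin.castSucc)).mono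
      (by omega)
  | right h ih =>
    exact ((computesBit_select (Fin.last _)).not.or (Computes.relabel ih Fin.castSucc)).mono
      (by omega)

theorem eq_snoc_iff {d : ℕ} (x : Bits (d + 1)) (p : Bits d) (b : Bool) :
    x = Fin.snoc (α := fun _ => Bool) p b ↔ x (Fin.last d) = b ∧ (fun i => x i.castSucc) = p := by
  constructor
  · rintro rfl
    simp
  · rintro ⟨h1, h2⟩
    funext i
    refine Fin.lastCases ?_ (fun j => ?_) i
    · simpa using h1
    · simpa using congrFun h2 j

theorem computesBit_eq {d : ℕ} (p : Bits d) : ComputesBit (3 * d + 1) fun x => decide (x = p) := by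
  induction d with
  | zero =>
    have e : (fun x : Bits 0 => decide (x = p)) = fun _ => true := by
      funext x
      simp [Subsingleton.elim x p]
    rw [e]
    exact computesBit_const true
  | succ d ih =>
    have h1 : ComputesBit 1 fun x : Bits (d + 1) => decide (x (Fin.last d) = p (Fin.last d)) := by
      cases p (Fin.last d)
      · simpa using (computesBit_select (Fin.last d)).not
      · simpa using (computesBit_select (Fin.last d)).mono (by omega : 0 ≤ 1)
    have h2 := h1.and (Computes.relabel (ih fun i => p i.castSucc) Fin.castSucc)
    refine ComputesBit.mono ?_ (by omega : 1 + (3 * d + 1) + 2 ≤ 3 * (d + 1) + 1)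
    convert h2 using 1
    funext x
    have h3 : p = Fin.snoc (α := fun _ => Bool) (fun i => p i.castSucc) (p (Fin.last d)) :=
      (eq_snoc_iff _ _ _).2 ⟨rfl, rfl⟩
    rw [← Bool.decide_and, decide_eq_decide]
    conv_lhs => rw [h3]
    exact eq_snoc_iff _ _ _

/-- The chain for d + 1 bits is the concatenation of two chains for d bits: the first fills the half
with last bit 0, the second then fills the other half. The two meet at {x | last bit 0}, and each
contributes 2^d steps. -/
theorem abs_telescope {d : ℕ} (Φ : (Bits d → Bool) → ℝ) (ε : ℝ)
    (h : ∀ T p, Segment d T p → |Φ (fun x => T x || decide (x = p)) - Φ T| ≤ ε) :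
    |Φ (fun _ => true) - Φ fun _ => false| ≤ 2 ^ d * ε := by
  induction d with
  | zero =>
    have := h _ _ Segment.zero
    have e : (fun x : Bits 0 => false || decide (x = zeroBits 0)) = fun _ => true := by
      funext x
      simp [Subsingleton.elim x (zeroBits 0)]
    rw [e] at this
    simpa using this
  | succ d ih =>
    have h1 := ih (fun T => Φ fun x => !(x (Fin.last d)) && T (fun i => x i.castSucc)) (by
      intro T p hT
      have := h _ _ hT.left
      convert this using 4
      funext x
      simp only [eq_snoc_iff, Bool.decide_and]
      cases x (Fin.last d) <;> simp)
    have h2 := ih (fun T => Φ fun x => !(x (Fin.last d)) || T (fun i => x i.castSucc)) (by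
      intro T p hT
      have := h _ _ hT.right
      convert this using 4
      funext x
      simp only [eq_snoc_iff, Bool.decide_and]
      cases x (Fin.last d) <;> simp)
    simp only [Bool.and_true, Bool.and_false, Bool.or_true, Bool.or_false] at h1 h2
    have := abs_sub_le (Φ fun _ => true) (Φ fun x => !(x (Fin.last d))) (Φ fun _ => false)
    rw [pow_succ]
    linarith

/-! ### Gate sequences acting on basis states -/

/-- The unitary of a sequence of gates, applied from left to right. -/
def runGates {N : ℕ} : List (Gate N) → Op N
  | [] => 1
  | g :: gs => runGates gs * g.mat

theorem runGates_append {N : ℕ} (gs hs : List (Gate N)) :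
    runGates (gs ++ hs) = runGates hs * runGates gs := by
  induction gs with
  | nil => simp [runGates]
  | cons g gs ih => rw [List.cons_append, runGates, ih, runGates, Matrix.mul_assoc]

theorem runGates_append_ket {N : ℕ} (gs hs : List (Gate N)) (u : Bits N) :
    runGates (gs ++ hs) *ᵥ ket u = runGates hs *ᵥ (runGates gs *ᵥ ket u) := by
  rw [runGates_append, Matrix.mulVec_mulVec]

theorem runGates_singleton {N : ℕ} (g : Gate N) : runGates [g] = g.mat := by
  simp [runGates]

theorem foldl_conj_eq_runGates {N : ℕ} (gs : List (Gate N)) (σ : Op N) :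
    gs.foldl (fun σ g => g.mat * σ * g.matᴴ) σ = runGates gs * σ * (runGates gs)ᴴ := by
  induction gs generalizing σ with
  | nil => simp [runGates]
  | cons g gs ih =>
    rw [List.foldl_cons, ih, runGates, Matrix.conjTranspose_mul]
    simp only [Matrix.mul_assoc]

/-- Put a sequence of gates in front of an oracle circuit. -/
def OracleCircuit.withGates {a b N : ℕ} (gs : List (Gate N)) (C : OracleCircuit a b N) :
    OracleCircuit a b N := gs.foldr OracleCircuit.gate C

theorem OracleCircuit.accept_withGates {a b N : ℕ} (O : QOracle a b) (gs : List (Gate N))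
    (C : OracleCircuit a b N) (ρ : Op N) :
    (C.withGates gs).accept O ρ = C.accept O (runGates gs * ρ * (runGates gs)ᴴ) := by
  rw [← foldl_conj_eq_runGates]
  induction gs generalizing ρ with
  | nil => rfl
  | cons g gs ih => exact ih _

theorem OracleCircuit.size_withGates {a b N : ℕ} (gs : List (Gate N)) (C : OracleCircuit a b N) :
    (C.withGates gs).size = gs.length + C.size := by
  induction gs with
  | nil => simp [withGates]
  | cons g gs ih =>
    change (C.withGates gs).size + 1 = _
    rw [ih, List.length_cons]; omega

/-- The primitive eighth root of unity of the gate `T`. -/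
def omega : ℂ := Complex.exp (Complex.I * (Real.pi / 4 : ℝ))

theorem omega_pow_four : omega ^ 4 = -1 := by
  rw [omega, ← Complex.exp_nat_mul, ← Complex.exp_pi_mul_I]
  congr 1
  push_cast
  ring

/-- The gates multiply the basis state `|u⟩` by `omega ^ φ u`. -/
def PhaseActs {N : ℕ} (gs : List (Gate N)) (φ : Bits N → ℕ) : Prop :=
  ∀ u, runGates gs *ᵥ ket u = omega ^ φ u • ket u

theorem PhaseActs.append {N : ℕ} {gs hs : List (Gate N)} {φ ψ : Bits N → ℕ} (hg : PhaseActs gs φ)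
    (hh : PhaseActs hs ψ) : PhaseActs (gs ++ hs) fun u => φ u + ψ u := by
  intro u
  rw [runGates_append_ket, hg, Matrix.mulVec_smul, hh, smul_smul, pow_add]

theorem phaseActs_T {N : ℕ} (i : Fin N) (k : ℕ) :
    PhaseActs (List.replicate k (Gate.T i)) fun u => k * (u i).toNat := by
  induction k with
  | zero => intro u; simp [runGates]
  | succ k ih =>
    have h1 : PhaseActs [Gate.T i] fun u => (u i).toNat := by
      intro u
      rw [runGates_singleton, T_mulVec_ket]
      cases h : u i <;> simp [omega, h]
    have h := h1.append ih
    intro u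
    have := h u
    rw [List.singleton_append] at this
    rw [List.replicate_succ, this]
    congr 2
    ring

/-- Conjugation by CNOT evaluates the phase at u_t ⊕ u_c instead of u_t, so phases of parities
become available. -/
theorem PhaseActs.conj_CNOT {N : ℕ} {gs : List (Gate N)} {φ : Bits N → ℕ} (hg : PhaseActs gs φ)
    {c t : Fin N} (h : c ≠ t) :
    PhaseActs ([Gate.CNOT c t h] ++ gs ++ [Gate.CNOT c t h])
      fun u => φ (Function.update u t (xor (u t) (u c))) := by
  intro u
  rw [runGates_append_ket, runGates_append_ket, runGates_singleton, CNOT_mulVec_ket, hg,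
    Matrix.mulVec_smul, CNOT_mulVec_ket]
  congr 2
  simp [Function.update_of_ne h]

/-- The gates multiply the basis state `|u⟩` by `(-1)^{β u}`. -/
def SignActs {N : ℕ} (gs : List (Gate N)) (β : Bits N → Bool) : Prop :=
  ∀ u, runGates gs *ᵥ ket u = boolSign (β u) • ket u

theorem PhaseActs.signActs {N : ℕ} {gs : List (Gate N)} {φ : Bits N → ℕ} {β : Bits N → Bool}
    (hg : PhaseActs gs φ) (h : ∀ u, ∃ k, φ u = 8 * k + 4 * (β u).toNat) : SignActs gs β := by
  intro u
  obtain ⟨k, hk⟩ := h u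
  rw [hg, hk, pow_add, pow_mul, show 8 = 4 * 2 from rfl, pow_mul omega 4 2, omega_pow_four, pow_mul,
    omega_pow_four]
  cases β u <;> simp [boolSign]

theorem boolSign_xor (a b : Bool) : boolSign (xor a b) = boolSign a * boolSign b := by
  cases a <;> cases b <;> simp [boolSign]

theorem SignActs.append {N : ℕ} {gs hs : List (Gate N)} {α β : Bits N → Bool} (hg : SignActs gs α)
    (hh : SignActs hs β) : SignActs (gs ++ hs) fun u => xor (α u) (β u) := by
  intro u
  rw [runGates_append_ket, hg, Matrix.mulVec_smul, hh, smul_smul, boolSign_xor]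

theorem exists_sign_bit {N : ℕ} (i : Fin N) :
    ∃ gs : List (Gate N), gs.length ≤ 4 ∧ SignActs gs fun u => u i :=
  ⟨List.replicate 4 (Gate.T i), by simp, (phaseActs_T i 4).signActs fun u => ⟨0, by simp⟩⟩

/-- Uses 4ab = 2a + 2b - 2(a ⊕ b); exponents of `omega` count modulo 8, so -2 becomes 6. -/
theorem exists_sign_and {N : ℕ} {a t : Fin N} (h : a ≠ t) :
    ∃ gs : List (Gate N), gs.length ≤ 12 ∧ SignActs gs fun u => u a && u t := by
  have hp := ((phaseActs_T a 2).append (phaseActs_T t 2)).append ((phaseActs_T t 6).conj_CNOT h)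
  refine ⟨_, ?_, hp.signActs fun u => ?_⟩
  · simp
  · simp only [Function.update_self]
    cases u a <;> cases u t <;> simp

/-- Uses 4abt = a + b + t - (a ⊕ b) - (a ⊕ t) - (b ⊕ t) + (a ⊕ b ⊕ t), with -1 replaced by 7 modulo
8. -/
theorem exists_sign_and_and {N : ℕ} {a b t : Fin N} (hab : a ≠ b) (hat : a ≠ t) (hbt : b ≠ t) :
    ∃ gs : List (Gate N), gs.length ≤ 35 ∧ SignActs gs fun u => u a && u b && u t := by
  have hp := ((((phaseActs_T a 1).append (phaseActs_T b 1)).append (phaseActs_T t 1)).append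
    (((phaseActs_T b 7).conj_CNOT hab).append (((phaseActs_T t 7).conj_CNOT hat).append
      ((phaseActs_T t 7).conj_CNOT hbt)))).append (((phaseActs_T t 1).conj_CNOT hbt).conj_CNOT hat)
  refine ⟨_, ?_, hp.signActs fun u => ?_⟩
  · simp
  · simp only [Function.update_self, Function.update_of_ne hbt]
    cases u a <;> cases u b <;> cases u t <;> simp <;>
      first | exact ⟨0, rfl⟩ | exact ⟨1, rfl⟩ | exact ⟨2, rfl⟩

/-- Hadamard conjugation turns a controlled sign into a controlled bit flip. The control κ must not
read the target bit. -/
theorem SignActs.flip {N : ℕ} {gs : List (Gate N)} {β κ : Bits N → Bool} {t : Fin N}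
    (hg : SignActs gs β) (hβ : ∀ u, β u = (u t && κ u))
    (hκ : ∀ u b, κ (Function.update u t b) = κ u) (u : Bits N) :
    runGates ([Gate.H t] ++ gs ++ [Gate.H t]) *ᵥ ket u =
      ket (Function.update u t (xor (u t) (κ u))) := by
  have h0 := sqrt_two_ne_zero
  have h2 := sqrt_two_mul_self
  have hh : (1 / (Real.sqrt 2 : ℂ)) * (1 / (Real.sqrt 2 : ℂ)) = 1 / 2 := by
    rw [div_mul_div_comm, h2]; norm_num
  rw [runGates_append_ket, runGates_append_ket, runGates_singleton]
  simp only [H_mulVec_ket, Matrix.mulVec_smul, Matrix.mulVec_add, hg _]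
  simp only [hβ, hκ, Function.update_self, Function.update_idem, Bool.not_not,
    Function.update_eq_self]
  cases hk : κ u <;> cases hu : u t
  · have e : Function.update u t false = u := by rw [← hu, Function.update_eq_self]
    simp only [boolSign, Bool.and_false, Bool.not_false, if_true, Bool.false_eq_true,
      if_false, Bool.xor_false, e]
    simp only [smul_add, smul_smul, ← mul_assoc, mul_one, hh, one_mul]
    module
  · have e : Function.update u t true = u := by rw [← hu, Function.update_eq_self]
    simp only [boolSign, Bool.and_false, Bool.not_true, if_true, Bool.false_eq_true,
      if_false, Bool.xor_false, e]
    simp only [smul_add, smul_smul, mul_one, hh, one_mul, mul_neg, neg_mul, neg_neg]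
    module
  · have e : Function.update u t false = u := by rw [← hu, Function.update_eq_self]
    simp only [boolSign, Bool.and_true, Bool.not_false, if_true, Bool.false_eq_true,
      if_false, Bool.xor_true]
    simp only [smul_add, smul_smul, mul_one, hh, one_mul, mul_neg, neg_mul, neg_neg]
    module
  · have e : Function.update u t true = u := by rw [← hu, Function.update_eq_self]
    simp only [boolSign, Bool.and_true, Bool.not_true, if_true, Bool.false_eq_true,
      if_false, Bool.xor_true]
    simp only [smul_add, smul_smul, mul_one, hh, one_mul, mul_neg, neg_mul, neg_neg]
    module

/-- The sign for u_t (1 - u_a u_b) is the product of the signs for u_t and for u_a u_b u_t. The two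
inputs of a NAND gate may coincide, and then the triple product degenerates to a double one. -/
theorem exists_flip_nand {N : ℕ} {a b t : Fin N} (ha : a ≠ t) (hb : b ≠ t) :
    ∃ gs : List (Gate N), gs.length ≤ 41 ∧ ∀ u, runGates gs *ᵥ ket u =
      ket (Function.update u t (xor (u t) (!(u a && u b)))) := by
  obtain ⟨g1, hg1, h1⟩ := exists_sign_bit t
  obtain ⟨g2, hg2, h2⟩ : ∃ gs : List (Gate N), gs.length ≤ 35 ∧
      SignActs gs fun u => u a && u b && u t := by
    by_cases hab : a = b
    · subst hab
      obtain ⟨gs, hl, h⟩ := exists_sign_and ha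
      refine ⟨gs, by omega, ?_⟩
      simpa only [Bool.and_self] using h
    · exact exists_sign_and_and hab ha hb
  refine ⟨[Gate.H t] ++ (g1 ++ g2) ++ [Gate.H t], ?_,
    (h1.append h2).flip (κ := fun u => !(u a && u b)) (fun u => ?_) fun u c => ?_⟩
  · simp only [List.length_append, List.length_singleton]; omega
  · cases u a <;> cases u b <;> cases u t <;> rfl
  · rw [Function.update_of_ne ha, Function.update_of_ne hb]

theorem exists_flip_const {N : ℕ} (b : Bool) (t : Fin N) :
    ∃ gs : List (Gate N), gs.length ≤ 41 ∧ ∀ u, runGates gs *ᵥ ket u =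
      ket (Function.update u t (xor (u t) b)) := by
  cases b with
  | false => exact ⟨[], by simp, fun u => by simp [runGates]⟩
  | true =>
    obtain ⟨g1, hg1, h1⟩ := exists_sign_bit t
    refine ⟨[Gate.H t] ++ g1 ++ [Gate.H t], ?_,
      h1.flip (κ := fun _ => true) (fun u => (Bool.and_true _).symm) fun u c => rfl⟩
    simp only [List.length_append, List.length_singleton]; omega

/-- Phase kickback for a Boolean circuit: its value is computed into ancillas, turned into a sign,
and uncomputed. -/
theorem exists_sign_of_circuit {N w : ℕ} (C : BoolCircuit 1 w) (e : Fin w → Fin N)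
    (anc : List (Fin N)) (hnd : anc.Nodup) (hdis : ∀ a ∈ anc, ∀ i, e i ≠ a)
    (hlen : C.gates ≤ anc.length) :
    ∃ gs : List (Gate N), gs.length ≤ 82 * C.gates + 4 ∧
      ∀ u, (∀ a ∈ anc, u a = false) →
        runGates gs *ᵥ ket u = boolSign (C.eval (fun i => u (e i)) 0) • ket u := by
  -- One Boolean gate: flip a zero ancilla by the value φ, treat it as a further wire of the
  -- remaining circuit, and flip it back. The flip is applied twice at 41 gates, whence 82 per gate;
  -- φ does not read the ancilla, so the second flip undoes the first.
  have step : ∀ {w : ℕ} (C : BoolCircuit 1 (w + 1)) (e : Fin w → Fin N) (a : Fin N)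
      (as : List (Fin N)) (φ : Bits N → Bool), (a :: as).Nodup → (∀ c ∈ a :: as, ∀ i, e i ≠ c) →
      (∀ u b, φ (Function.update u a b) = φ u) →
      (∃ gs : List (Gate N), gs.length ≤ 41 ∧ ∀ u, runGates gs *ᵥ ket u =
        ket (Function.update u a (xor (u a) (φ u)))) →
      (∃ gs : List (Gate N), gs.length ≤ 82 * C.gates + 4 ∧
        ∀ u, (∀ c ∈ as, u c = false) → runGates gs *ᵥ ket u =
          boolSign (C.eval (fun i => u (Fin.snoc (α := fun _ => Fin N) e a i)) 0) • ket u) →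
      ∃ gs : List (Gate N), gs.length ≤ 82 * (C.gates + 1) + 4 ∧
        ∀ u, (∀ c ∈ a :: as, u c = false) → runGates gs *ᵥ ket u =
          boolSign (C.eval (Fin.snoc (α := fun _ => Bool) (fun i => u (e i)) (φ u)) 0) • ket u := by
    intro w C e a as φ hnd hdis hφ ⟨pre, hpre, hp⟩ ⟨mid, hmid, hm⟩
    refine ⟨pre ++ mid ++ pre, ?_, fun u hu => ?_⟩
    · simp only [List.length_append]; omega
    · have hua : u a = false := hu a List.mem_cons_self
      rw [runGates_append_ket, runGates_append_ket, hp, hm, Matrix.mulVec_smul, hp]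
      · congr 2
        · congr 2
          funext i
          refine Fin.lastCases ?_ (fun j => ?_) i
          · simp [hua]
          · simp only [Fin.snoc_castSucc]
            rw [Function.update_of_ne (hdis a List.mem_cons_self j)]
        · simp [hφ, hua]
      · intro c hc
        have hca : c ≠ a := by
          rintro rfl
          exact (List.nodup_cons.1 hnd).1 hc
        rw [Function.update_of_ne hca]
        exact hu c (List.mem_cons_of_mem _ hc)
  have hext : ∀ {w : ℕ} (e : Fin w → Fin N) (a : Fin N) (as : List (Fin N)), (a :: as).Nodup →
      (∀ c ∈ a :: as, ∀ i, e i ≠ c) →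
      ∀ c ∈ as, ∀ i, Fin.snoc (α := fun _ => Fin N) e a i ≠ c := by
    intro w e a as hnd hdis c hc i
    refine Fin.lastCases ?_ (fun j => ?_) i
    · rw [Fin.snoc_last]
      rintro rfl
      exact (List.nodup_cons.1 hnd).1 hc
    · rw [Fin.snoc_castSucc]
      exact hdis c (List.mem_cons_of_mem _ hc) j
  induction C generalizing anc with
  | output o =>
    obtain ⟨gs, hl, hs⟩ := exists_sign_bit (e (o 0))
    exact ⟨gs, by simpa [BoolCircuit.gates] using hl, fun u _ => hs u⟩
  | const b C ih =>
    cases anc with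
    | nil => simp [BoolCircuit.gates] at hlen
    | cons a as =>
      simp only [BoolCircuit.gates, List.length_cons] at hlen
      exact step C e a as (fun _ => b) hnd hdis (fun _ _ => rfl) (exists_flip_const b a)
        (ih _ as (List.nodup_cons.1 hnd).2 (hext e a as hnd hdis) (by omega))
  | nand i j C ih =>
    cases anc with
    | nil => simp [BoolCircuit.gates] at hlen
    | cons a as =>
      simp only [BoolCircuit.gates, List.length_cons] at hlen
      have hi := hdis a List.mem_cons_self i
      have hj := hdis a List.mem_cons_self j
      exact step C e a as (fun u => !(u (e i) && u (e j))) hnd hdis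
        (fun u c => by rw [Function.update_of_ne hi, Function.update_of_ne hj])
        (exists_flip_nand hi hj)
        (ih _ as (List.nodup_cons.1 hnd).2 (hext e a as hnd hdis) (by omega))

/-- Hadamard gates on fresh qubits. -/
theorem exists_hadamards {N n : ℕ} (y : Fin n ↪ Fin N) :
    ∃ gs : List (Gate N), gs.length = n ∧ ∀ u, (∀ j, u (y j) = false) →
      runGates gs *ᵥ ket u = (1 / (Real.sqrt 2 : ℂ) ^ n) •
        ∑ b : Bits n, ket (Function.extend y b u) := by
  induction n with
  | zero =>
    refine ⟨[], rfl, fun u _ => ?_⟩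
    have : ∀ b : Bits 0, Function.extend y b u = u := fun b => by
      funext i
      exact Function.extend_apply' _ _ _ fun ⟨j, _⟩ => j.elim0
    simp [runGates, this]
  | succ n ih =>
    obtain ⟨gs, hl, hs⟩ := ih ((Fin.succEmb n).trans y)
    refine ⟨gs ++ [Gate.H (y 0)], by simp [hl], fun u hu => ?_⟩
    have key : ∀ b : Bits n, (Gate.H (y 0)).mat *ᵥ
        ket (Function.extend ((Fin.succEmb n).trans y) b u) = (1 / (Real.sqrt 2 : ℂ)) •
          ∑ c : Bool, ket (Function.extend y (Fin.consEquiv (fun _ => Bool) (c, b)) u) := by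
      intro b
      have hz : Function.extend ((Fin.succEmb n).trans y) b u (y 0) = false := by
        rw [Function.extend_apply', hu]
        rintro ⟨j, hj⟩
        exact Fin.succ_ne_zero j (y.injective hj)
      have hc : ∀ c : Bool, Function.extend y (Fin.consEquiv (fun _ => Bool) (c, b)) u =
          Function.update (Function.extend ((Fin.succEmb n).trans y) b u) (y 0) c := by
        intro c
        funext i
        by_cases hi : ∃ j, y j = i
        · obtain ⟨j, rfl⟩ := hi
          rw [y.injective.extend_apply]
          refine Fin.cases ?_ (fun k => ?_) j
          · simp
          · rw [Function.update_of_ne (fun h => Fin.succ_ne_zero k (y.injective h))]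
            exact (((Fin.succEmb n).trans y).injective.extend_apply b u k).symm
        · rw [Function.extend_apply' _ _ _ hi, Function.update_of_ne (fun h => hi ⟨0, h.symm⟩),
            Function.extend_apply' _ _ _ fun ⟨j, hj⟩ => hi ⟨j.succ, hj⟩]
      rw [H_mulVec_ket, hz, Fintype.sum_bool, hc, hc]
      have e : Function.update (Function.extend ((Fin.succEmb n).trans y) b u) (y 0) false =
          Function.extend ((Fin.succEmb n).trans y) b u := by
        rw [← hz, Function.update_eq_self]
      rw [e, add_comm]
      simp
    have hsum : ∑ b : Bits (n + 1), ket (Function.extend y b u) =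
        ∑ b : Bits n, ∑ c : Bool,
          ket (Function.extend y (Fin.consEquiv (fun _ => Bool) (c, b)) u) := by
      rw [← Equiv.sum_comp (Fin.consEquiv fun _ : Fin (n + 1) => Bool)
        (fun b => ket (Function.extend y b u)), Fintype.sum_prod_type_right]
    rw [runGates_append_ket, hs u fun j => hu j.succ, runGates_singleton, Matrix.mulVec_smul,
      Matrix.mulVec_sum, hsum, Finset.sum_congr rfl fun b _ => key b, ← Finset.smul_sum, smul_smul,
      pow_succ, one_div_mul_one_div]

/-! ### Embedding registers into a larger one -/

/-- The string that carries `v` on the positions `π` and is zero elsewhere. -/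
def placeBits {N N' : ℕ} (π : Fin N ↪ Fin N') (v : Bits N) : Bits N' :=
  Function.extend π v (zeroBits N')

theorem placeBits_apply {N N' : ℕ} (π : Fin N ↪ Fin N') (v : Bits N) (i : Fin N) :
    placeBits π v (π i) = v i := π.injective.extend_apply _ _ _

theorem placeBits_of_notMem {N N' : ℕ} (π : Fin N ↪ Fin N') (v : Bits N) {j : Fin N'}
    (hj : ∀ i, π i ≠ j) : placeBits π v j = false :=
  Function.extend_apply' _ _ _ fun ⟨i, hi⟩ => hj i hi

theorem placeBits_injective {N N' : ℕ} (π : Fin N ↪ Fin N') : Function.Injective (placeBits π) := by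
  intro v w h
  funext i
  rw [← placeBits_apply π v, h, placeBits_apply]

theorem update_placeBits {N N' : ℕ} (π : Fin N ↪ Fin N') (v : Bits N) (i : Fin N) (b : Bool) :
    Function.update (placeBits π v) (π i) b = placeBits π (Function.update v i b) := by
  funext j
  by_cases hj : ∃ k, π k = j
  · obtain ⟨k, rfl⟩ := hj
    rw [placeBits_apply]
    by_cases hk : k = i
    · subst hk; simp
    · rw [Function.update_of_ne (π.injective.ne hk), Function.update_of_ne hk, placeBits_apply]
  · have hj' : ∀ k, π k ≠ j := fun k hk => hj ⟨k, hk⟩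
    rw [Function.update_of_ne (hj' i).symm, placeBits_of_notMem π _ hj',
      placeBits_of_notMem π _ hj']

/-- The matrix `|v⟩ ↦ |φ v⟩`. -/
def mapMat {α β : Type*} [DecidableEq β] (φ : α → β) : Matrix β α ℂ :=
  Matrix.of fun w v => if w = φ v then 1 else 0

theorem mapMat_mulVec_ket {N N' : ℕ} (φ : Bits N → Bits N') (v : Bits N) :
    mapMat φ *ᵥ ket v = ket (φ v) := by
  rw [mulVec_ket]
  funext w
  simp [mapMat, ket_apply]

theorem mapMat_conj_apply {α β : Type*} [Fintype α] [DecidableEq α] [DecidableEq β] {φ : α → β}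
    (hφ : Function.Injective φ) (ρ : Matrix α α ℂ) (v v' : α) :
    (mapMat φ * ρ * (mapMat φ)ᴴ) (φ v) (φ v') = ρ v v' := by
  simp [Matrix.mul_apply, mapMat, hφ.eq_iff]

theorem mapMat_conj_apply_left {α β : Type*} [Fintype α] [DecidableEq β] {φ : α → β}
    (ρ : Matrix α α ℂ) {w : β} (hw : w ∉ Set.range φ) (w' : β) :
    (mapMat φ * ρ * (mapMat φ)ᴴ) w w' = 0 := by
  have : ∀ v, w ≠ φ v := fun v hv => hw ⟨v, hv.symm⟩
  simp [Matrix.mul_apply, mapMat, this]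

theorem mapMat_conj_apply_right {α β : Type*} [Fintype α] [DecidableEq β] {φ : α → β}
    (ρ : Matrix α α ℂ) (w : β) {w' : β} (hw : w' ∉ Set.range φ) :
    (mapMat φ * ρ * (mapMat φ)ᴴ) w w' = 0 := by
  have : ∀ v, w' ≠ φ v := fun v hv => hw ⟨v, hv.symm⟩
  simp [Matrix.mul_apply, mapMat, this]

/-- The isometry `|v⟩ ↦ |placeBits π v⟩`. -/
def placeMat {N N' : ℕ} (π : Fin N ↪ Fin N') : Matrix (Bits N') (Bits N) ℂ :=
  mapMat (placeBits π)

theorem placeMat_mulVec_ket {N N' : ℕ} (π : Fin N ↪ Fin N') (v : Bits N) :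
    placeMat π *ᵥ ket v = ket (placeBits π v) := mapMat_mulVec_ket _ _

/-- The same gate on the qubits `π`. -/
def Gate.map {N N' : ℕ} (π : Fin N ↪ Fin N') : Gate N → Gate N'
  | .H i => .H (π i)
  | .T i => .T (π i)
  | .CNOT c t h => .CNOT (π c) (π t) (π.injective.ne h)

theorem map_mat_mul_placeMat {N N' : ℕ} (π : Fin N ↪ Fin N') (g : Gate N) :
    (g.map π).mat * placeMat π = placeMat π * g.mat := by
  refine matrix_ext_ket fun v => ?_
  rw [← Matrix.mulVec_mulVec, ← Matrix.mulVec_mulVec, placeMat_mulVec_ket]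
  cases g with
  | H i =>
    rw [Gate.map, H_mulVec_ket, H_mulVec_ket, Matrix.mulVec_smul, Matrix.mulVec_add,
      Matrix.mulVec_smul, placeMat_mulVec_ket, placeMat_mulVec_ket, placeBits_apply,
      update_placeBits]
  | T i =>
    rw [Gate.map, T_mulVec_ket, T_mulVec_ket, Matrix.mulVec_smul, placeMat_mulVec_ket,
      placeBits_apply]
  | CNOT c t h =>
    rw [Gate.map, CNOT_mulVec_ket, CNOT_mulVec_ket, placeMat_mulVec_ket, placeBits_apply,
      placeBits_apply, update_placeBits]

theorem conj_conj {α β γ : Type*} [Fintype α] [Fintype β] (M : Matrix γ β ℂ) (K : Matrix β α ℂ)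
    (ρ : Matrix α α ℂ) : M * (K * ρ * Kᴴ) * Mᴴ = (M * K) * ρ * (M * K)ᴴ := by
  rw [Matrix.conjTranspose_mul]; simp only [Matrix.mul_assoc]

/-! ### Simulating a state oracle by a function oracle -/

/-- The concatenation of two embeddings with disjoint ranges. -/
def appendEmb {a b : ℕ} {X : Type*} (f : Fin a ↪ X) (g : Fin b ↪ X) (h : ∀ i j, f i ≠ g j) :
    Fin (a + b) ↪ X where
  toFun := Fin.append f g
  inj' := Fin.append_injective_iff.2 ⟨f.injective, g.injective, h⟩

/-- The unitary of a query to a function oracle. -/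
def queryMat {a b N : ℕ} (f : Bits a → Bits b) (e : Fin (a + b) ↪ Fin N) : Op N :=
  (liftKraus e ((functionOracle f).kraus ()) : Matrix (Bits (N + 0)) (Bits N) ℂ)

theorem applyAt_functionOracle {a b N : ℕ} (f : Bits a → Bits b) (e : Fin (a + b) ↪ Fin N)
    (ρ : Op N) : (functionOracle f).applyAt e ρ = queryMat f e * ρ * (queryMat f e)ᴴ :=
  Fintype.sum_unique (ι := Unit) _

theorem accept_query_functionOracle {a b N : ℕ} (f : Bits a → Bits b) (e : Fin (a + b) ↪ Fin N)
    (C : OracleCircuit (a + b) 0 N) (ρ : Op N) :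
    (OracleCircuit.query (N := N) e C).accept (functionOracle f) ρ =
      C.accept (functionOracle f) (queryMat f e * ρ * (queryMat f e)ᴴ) :=
  congrArg (fun σ : Op N => C.accept (functionOracle f) σ) (applyAt_functionOracle f e ρ)

open Classical in
theorem queryMat_mulVec_ket {a b N : ℕ} (f : Bits a → Bits b) (p : Fin a ↪ Fin N)
    (r : Fin b ↪ Fin N) (h : ∀ i j, p i ≠ r j) (u : Bits N) :
    queryMat f (appendEmb p r h) *ᵥ ket u =
      ket (Function.extend r (xorBits (fun i => u (r i)) (f fun i => u (p i))) u) := by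
  rw [mulVec_ket]
  funext w
  rw [ket_apply]
  have hp : fstBits (u ∘ appendEmb p r h) = fun i => u (p i) :=
    funext fun i => congrArg u (Fin.append_left _ _ i)
  have hr : sndBits (u ∘ appendEmb p r h) = fun i => u (r i) :=
    funext fun i => congrArg u (Fin.append_right _ _ i)
  have hp' : fstBits (w ∘ appendEmb p r h) = fun i => w (p i) :=
    funext fun i => congrArg w (Fin.append_left _ _ i)
  have hr' : sndBits (w ∘ appendEmb p r h) = fun i => w (r i) :=
    funext fun i => congrArg w (Fin.append_right _ _ i)
  change (if AgreeOff (Set.range (appendEmb p r h)) w u then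
    (if fstBits (w ∘ appendEmb p r h) = fstBits (u ∘ appendEmb p r h) ∧
      sndBits (w ∘ appendEmb p r h) = xorBits (sndBits (u ∘ appendEmb p r h))
        (f (fstBits (u ∘ appendEmb p r h))) then (1 : ℂ) else 0) else 0) = _
  rw [hp, hr, hp', hr', ← ite_and]
  congr 1
  rw [eq_iff_iff]
  constructor
  · rintro ⟨h1, h2, h3⟩
    funext j
    by_cases hj : ∃ i, r i = j
    · obtain ⟨i, rfl⟩ := hj
      rw [r.injective.extend_apply]
      exact congrFun h3 i
    · rw [Function.extend_apply' _ _ _ hj]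
      by_cases hj' : ∃ i, p i = j
      · obtain ⟨i, rfl⟩ := hj'
        exact congrFun h2 i
      · refine h1 j ?_
        rintro ⟨i, hi⟩
        revert hi
        refine Fin.addCases (fun k hk => hj' ⟨k, ?_⟩) (fun k hk => hj ⟨k, ?_⟩) i
        · rw [← hk]; exact (Fin.append_left _ _ k).symm
        · rw [← hk]; exact (Fin.append_right _ _ k).symm
  · rintro rfl
    refine ⟨fun j hj => ?_, ?_, ?_⟩
    · refine Function.extend_apply' _ _ _ ?_
      rintro ⟨k, rfl⟩
      exact hj ⟨Fin.natAdd a k, Fin.append_right _ _ k⟩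
    · funext i
      refine Function.extend_apply' _ _ _ ?_
      rintro ⟨k, hk⟩
      exact h i k hk.symm
    · funext i
      exact r.injective.extend_apply _ _ _

/-- The state oracle `|x⟩ ↦ |x⟩ ⊗ 2^{-n/2} ∑_y (-1)^{G(x, y, f(sel(x, y)))} |y⟩`. -/
def simState {a b d n : ℕ} (G : Bits (d + n + b) → Bits 1) (sel : Fin a ↪ Fin (d + n))
    (f : Bits a → Bits b) : Bits d → Bits n → ℂ :=
  signState fun w => G (Fin.append (Fin.append w.1 w.2)
    (f fun i => (Fin.append w.1 w.2 : Bits (d + n)) (sel i))) 0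

theorem exists_disjoint_embedding {N N' k : ℕ} (π : Fin N ↪ Fin N') (h : N + k ≤ N') :
    ∃ η : Fin k ↪ Fin N', ∀ i j, π i ≠ η j := by
  have hc : k ≤ ((Finset.univ.map π)ᶜ).card := by
    rw [Finset.card_compl, Finset.card_map, Fintype.card_fin, Finset.card_univ, Fintype.card_fin]
    omega
  refine ⟨(Finset.orderEmbOfCardLe _ hc).toEmbedding, fun i j hij => ?_⟩
  have h1 := Finset.orderEmbOfCardLe_mem _ hc j
  rw [Finset.mem_compl] at h1
  exact h1 (Finset.mem_map.2 ⟨i, Finset.mem_univ _, hij⟩)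

theorem stateKraus_mulVec_ket {d n N : ℕ} (ψ : Bits d → Bits n → ℂ) (e : Fin d ↪ Fin N)
    (v : Bits N) :
    stateKraus ψ e *ᵥ ket v = ∑ y : Bits n, ψ (v ∘ e) y • ket (Fin.append v y) := by
  rw [mulVec_ket]
  funext u
  have h : ∀ y : Bits n, (u = Fin.append v y) ↔ (fstBits u = v ∧ sndBits u = y) := fun y => by
    rw [← (splitBits N n).apply_eq_iff_eq, ← Prod.mk.injEq]
    change (fstBits u, sndBits u) = (fstBits (Fin.append v y), sndBits (Fin.append v y)) ↔ _
    rw [fstBits_append, sndBits_append]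
  simp only [stateKraus, Matrix.of_apply, Finset.sum_apply, Pi.smul_apply, ket_apply, h,
    smul_eq_mul, mul_ite, mul_one, mul_zero, ite_and]
  by_cases hu : fstBits u = v
  · simp [hu]
  · simp [hu]

/-- A query to the oracle `simState G sel f` is simulated by two queries to `f`. -/
theorem exists_query_simulation {a b d n N N' : ℕ} (C : BoolCircuit 1 (d + n + b))
    (sel : Fin a ↪ Fin (d + n)) (e : Fin d ↪ Fin N) (π : Fin N ↪ Fin N')
    (hN : N + (n + (b + C.gates)) ≤ N') :
    ∃ (g₁ g₂ : List (Gate N')) (q : Fin (a + b) ↪ Fin N') (π' : Fin (N + n) ↪ Fin N'),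
      g₁.length ≤ n ∧ g₂.length ≤ 82 * C.gates + 4 ∧
      ∀ f : Bits a → Bits b, queryMat f q * (runGates g₂ * (queryMat f q * (runGates g₁ *
        placeMat π))) = placeMat π' * stateKraus (simState C.eval sel f) e := by
  obtain ⟨η, hη⟩ := exists_disjoint_embedding π hN
  let y : Fin n ↪ Fin N' := (Fin.castAddEmb _).trans η
  let r : Fin b ↪ Fin N' := ((Fin.castAddEmb _).trans (Fin.natAddEmb n)).trans η
  let c : Fin C.gates ↪ Fin N' := ((Fin.natAddEmb b).trans (Fin.natAddEmb n)).trans η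
  have hπy : ∀ i j, π i ≠ y j := fun i j => hη i _
  have hπr : ∀ i j, π i ≠ r j := fun i j => hη i _
  have hπc : ∀ i j, π i ≠ c j := fun i j => hη i _
  have hyr : ∀ i j, y i ≠ r j := fun i j h => by
    have := congrArg Fin.val (η.injective h)
    simp at this
    omega
  have hyc : ∀ i j, y i ≠ c j := fun i j h => by
    have := congrArg Fin.val (η.injective h)
    simp at this
    omega
  have hrc : ∀ i j, r i ≠ c j := fun i j h => by
    have := congrArg Fin.val (η.injective h)
    simp at this
    omega
  let π' : Fin (N + n) ↪ Fin N' := appendEmb π y hπy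
  let xy : Fin (d + n) ↪ Fin N' := appendEmb (e.trans π) y fun i j => hπy _ j
  have hxy_l : ∀ i, xy (Fin.castAdd n i) = π (e i) := fun i => Fin.append_left _ _ i
  have hxy_r : ∀ i, xy (Fin.natAdd d i) = y i := fun i => Fin.append_right _ _ i
  have hxyr : ∀ i j, xy i ≠ r j := fun i j => by
    refine Fin.addCases (fun k => ?_) (fun k => ?_) i
    · rw [hxy_l]; exact hπr _ j
    · rw [hxy_r]; exact hyr k j
  have hxyc : ∀ i j, xy i ≠ c j := fun i j => by
    refine Fin.addCases (fun k => ?_) (fun k => ?_) i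
    · rw [hxy_l]; exact hπc _ j
    · rw [hxy_r]; exact hyc k j
  obtain ⟨g₁, hg₁, h1⟩ := exists_hadamards y
  have hwires : ∀ x ∈ List.ofFn c, ∀ i, (Fin.append xy r : Fin (d + n + b) → Fin N') i ≠ x := by
    intro x hx i
    obtain ⟨j, rfl⟩ := (List.mem_ofFn' _ _).1 hx
    refine Fin.addCases (fun k => ?_) (fun k => ?_) i
    · rw [Fin.append_left]; exact hxyc k j
    · rw [Fin.append_right]; exact hrc k j
  obtain ⟨g₂, hg₂, h2⟩ := exists_sign_of_circuit C (Fin.append xy r) (List.ofFn c)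
    (List.nodup_ofFn.2 c.injective) hwires (by simp)
  have hsel : ∀ i j, (sel.trans xy) i ≠ r j := fun i j => hxyr _ j
  refine ⟨g₁, g₂, appendEmb (sel.trans xy) r hsel, π', hg₁.le, hg₂, fun f => ?_⟩
  refine matrix_ext_ket fun v => ?_
  simp only [← Matrix.mulVec_mulVec]
  have hu : ∀ j, placeBits π v (y j) = false := fun j =>
    placeBits_of_notMem π v fun i => hπy i j
  rw [placeMat_mulVec_ket, h1 _ hu, stateKraus_mulVec_ket]
  simp only [Matrix.mulVec_smul, Matrix.mulVec_sum, placeMat_mulVec_ket]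
  rw [Finset.smul_sum]
  refine Finset.sum_congr rfl fun s _ => ?_
  set u₁ : Bits N' := Function.extend y s (placeBits π v) with hu₁
  have hu₁y : ∀ i, u₁ (y i) = s i := fun i => y.injective.extend_apply _ _ _
  have hu₁n : ∀ j, (∀ i, y i ≠ j) → u₁ j = placeBits π v j := fun j hj =>
    Function.extend_apply' _ _ _ fun ⟨i, hi⟩ => hj i hi
  have hu₁r : ∀ j, u₁ (r j) = false := fun j => by
    rw [hu₁n _ fun i => hyr i j]
    exact placeBits_of_notMem π v fun i => hπr i j
  have hu₁c : ∀ j, u₁ (c j) = false := fun j => by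
    rw [hu₁n _ fun i => hyc i j]
    exact placeBits_of_notMem π v fun i => hπc i j
  have hu₁xy : (fun i => u₁ (xy i)) = (Fin.append (v ∘ e) s : Bits (d + n)) := by
    funext i
    refine Fin.addCases (fun k => ?_) (fun k => ?_) i
    · rw [hxy_l, Fin.append_left, hu₁n _ fun j => (hπy _ j).symm, placeBits_apply]
      rfl
    · rw [hxy_r, Fin.append_right, hu₁y]
  set z : Bits b := f fun i => (Fin.append (v ∘ e) s : Bits (d + n)) (sel i) with hz
  have hfz : ∀ u : Bits N', (fun i => u (xy i)) = (Fin.append (v ∘ e) s : Bits (d + n)) →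
      (f fun i => u ((sel.trans xy) i)) = z := by
    intro u hu
    rw [hz, ← hu]
    rfl
  set u₂ : Bits N' := Function.extend r z u₁ with hu₂
  have hu₂r : ∀ j, u₂ (r j) = z j := fun j => r.injective.extend_apply _ _ _
  have hu₂n : ∀ j, (∀ i, r i ≠ j) → u₂ j = u₁ j := fun j hj =>
    Function.extend_apply' _ _ _ fun ⟨i, hi⟩ => hj i hi
  have hu₂xy : (fun i => u₂ (xy i)) = (Fin.append (v ∘ e) s : Bits (d + n)) := by
    rw [← hu₁xy]
    exact funext fun i => hu₂n _ fun j => (hxyr i j).symm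
  -- The first query writes the value of f into the zero register `r`. The sign gates leave basis
  -- states fixed, so the second query clears `r` again.
  have hx1 : xorBits (fun i => u₁ (r i)) z = z := by
    funext i
    simp [xorBits, hu₁r]
  have hx2 : xorBits (fun i => u₂ (r i)) z = zeroBits b := by
    funext i
    simp [xorBits, hu₂r, zeroBits]
  have hback : Function.extend r (zeroBits b) u₂ = u₁ := by
    funext j
    by_cases hj : ∃ i, r i = j
    · obtain ⟨i, rfl⟩ := hj
      rw [r.injective.extend_apply, hu₁r]; rfl
    · rw [Function.extend_apply' _ _ _ hj]
      exact hu₂n _ fun i hi => hj ⟨i, hi⟩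
  rw [queryMat_mulVec_ket, hfz u₁ hu₁xy, hx1, ← hu₂, h2 u₂, Matrix.mulVec_smul, queryMat_mulVec_ket,
    hfz u₂ hu₂xy, hx2, hback]
  · have hw : (fun i => u₂ ((Fin.append xy r : Fin (d + n + b) → Fin N') i)) =
        (Fin.append (Fin.append (v ∘ e) s) z : Bits (d + n + b)) := by
      funext i
      refine Fin.addCases (fun k => ?_) (fun k => ?_) i
      · rw [Fin.append_left, Fin.append_left]; exact congrFun hu₂xy k
      · rw [Fin.append_right, Fin.append_right, hu₂r]
    have hp : u₁ = placeBits π' (Fin.append v s) := by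
      funext j
      by_cases hj : ∃ i, y i = j
      · obtain ⟨i, rfl⟩ := hj
        have : y i = π' (Fin.natAdd N i) := (Fin.append_right _ _ i).symm
        rw [hu₁y, this, placeBits_apply, Fin.append_right]
      · rw [hu₁n _ fun i hi => hj ⟨i, hi⟩]
        by_cases hj' : ∃ i, π i = j
        · obtain ⟨i, rfl⟩ := hj'
          have : π i = π' (Fin.castAdd n i) := (Fin.append_left _ _ i).symm
          rw [placeBits_apply, this, placeBits_apply, Fin.append_left]
        · rw [placeBits_of_notMem π v fun i hi => hj' ⟨i, hi⟩, placeBits_of_notMem]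
          intro i
          refine Fin.addCases (fun k hk => hj' ⟨k, ?_⟩) (fun k hk => hj ⟨k, ?_⟩) i
          · rw [← hk]; exact (Fin.append_left _ _ k).symm
          · rw [← hk]; exact (Fin.append_right _ _ k).symm
    rw [hw, hp, smul_smul, mul_comm]
    rfl
  · intro x hx
    obtain ⟨j, rfl⟩ := (List.mem_ofFn' _ _).1 hx
    rw [hu₂n _ fun i => hrc i j, hu₁c]

theorem sum_placeMat_conj {N N' : ℕ} (π : Fin N ↪ Fin N') (ρ : Op N) (i : Fin N) :
    (∑ w, if w (π i) then ((placeMat π * ρ * (placeMat π)ᴴ) w w).re else 0) =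
      ∑ v, if v i then (ρ v v).re else 0 := by
  rw [← Finset.sum_subset (Finset.subset_univ (Finset.univ.map ⟨placeBits π, placeBits_injective π⟩))]
  · rw [Finset.sum_map]
    simp only [Function.Embedding.coeFn_mk, placeBits_apply, placeMat,
      mapMat_conj_apply (placeBits_injective π)]
  · intro w _ hw
    rw [placeMat, mapMat_conj_apply_left ρ, Complex.zero_re, ite_self]
    rintro ⟨v, rfl⟩
    exact hw (Finset.mem_map.2 ⟨v, Finset.mem_univ _, rfl⟩)

/-- A function oracle returns no fresh qubits, so all space is reserved in advance: n qubits per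
query for the replies, and one work area of b + |G| qubits, which every simulated query returns to
zero and the next reuses. The embedding π records where the live qubits sit; everything outside its
range is zero. -/
theorem exists_circuit_simulation {a b d n N' : ℕ} (G : BoolCircuit 1 (d + n + b))
    (sel : Fin a ↪ Fin (d + n)) {N : ℕ} (C : OracleCircuit d n N) (π : Fin N ↪ Fin N')
    (hN : N + C.queries * n + (b + G.gates) ≤ N') :
    ∃ C' : OracleCircuit (a + b) 0 N',
      C'.size ≤ C.size * (n + 82 * G.gates + 6) ∧
      ∀ (f : Bits a → Bits b) (ρ : Op N),
        C'.accept (functionOracle f) (placeMat π * ρ * (placeMat π)ᴴ) =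
          C.accept (stateOracle (simState G.eval sel f)) ρ := by
  induction C with
  | measure i =>
    refine ⟨.measure (π i), ?_, fun f ρ => sum_placeMat_conj π ρ i⟩
    simp only [OracleCircuit.size]
    omega
  | gate g C ih =>
    obtain ⟨C', hs, hC'⟩ := ih π hN
    refine ⟨.gate (g.map π) C', ?_, fun f ρ => ?_⟩
    · change C'.size + 1 ≤ (C.size + 1) * _
      rw [Nat.succ_mul]
      omega
    · rw [OracleCircuit.accept, OracleCircuit.accept, ← hC', conj_conj, conj_conj,
        map_mat_mul_placeMat]
  | query e C ih =>
    rw [OracleCircuit.queries, Nat.succ_mul] at hN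
    obtain ⟨g₁, g₂, q, π', hg₁, hg₂, hq⟩ := exists_query_simulation G sel e π (by omega)
    obtain ⟨C', hs, hC'⟩ := ih π' (by omega)
    let C₂ : OracleCircuit (a + b) 0 N' := .query q C'
    let C₁ : OracleCircuit (a + b) 0 N' := .query q (C₂.withGates g₂)
    refine ⟨C₁.withGates g₁, ?_, fun f ρ => ?_⟩
    · rw [OracleCircuit.size_withGates]
      change g₁.length + ((C₂.withGates g₂).size + 1) ≤ (C.size + 1) * _
      rw [OracleCircuit.size_withGates]
      change g₁.length + (g₂.length + (C'.size + 1) + 1) ≤ (C.size + 1) * _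
      rw [Nat.succ_mul]
      omega
    · have hq' := hq f
      simp only [← Matrix.mul_assoc] at hq'
      rw [OracleCircuit.accept_withGates, accept_query_functionOracle,
        OracleCircuit.accept_withGates, accept_query_functionOracle, conj_conj, conj_conj, conj_conj,
        conj_conj, hq', OracleCircuit.accept, applyAt_stateOracle, ← hC', conj_conj]

/-! ### Functionals of low degree in a random function -/

/-- Linear combinations of functionals that depend on at most `k` values of a function. -/
def LowDeg (α β : Type*) (k : ℕ) : Submodule ℂ ((α → β) → ℂ) :=
  Submodule.span ℂ {Q | ∃ T : Finset α, T.card ≤ k ∧ DependsOn Q (T : Set α)}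

theorem LowDeg.of_dependsOn {α β : Type*} {k : ℕ} {Q : (α → β) → ℂ} {T : Finset α}
    (hT : T.card ≤ k) (hQ : DependsOn Q (T : Set α)) : Q ∈ LowDeg α β k :=
  Submodule.subset_span ⟨T, hT, hQ⟩

theorem LowDeg.const {α β : Type*} (k : ℕ) (c : ℂ) : (fun _ => c) ∈ LowDeg α β k :=
  LowDeg.of_dependsOn (T := ∅) (by simp) fun _ _ _ => rfl

theorem LowDeg.mul {α β : Type*} {j k : ℕ} {P Q : (α → β) → ℂ} (hP : P ∈ LowDeg α β j)
    (hQ : Q ∈ LowDeg α β k) : (fun f => P f * Q f) ∈ LowDeg α β (j + k) := by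
  classical
  have h : LowDeg α β j * LowDeg α β k ≤ LowDeg α β (j + k) := by
    rw [LowDeg, LowDeg, Submodule.span_mul_span, Submodule.span_le]
    rintro _ ⟨P, ⟨T, hT, hP⟩, Q, ⟨T', hT', hQ⟩, rfl⟩
    refine LowDeg.of_dependsOn (T := T ∪ T') ((Finset.card_union_le _ _).trans (by omega)) ?_
    intro f g hfg
    change P f * Q f = P g * Q g
    rw [hP fun i hi => hfg i (Finset.mem_coe.2 (Finset.mem_union_left _ (Finset.mem_coe.1 hi))),
      hQ fun i hi => hfg i (Finset.mem_coe.2 (Finset.mem_union_right _ (Finset.mem_coe.1 hi)))]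
  exact h (Submodule.mul_mem_mul hP hQ)

theorem LowDeg.conj {α β : Type*} {k : ℕ} {Q : (α → β) → ℂ} (hQ : Q ∈ LowDeg α β k) :
    (fun f => star (Q f)) ∈ LowDeg α β k := by
  induction hQ using Submodule.span_induction with
  | mem Q h =>
    obtain ⟨T, hT, hQ⟩ := h
    exact LowDeg.of_dependsOn hT fun f g hfg => congrArg Star.star (hQ hfg)
  | zero => simpa using LowDeg.const (α := α) (β := β) k 0
  | add P Q _ _ hP hQ =>
    have h : (fun f => star ((P + Q) f)) = (fun f => star (P f)) + fun f => star (Q f) :=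
      funext fun f => star_add _ _
    rw [h]
    exact add_mem hP hQ
  | smul c Q _ hQ => simpa [Pi.smul_def] using Submodule.smul_mem _ (Star.star c) hQ

theorem LowDeg.mono {α β : Type*} {j k : ℕ} (h : j ≤ k) : LowDeg α β j ≤ LowDeg α β k :=
  Submodule.span_mono fun _ ⟨T, hT, hQ⟩ => ⟨T, hT.trans h, hQ⟩

theorem LowDeg.sum {α β ι : Type*} {k : ℕ} (s : Finset ι) {Q : ι → (α → β) → ℂ}
    (h : ∀ i, Q i ∈ LowDeg α β k) : (fun f => ∑ i ∈ s, Q i f) ∈ LowDeg α β k := by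
  have := Submodule.sum_mem (LowDeg α β k) (t := s) fun i _ => h i
  convert this using 1
  funext f
  simp

theorem LowDeg.conj_mul {α β : Type*} {m n : Type*} [Fintype n] {j k : ℕ}
    {K : (α → β) → Matrix m n ℂ} {ρ : (α → β) → Matrix n n ℂ}
    (hK : ∀ u v, (fun f => K f u v) ∈ LowDeg α β j)
    (hρ : ∀ u v, (fun f => ρ f u v) ∈ LowDeg α β k) (u v : m) :
    (fun f => (K f * ρ f * (K f)ᴴ) u v) ∈ LowDeg α β (k + 2 * j) := by
  have h : ∀ f, (K f * ρ f * (K f)ᴴ) u v =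
      ∑ w, (∑ w', K f u w' * ρ f w' w) * star (K f v w) := fun f => by
    simp only [Matrix.mul_apply, Matrix.conjTranspose_apply]
  simp only [h]
  refine LowDeg.sum _ fun w => LowDeg.mono (j := j + k + j) (by omega) ?_
  exact LowDeg.mul (LowDeg.sum _ fun w' => LowDeg.mul (hK u w') (hρ w' w)) (LowDeg.conj (hK v w))

/-- A query multiplies the density matrix from both sides by a matrix of degree 1, so the degree
grows by 2 per query. Gates do not involve the function. -/
theorem accept_mem_lowDeg {α β : Type*} {d n N : ℕ} (C : OracleCircuit d n N)
    {ψ : (α → β) → Bits d → Bits n → ℂ} (hψ : ∀ x y, (fun f => ψ f x y) ∈ LowDeg α β 1) {k : ℕ}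
    {ρ : (α → β) → Op N} (hρ : ∀ u v, (fun f => ρ f u v) ∈ LowDeg α β k) :
    (fun f => ((C.accept (stateOracle (ψ f)) (ρ f) : ℝ) : ℂ)) ∈
      LowDeg α β (k + 2 * C.queries) := by
  induction C generalizing k with
  | measure i =>
    simp only [OracleCircuit.accept, Complex.ofReal_sum]
    refine LowDeg.sum _ fun w => ?_
    split_ifs
    · have h : ∀ f, (((ρ f w w).re : ℝ) : ℂ) = 2⁻¹ * (ρ f w w + star (ρ f w w)) := fun f => by
        rw [Complex.star_def, Complex.add_conj]
        push_cast
        ring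
      simp only [h]
      exact Submodule.smul_mem (LowDeg α β k) (2⁻¹ : ℂ) (add_mem (hρ w w) (LowDeg.conj (hρ w w)))
    · exact LowDeg.const _ _
  | gate g C ih =>
    exact ih (k := k) (ρ := fun f => g.mat * ρ f * g.matᴴ) fun u v =>
      LowDeg.conj_mul (j := 0) (K := fun _ => g.mat) (fun u v => LowDeg.const 0 (g.mat u v)) hρ u v
  | query e C ih =>
    simp only [OracleCircuit.accept, applyAt_stateOracle]
    refine LowDeg.mono (j := k + 2 * 1 + 2 * C.queries)
      (by simp only [OracleCircuit.queries]; omega) 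
      (ih (ρ := fun f => stateKraus (ψ f) e * ρ f * (stateKraus (ψ f) e)ᴴ) fun u v =>
        LowDeg.conj_mul (j := 1) (K := fun f => stateKraus (ψ f) e) (fun u v => ?_) hρ u v)
    simp only [stateKraus, Matrix.of_apply]
    split_ifs
    · exact hψ _ _
    · exact LowDeg.const _ _

theorem LowDeg.expect_eq {α β I : Type*} [Fintype I] [Fintype (α → β)] {k : ℕ} {h : I → α → β}
    (hind : ∀ T : Finset α, T.card ≤ k → ∀ Q : (α → β) → ℂ, DependsOn Q (T : Set α) →
      𝔼 s, Q (h s) = 𝔼 f, Q f) {Q : (α → β) → ℂ} (hQ : Q ∈ LowDeg α β k) :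
    𝔼 s, Q (h s) = 𝔼 f, Q f := by
  induction hQ using Submodule.span_induction with
  | mem Q hQ =>
    obtain ⟨T, hT, hQ⟩ := hQ
    exact hind T hT Q hQ
  | zero => simp
  | add P Q _ _ hP hQ => simp only [Pi.add_apply, Finset.expect_add_distrib, hP, hQ]
  | smul c Q _ hQ => simp only [Pi.smul_apply, ← Finset.smul_expect, hQ]

theorem ofReal_expect {ι : Type*} (s : Finset ι) (f : ι → ℝ) :
    ((𝔼 i ∈ s, f i : ℝ) : ℂ) = 𝔼 i ∈ s, (f i : ℂ) := by
  simp [Finset.expect_eq_sum_div_card]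

/-- An algorithm cannot distinguish a random function from a `2 q`-wise independent family by `q`
queries to a state oracle whose amplitudes depend on one value of the function each. -/
theorem expect_prob_eq {α β I : Type*} [Fintype I] [Fintype (α → β)] {d n k : ℕ} {h : I → α → β}
    (hind : ∀ T : Finset α, T.card ≤ k → ∀ Q : (α → β) → ℂ, DependsOn Q (T : Set α) →
      𝔼 s, Q (h s) = 𝔼 f, Q f) (A : Adversary d n) (hk : 2 * A.queries ≤ k)
    {ψ : (α → β) → Bits d → Bits n → ℂ}
    (hψ : ∀ x y, ∃ T : Finset α, T.card ≤ 1 ∧ DependsOn (fun f => ψ f x y) (T : Set α)) :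
    𝔼 s, A.prob (stateOracle (ψ (h s))) = 𝔼 f, A.prob (stateOracle (ψ f)) := by
  have h1 : (fun f => ((A.prob (stateOracle (ψ f)) : ℝ) : ℂ)) ∈ LowDeg α β k := by
    refine LowDeg.mono (j := 0 + 2 * A.queries) (by omega)
      (accept_mem_lowDeg A.circ (fun x y => ?_) fun _ _ => LowDeg.const 0 _)
    obtain ⟨T, hT, hQ⟩ := hψ x y
    exact LowDeg.of_dependsOn hT hQ
  have h2 := LowDeg.expect_eq hind h1
  rw [← ofReal_expect, ← ofReal_expect] at h2
  exact_mod_cast h2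

/-! ### Simulating adversaries -/

theorem placeBits_placeBits {N N' N'' : ℕ} (π : Fin N' ↪ Fin N'') (π' : Fin N ↪ Fin N')
    (v : Bits N) : placeBits π (placeBits π' v) = placeBits (π'.trans π) v := by
  funext j
  by_cases hj : ∃ i, π i = j
  · obtain ⟨i, rfl⟩ := hj
    rw [placeBits_apply]
    by_cases hi : ∃ k, π' k = i
    · obtain ⟨k, rfl⟩ := hi
      rw [placeBits_apply]
      exact (placeBits_apply (π'.trans π) v k).symm
    · rw [placeBits_of_notMem π' v fun k hk => hi ⟨k, hk⟩, placeBits_of_notMem]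
      exact fun k hk => hi ⟨k, π.injective hk⟩
  · rw [placeBits_of_notMem π _ fun i hi => hj ⟨i, hi⟩, placeBits_of_notMem]
    exact fun k hk => hj ⟨π' k, hk⟩

theorem placeMat_mul_placeMat {N N' N'' : ℕ} (π : Fin N' ↪ Fin N'') (π' : Fin N ↪ Fin N') :
    placeMat π * placeMat π' = placeMat (π'.trans π) :=
  matrix_ext_ket fun v => by
    rw [← Matrix.mulVec_mulVec, placeMat_mulVec_ket, placeMat_mulVec_ket, placeMat_mulVec_ket,
      placeBits_placeBits]

theorem ketbra_apply {n : ℕ} (x u v : Bits n) :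
    ketbra x u v = if u = x ∧ v = x then 1 else 0 := by
  simp only [ketbra, Matrix.single_apply, eq_comm]

theorem placeBits_castAddEmb {N : ℕ} (k : ℕ) (v : Bits N) :
    placeBits (Fin.castAddEmb k) v = Fin.append v (zeroBits k) := by
  funext j
  refine Fin.addCases (fun i => ?_) (fun i => ?_) j
  · rw [Fin.append_left]
    exact placeBits_apply (Fin.castAddEmb k) v i
  · rw [Fin.append_right, placeBits_of_notMem]
    · rfl
    · intro i hi
      have := congrArg Fin.val hi
      simp at this
      omega

theorem append_fstBits_sndBits {a b : ℕ} (w : Bits (a + b)) :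
    Fin.append (fstBits w) (sndBits w) = w := (splitBits a b).left_inv w

theorem tensor_ketbra_zero {N : ℕ} (k : ℕ) (σ : Op N) :
    tensor σ (ketbra (zeroBits k)) =
      placeMat (N := N) (Fin.castAddEmb k) * σ * (placeMat (N := N) (Fin.castAddEmb k))ᴴ := by
  have hr : ∀ w : Bits (N + k), sndBits w = zeroBits k →
      w = placeBits (Fin.castAddEmb k) (fstBits w) := fun w hw => by
    rw [placeBits_castAddEmb, ← hw, append_fstBits_sndBits]
  have hs : ∀ w : Bits (N + k), sndBits w ≠ zeroBits k →
      w ∉ Set.range (placeBits (Fin.castAddEmb k)) := by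
    rintro _ hw ⟨v, rfl⟩
    rw [placeBits_castAddEmb, sndBits_append] at hw
    exact hw rfl
  ext u v
  simp only [tensor, Matrix.of_apply, ketbra_apply]
  by_cases hu : sndBits u = zeroBits k
  · by_cases hv : sndBits v = zeroBits k
    · rw [if_pos ⟨hu, hv⟩, mul_one]
      conv_rhs => rw [hr u hu, hr v hv, placeMat, mapMat_conj_apply (placeBits_injective _)]
    · rw [if_neg fun h => hv h.2, mul_zero, placeMat, mapMat_conj_apply_right _ _ (hs v hv)]
  · rw [if_neg fun h => hu h.1, mul_zero, placeMat, mapMat_conj_apply_left _ (hs u hu)]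

theorem queries_le_size {a b N : ℕ} (C : OracleCircuit a b N) : C.queries ≤ C.size := by
  induction C with
  | measure i => exact Nat.zero_le _
  | gate g C ih => exact ih.trans (Nat.le_succ _)
  | query e C ih => exact Nat.succ_le_succ ih

theorem exists_adversary_simulation {a b d n : ℕ} (G : BoolCircuit 1 (d + n + b))
    (sel : Fin a ↪ Fin (d + n)) (A : Adversary d n) :
    ∃ B : Adversary (a + b) 0, B.size ≤ (A.size + 1) * (2 * n + b + 83 * G.gates + 7) ∧
      ∀ f : Bits a → Bits b,
        B.prob (functionOracle f) = A.prob (stateOracle (simState G.eval sel f)) := by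
  let k := A.anc + (A.queries * n + (b + G.gates))
  have hk : A.m + A.anc ≤ A.m + k := by omega
  let π : Fin (A.m + A.anc) ↪ Fin (A.m + k) := (Fin.castLEEmb hk)
  obtain ⟨C', hs, hC'⟩ := exists_circuit_simulation G sel A.circ π
    (show _ ≤ A.m + (A.anc + (A.circ.queries * n + (b + G.gates))) by omega)
  refine ⟨⟨A.m, k, A.advice, A.posSemidef, A.trace_eq_one, C'⟩, ?_, fun f => ?_⟩
  · change C'.size + A.m + (A.anc + (A.circ.queries * n + (b + G.gates))) ≤
      (A.circ.size + A.m + A.anc + 1) * _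
    have h1 : A.circ.queries * n ≤ A.circ.size * n := Nat.mul_le_mul_right _ (queries_le_size _)
    nlinarith [Nat.zero_le ((A.m + A.anc) * (2 * n + b + 83 * G.gates)),
      Nat.zero_le (A.circ.size * (b + G.gates))]
  · change C'.accept _ (tensor A.advice (ketbra (zeroBits k))) = _
    have h : tensor A.advice (ketbra (zeroBits k)) =
        placeMat π * tensor A.advice (ketbra (zeroBits A.anc)) * (placeMat π)ᴴ := by
      rw [tensor_ketbra_zero, tensor_ketbra_zero, conj_conj, placeMat_mul_placeMat]
      rfl
    rw [h, hC']
    rfl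

/-! ### Replacing the pseudorandom functions by random functions -/

theorem exists_adversary_of_computesBit {a b d n s : ℕ} {G : Bits (d + n + b) → Bool}
    (hG : ComputesBit s G) (sel : Fin a ↪ Fin (d + n)) (A : Adversary d n) :
    ∃ B : Adversary (a + b) 0, B.size ≤ (A.size + 1) * (2 * n + b + 83 * s + 7) ∧
      ∀ f : Bits a → Bits b, B.prob (functionOracle f) =
        A.prob (stateOracle (signState fun w => G (Fin.append (Fin.append w.1 w.2)
          (f fun i => (Fin.append w.1 w.2 : Bits (d + n)) (sel i))))) := by
  obtain ⟨C, hC, hCG⟩ := hG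
  obtain ⟨B, hB, h⟩ := exists_adversary_simulation C sel A
  refine ⟨B, hB.trans (Nat.mul_le_mul_left _ (by omega)), fun f => ?_⟩
  rw [h, simState, hCG]

theorem signState_congr {d n : ℕ} {g g' : Record d n → Bool} {x : Bits d} {y : Bits n}
    (h : g (x, y) = g' (x, y)) : signState g x y = signState g' x y := by
  simp only [signState, signedState, h]

/-- Replacing the first function by a random function. -/
theorem exists_adversary_first {κ d ℓ n s : ℕ} (F₁ : Bits κ → Bits d → Bits ℓ)
    {F₂ : Bits ℓ → Bits n → Bits 1}
    (hF₂ : Computes s fun w : Bits (ℓ + n) => F₂ (fstBits w) (sndBits w)) (A : Adversary d n) :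
    ∃ B : Adversary (d + ℓ) 0, B.size ≤ (A.size + 1) * (2 * n + ℓ + 83 * s + 7) ∧
      |(𝔼 k, A.prob (stateOracle (signState fun w => F₂ (F₁ k w.1) w.2 0))) -
        𝔼 f : Bits d → Bits ℓ, A.prob (stateOracle (signState fun w => F₂ (f w.1) w.2 0))| =
          prfAdvantage F₁ B := by
  have hG : ComputesBit s fun w : Bits (d + n + ℓ) => F₂ (sndBits w) (sndBits (fstBits w)) 0 := by
    have hk : Computes 0 fun w : Bits (d + n + ℓ) => sndBits w :=
      computes_select fun i => Fin.natAdd (d + n) i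
    have hy : Computes 0 fun w : Bits (d + n + ℓ) => sndBits (fstBits w) :=
      computes_select fun i => Fin.castAdd ℓ (Fin.natAdd d i)
    have h := (hF₂.comp (hk.append hy)).bit 0
    simp only [fstBits_append, sndBits_append] at h
    exact h.mono (by omega)
  -- The challenge function is evaluated at x, the first d bits of the pair (x, y).
  obtain ⟨B, hB, h⟩ := exists_adversary_of_computesBit hG (Fin.castAddEmb n) A
  refine ⟨B, hB, ?_⟩
  have h' : ∀ f : Bits d → Bits ℓ, B.prob (functionOracle f) =
      A.prob (stateOracle (signState fun w => F₂ (f w.1) w.2 0)) := fun f => by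
    rw [h]
    congr 3
    funext w
    rw [sndBits_append, fstBits_append, sndBits_append]
    congr 3
    exact funext fun i => Fin.append_left _ _ _
  simp only [prfAdvantage, h']

/-- Resampling one value of a uniform function does not change its distribution: exchanging the old
value with the new one is a bijection. -/
theorem expect_expect_update {α β : Type*} [Fintype α] [DecidableEq α] [Fintype β]
    (Q : (α → β) → ℝ) (p : α) : 𝔼 f, 𝔼 b, Q (Function.update f p b) = 𝔼 f, Q f := by
  have e : Function.Bijective fun z : (α → β) × β => (Function.update z.1 p z.2, z.1 p) := by
    refine Function.Involutive.bijective fun z => ?_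
    simp
  have h : 𝔼 z : (α → β) × β, Q (Function.update z.1 p z.2) = 𝔼 z : (α → β) × β, Q z.1 :=
    Fintype.expect_bijective _ e _ _ fun _ => rfl
  rw [← Finset.univ_product_univ, Finset.expect_product, Finset.expect_product] at h
  rw [h]
  refine Finset.expect_congr rfl fun f _ => ?_
  rcases isEmpty_or_nonempty β with hβ | hβ
  · exact isEmptyElim (f p)
  · exact Fintype.expect_const (Q f)

/-- The signs of the hybrid in which the queries in `T` are answered by a random function. -/
def hybridSign {d ℓ n : ℕ} (F₂ : Bits ℓ → Bits n → Bits 1) (T : Bits d → Bool)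
    (f : Bits d → Bits ℓ) (g : Bits d → Bits n → Bits 1) (w : Record d n) : Bool :=
  if T w.1 then g w.1 w.2 0 else F₂ (f w.1) w.2 0

/-- The signs of the hybrid in which moreover the query `p` is answered by `t`. -/
def stepSign {d ℓ n : ℕ} (F₂ : Bits ℓ → Bits n → Bits 1) (T : Bits d → Bool) (p : Bits d)
    (f : Bits d → Bits ℓ) (g : Bits d → Bits n → Bits 1) (t : Bits n → Bits 1)
    (w : Record d n) : Bool :=
  if T w.1 then g w.1 w.2 0 else if decide (w.1 = p) then t w.2 0 else F₂ (f w.1) w.2 0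

theorem hybridSign_update_right {d ℓ n : ℕ} {F₂ : Bits ℓ → Bits n → Bits 1} {T : Bits d → Bool}
    {p : Bits d} (hp : T p = false) (f : Bits d → Bits ℓ) (g : Bits d → Bits n → Bits 1)
    (t : Bits n → Bits 1) :
    hybridSign F₂ (fun x => T x || decide (x = p)) f (Function.update g p t) =
      stepSign F₂ T p f g t := by
  funext w
  by_cases h : w.1 = p
  · simp [hybridSign, stepSign, h, hp]
  · simp [hybridSign, stepSign, h]

theorem hybridSign_update_left {d ℓ n : ℕ} {F₂ : Bits ℓ → Bits n → Bits 1} {T : Bits d → Bool}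
    {p : Bits d} (hp : T p = false) (f : Bits d → Bits ℓ) (g : Bits d → Bits n → Bits 1)
    (k : Bits ℓ) :
    hybridSign F₂ T (Function.update f p k) g = stepSign F₂ T p f g (F₂ k) := by
  funext w
  by_cases h : w.1 = p
  · simp [hybridSign, stepSign, h, hp]
  · simp [hybridSign, stepSign, h]

/-- The average acceptance probability in a hybrid. -/
def hybridProb {d ℓ n : ℕ} (F₂ : Bits ℓ → Bits n → Bits 1) (A : Adversary d n)
    (T : Bits d → Bool) : ℝ :=
  𝔼 f : Bits d → Bits ℓ, 𝔼 g : Bits d → Bits n → Bits 1,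
    A.prob (stateOracle (signState (hybridSign F₂ T f g)))

/-- The advantage in distinguishing a random function from `F₂` in a hybrid, for fixed functions
answering the other queries. -/
def stepGap {d ℓ n : ℕ} (F₂ : Bits ℓ → Bits n → Bits 1) (A : Adversary d n)
    (T : Bits d → Bool) (p : Bits d) (f : Bits d → Bits ℓ) (g : Bits d → Bits n → Bits 1) : ℝ :=
  (𝔼 t : Bits n → Bits 1, A.prob (stateOracle (signState (stepSign F₂ T p f g t)))) -
    𝔼 k : Bits ℓ, A.prob (stateOracle (signState (stepSign F₂ T p f g (F₂ k))))

/-- Consecutive hybrids differ only in how the query p is answered. Resampling g at p on one side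
exposes a fresh random function, resampling f at p on the other a fresh uniform key; by `T p =
false` no other query reads these values. This is where F₁ must already be replaced, since it needs
independent keys for different queries. -/
theorem hybridProb_sub {d ℓ n : ℕ} (F₂ : Bits ℓ → Bits n → Bits 1) (A : Adversary d n)
    {T : Bits d → Bool} {p : Bits d} (hp : T p = false) :
    hybridProb F₂ A (fun x => T x || decide (x = p)) - hybridProb F₂ A T =
      𝔼 f, 𝔼 g, stepGap F₂ A T p f g := by
  have h1 : hybridProb F₂ A (fun x => T x || decide (x = p)) =
      𝔼 f, 𝔼 g, 𝔼 t : Bits n → Bits 1,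
        A.prob (stateOracle (signState (stepSign F₂ T p f g t))) := by
    refine Finset.expect_congr rfl fun f _ => ?_
    rw [← expect_expect_update _ p]
    simp only [hybridSign_update_right hp]
  have h2 : hybridProb F₂ A T =
      𝔼 f, 𝔼 g, 𝔼 k : Bits ℓ,
        A.prob (stateOracle (signState (stepSign F₂ T p f g (F₂ k)))) := by
    rw [hybridProb, ← expect_expect_update _ p]
    refine Finset.expect_congr rfl fun f _ => ?_
    rw [Finset.expect_comm]
    simp only [hybridSign_update_left hp]
  rw [h1, h2, ← Finset.expect_sub_distrib]
  simp only [← Finset.expect_sub_distrib, stepGap]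

/-- Currying of a function of two registers. -/
def curryBits {d n : ℕ} (g : Bits (d + n) → Bits 1) (x : Bits d) (y : Bits n) : Bits 1 :=
  g (Fin.append x y)

theorem bijective_curryBits {d n : ℕ} : Function.Bijective (curryBits (d := d) (n := n)) := by
  refine Function.bijective_iff_has_inverse.2 ⟨fun g w => g (fstBits w) (sndBits w), fun g => ?_,
    fun g => ?_⟩
  · exact funext fun w => congrArg g (append_fstBits_sndBits w)
  · funext x y
    change g (fstBits (Fin.append x y)) (sndBits (Fin.append x y)) = _
    rw [fstBits_append, sndBits_append]

/-- The amplitude at (x, y) reads f only at x, so 2q-wise independence is enough for either of the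
two averages in the gap. -/
theorem expect_stepGap_left {d ℓ n k : ℕ} {F₂ : Bits ℓ → Bits n → Bits 1} {A : Adversary d n}
    (hk : 2 * A.queries ≤ k) {I : Type} [Fintype I] {h : I → Bits d → Bits ℓ}
    (hind : ∀ T : Finset (Bits d), T.card ≤ k → ∀ Q : (Bits d → Bits ℓ) → ℂ,
      DependsOn Q (T : Set (Bits d)) → 𝔼 s, Q (h s) = 𝔼 f, Q f)
    (T : Bits d → Bool) (p : Bits d) (g : Bits d → Bits n → Bits 1) :
    𝔼 s, stepGap F₂ A T p (h s) g = 𝔼 f, stepGap F₂ A T p f g := by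
  have key : ∀ t : Bits n → Bits 1,
      𝔼 s, A.prob (stateOracle (signState (stepSign F₂ T p (h s) g t))) =
        𝔼 f, A.prob (stateOracle (signState (stepSign F₂ T p f g t))) := fun t => by
    refine expect_prob_eq hind A hk (ψ := fun f => signState (stepSign F₂ T p f g t))
      fun x y => ⟨{x}, by simp, fun f f' hf => signState_congr ?_⟩
    simp only [stepSign, hf (i := x) (by simp)]
  simp only [stepGap, Finset.expect_sub_distrib]
  rw [Finset.expect_comm, Finset.expect_comm (t := Finset.univ (α := Bits ℓ))]
  simp only [key]
  rw [Finset.expect_comm, Finset.expect_comm (s := Finset.univ (α := Bits ℓ))]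

theorem expect_stepGap_right {d ℓ n k : ℕ} {F₂ : Bits ℓ → Bits n → Bits 1} {A : Adversary d n}
    (hk : 2 * A.queries ≤ k) {I : Type} [Fintype I] {h : I → Bits (d + n) → Bits 1}
    (hind : ∀ T : Finset (Bits (d + n)), T.card ≤ k → ∀ Q : (Bits (d + n) → Bits 1) → ℂ,
      DependsOn Q (T : Set (Bits (d + n))) → 𝔼 s, Q (h s) = 𝔼 f, Q f)
    (T : Bits d → Bool) (p : Bits d) (f : Bits d → Bits ℓ) :
    𝔼 s, stepGap F₂ A T p f (curryBits (h s)) = 𝔼 g, stepGap F₂ A T p f g := by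
  have key : ∀ t : Bits n → Bits 1,
      𝔼 s, A.prob (stateOracle (signState (stepSign F₂ T p f (curryBits (h s)) t))) =
        𝔼 g, A.prob (stateOracle (signState (stepSign F₂ T p f g t))) := fun t => by
    rw [← Fintype.expect_bijective curryBits bijective_curryBits
      (fun g => A.prob (stateOracle (signState (stepSign F₂ T p f (curryBits g) t)))) _
      fun _ => rfl]
    refine expect_prob_eq hind A hk (ψ := fun g => signState (stepSign F₂ T p f (curryBits g) t))
      fun x y => ⟨{Fin.append x y}, by simp, fun g g' hg => signState_congr ?_⟩
    simp only [stepSign, curryBits, hg (i := Fin.append x y) (by simp)]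
  simp only [stepGap, Finset.expect_sub_distrib]
  rw [Finset.expect_comm, Finset.expect_comm (t := Finset.univ (α := Bits ℓ))]
  simp only [key]
  rw [Finset.expect_comm, Finset.expect_comm (s := Finset.univ (α := Bits ℓ))]

/-- The averaging argument by which non-uniform adversaries get a hardwired choice in place of a
random one. -/
theorem exists_abs_expect_le {ι : Type*} [Fintype ι] [Nonempty ι] (X : ι → ℝ) :
    ∃ i, |𝔼 j, X j| ≤ |X i| := by
  obtain ⟨i, hi⟩ := Finite.exists_max fun i => |X i|
  refine ⟨i, (Finset.abs_expect_le _ _).trans ?_⟩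
  exact Finset.expect_le Finset.univ_nonempty fun j _ => hi j

/-- The size of a circuit that computes `stepSign` with hash functions for `f` and `g`. -/
def stepGates (d ℓ n k s : ℕ) : ℕ :=
  14 * d + 20 + hashGates (d + n) 1 k + hashGates d ℓ k + s

/-- The random functions f and g of the hybrid are replaced by hash functions without error, and the
best pair of hash keys is fixed. The sign then is a small circuit in x, y and a single value of the
challenge function. -/
theorem exists_adversary_step {d ℓ n s : ℕ} {F₂ : Bits ℓ → Bits n → Bits 1}
    (hF₂ : Computes s fun w : Bits (ℓ + n) => F₂ (fstBits w) (sndBits w)) (A : Adversary d n)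
    {T : Bits d → Bool} {p : Bits d} (hT : Segment d T p) :
    ∃ B : Adversary (n + 1) 0,
      B.size ≤ (A.size + 1) * (2 * n + 1 + 83 * stepGates d ℓ n (2 * A.queries) s + 7) ∧
      |hybridProb F₂ A (fun x => T x || decide (x = p)) - hybridProb F₂ A T| ≤
        prfAdvantage F₂ B := by
  obtain ⟨I, _, _, h, hh, hind⟩ := exists_independent_family d ℓ (2 * A.queries)
  obtain ⟨I', _, _, h', hh', hind'⟩ := exists_independent_family (d + n) 1 (2 * A.queries)
  -- The two functions are replaced in turn, each for every fixed value of the other.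
  have hgap : 𝔼 f, 𝔼 g, stepGap F₂ A T p f g =
      𝔼 z : I × I', stepGap F₂ A T p (h z.1) (curryBits (h' z.2)) := by
    simp only [← expect_stepGap_right le_rfl hind']
    rw [Finset.expect_comm]
    simp only [← expect_stepGap_left le_rfl hind]
    rw [Finset.expect_comm, ← Finset.univ_product_univ, Finset.expect_product]
  obtain ⟨⟨i, i'⟩, hi⟩ := exists_abs_expect_le fun z : I × I' =>
    stepGap F₂ A T p (h z.1) (curryBits (h' z.2))
  have hG : ComputesBit (stepGates d ℓ n (2 * A.queries) s) fun w : Bits (d + n + 1) =>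
      if T (fstBits (fstBits w)) then h' i' (fstBits w) 0
      else if decide (fstBits (fstBits w) = p) then sndBits w 0
      else F₂ (h i (fstBits (fstBits w))) (sndBits (fstBits w)) 0 := by
    have hx : Computes 0 fun w : Bits (d + n + 1) => fstBits (fstBits w) :=
      computes_select fun i => Fin.castAdd 1 (Fin.castAdd n i)
    have hy : Computes 0 fun w : Bits (d + n + 1) => sndBits (fstBits w) :=
      computes_select fun i => Fin.castAdd 1 (Fin.natAdd d i)
    have hxy : Computes 0 fun w : Bits (d + n + 1) => fstBits w :=
      computes_select fun i => Fin.castAdd 1 i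
    have h1 := hT.computesBit.comp hx
    have h2 := ((hh' i').comp hxy).bit 0
    have h3 := (computesBit_eq p).comp hx
    have h4 : ComputesBit 0 fun w : Bits (d + n + 1) => sndBits w 0 :=
      computesBit_select (Fin.natAdd (d + n) 0)
    have h5 := (hF₂.comp (((hh i).comp hx).append hy)).bit 0
    simp only [fstBits_append, sndBits_append] at h5
    refine (h1.ite h2 (h3.ite h4 h5)).mono ?_
    simp only [stepGates]
    omega
  -- The challenge function is evaluated at y, the last n bits of (x, y), on every query; the
  -- circuit uses the value only when x = p.
  obtain ⟨B, hB, hprob⟩ := exists_adversary_of_computesBit hG (Fin.natAddEmb d) A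
  refine ⟨B, hB, ?_⟩
  rw [hybridProb_sub F₂ A hT.apply_self, hgap]
  refine hi.trans_eq ?_
  have h' : ∀ t : Bits n → Bits 1, B.prob (functionOracle t) =
      A.prob (stateOracle (signState (stepSign F₂ T p (h i) (curryBits (h' i')) t))) := fun t => by
    rw [hprob]
    congr 3
    funext w
    have ht : (fun i => (Fin.append w.1 w.2 : Bits (d + n)) (Fin.natAddEmb d i)) = w.2 :=
      funext fun i => Fin.append_right _ _ _
    rw [sndBits_append, fstBits_append, sndBits_append, fstBits_append, ht]
    rfl
  simp only [prfAdvantage, stepGap, h']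
  exact abs_sub_comm _ _

theorem exists_segment (d : ℕ) : ∃ T p, Segment d T p := by
  induction d with
  | zero => exact ⟨_, _, .zero⟩
  | succ d ih =>
    obtain ⟨T, p, h⟩ := ih
    exact ⟨_, _, h.left⟩

/-- Taking the largest step of the chain, rather than a random one, yields a single adversary for
each security parameter. The asymptotic security of F₂ can then be applied to one family although
the number of steps is exponential. -/
theorem exists_segment_ge {d : ℕ} (Φ : (Bits d → Bool) → ℝ) :
    ∃ T p, Segment d T p ∧ |Φ (fun _ => true) - Φ fun _ => false| ≤
      2 ^ d * |Φ (fun x => T x || decide (x = p)) - Φ T| := by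
  obtain ⟨T₀, p₀, h₀⟩ := exists_segment d
  obtain ⟨z, hz, hmax⟩ := Set.exists_max_image {z : (Bits d → Bool) × Bits d | Segment d z.1 z.2}
    (fun z => |Φ (fun x => z.1 x || decide (x = z.2)) - Φ z.1|) (Set.toFinite _) ⟨(T₀, p₀), h₀⟩
  exact ⟨z.1, z.2, hz, abs_telescope Φ _ fun T p h => hmax (T, p) h⟩

theorem hybridProb_false {d ℓ n : ℕ} (F₂ : Bits ℓ → Bits n → Bits 1) (A : Adversary d n) :
    hybridProb F₂ A (fun _ => false) =
      𝔼 f : Bits d → Bits ℓ, A.prob (stateOracle (signState fun w => F₂ (f w.1) w.2 0)) := by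
  have e : ∀ f g, hybridSign F₂ (fun _ => false) f g = fun w : Record d n => F₂ (f w.1) w.2 0 :=
    fun f g => rfl
  simp only [hybridProb, e, Fintype.expect_const]

theorem hybridProb_true {d ℓ n : ℕ} (F₂ : Bits ℓ → Bits n → Bits 1) (A : Adversary d n) :
    hybridProb F₂ A (fun _ => true) =
      𝔼 g : Record d n → Bool, A.prob (stateOracle (signState g)) := by
  have e : Function.Bijective fun (g : Bits d → Bits n → Bits 1) (w : Record d n) =>
      g w.1 w.2 0 := by
    refine Function.bijective_iff_has_inverse.2 ⟨fun g x y _ => g (x, y), fun g => ?_,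
      fun g => rfl⟩
    funext x y i
    rw [Subsingleton.elim i 0]
  have h : ∀ f g, hybridSign F₂ (fun _ => true) f g = fun w : Record d n => g w.1 w.2 0 :=
    fun f g => rfl
  simp only [hybridProb, h, Fintype.expect_const]
  exact Fintype.expect_bijective _ e
    (fun g => A.prob (stateOracle (signState fun w : Record d n => g w.1 w.2 0)))
    (fun g => A.prob (stateOracle (signState g))) fun _ => rfl

/-- Replacing the second function by a random function. -/
theorem exists_adversary_second {d ℓ n s : ℕ} {F₂ : Bits ℓ → Bits n → Bits 1}
    (hF₂ : Computes s fun w : Bits (ℓ + n) => F₂ (fstBits w) (sndBits w)) (A : Adversary d n) :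
    ∃ B : Adversary (n + 1) 0,
      B.size ≤ (A.size + 1) * (2 * n + 1 + 83 * stepGates d ℓ n (2 * A.queries) s + 7) ∧
      |(𝔼 f : Bits d → Bits ℓ, A.prob (stateOracle (signState fun w => F₂ (f w.1) w.2 0))) -
        𝔼 g : Record d n → Bool, A.prob (stateOracle (signState g))| ≤
          2 ^ d * prfAdvantage F₂ B := by
  obtain ⟨T, p, hT, h⟩ := exists_segment_ge (hybridProb F₂ A)
  obtain ⟨B, hB, hgap⟩ := exists_adversary_step hF₂ A hT
  refine ⟨B, hB, ?_⟩
  rw [← hybridProb_false, ← hybridProb_true F₂, abs_sub_comm]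
  exact h.trans (mul_le_mul_of_nonneg_left hgap (by positivity))

/-! ### The construction prepares the states with signs `F₂ (F₁ k x) y` -/

theorem mapMat_mul_apply {α γ : Type*} [Fintype α] [DecidableEq α] {φ : α → α}
    (hφ : Function.Involutive φ) (M : Matrix α γ ℂ) (r : α) (x : γ) :
    (mapMat φ * M) r x = M (φ r) x := by
  have : ∀ s, (r = φ s) ↔ (s = φ r) := fun s => by
    rw [eq_comm, hφ.eq_iff]
  simp [Matrix.mul_apply, mapMat, this]

theorem xorBits_xorBits {n : ℕ} (u v : Bits n) : xorBits u (xorBits u v) = v := by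
  funext i
  simp [xorBits]

theorem xorBits_eq_zero_iff {n : ℕ} (u v : Bits n) : xorBits u v = zeroBits n ↔ v = u := by
  constructor
  · intro h
    rw [← xorBits_xorBits u v, h]
    funext i
    simp [xorBits, zeroBits]
  · rintro rfl
    funext i
    simp [xorBits, zeroBits]

theorem xorBits_comm {n : ℕ} (u v : Bits n) : xorBits u v = xorBits v u :=
  funext fun _ => Bool.xor_comm _ _

theorem hadamardY_mul_unitaryV_initRegs {d ℓ n : ℕ} (f : Bits d → Bits ℓ) (r : Reg d ℓ n)
    (x : Bits d) :
    (hadamardY d ℓ n * (unitaryV n f * initRegs d ℓ n)) r x =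
      if r.1 = x ∧ r.2.1 = f x then
        1 / (Real.sqrt 2 : ℂ) ^ n * (boolSign (r.2.2.2 0) / (Real.sqrt 2 : ℂ)) else 0 := by
  have hV : Function.Involutive fun s : Reg d ℓ n =>
      (s.1, xorBits (f s.1) s.2.1, s.2.2.1, s.2.2.2) := fun s => by
    simp [xorBits_xorBits]
  have h1 : ∀ s, (unitaryV n f * initRegs d ℓ n) s x =
      if s.1 = x ∧ s.2.1 = f x ∧ s.2.2.1 = zeroBits n then
        boolSign (s.2.2.2 0) / (Real.sqrt 2 : ℂ) else 0 := fun s => by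
    refine (mapMat_mul_apply hV _ s x).trans ?_
    simp only [initRegs, Matrix.of_apply, xorBits_eq_zero_iff, boolSign]
    by_cases hs : s.1 = x
    · simp [hs]
    · simp [hs]
  rw [Matrix.mul_apply, Finset.sum_eq_single (r.1, r.2.1, zeroBits n, r.2.2.2)]
  · rw [h1]
    simp [hadamardY, zeroBits]
  · intro s _ hs
    rw [h1]
    by_cases h : s.1 = x ∧ s.2.1 = f x ∧ s.2.2.1 = zeroBits n
    · have : ¬(r.1 = s.1 ∧ r.2.1 = s.2.1 ∧ r.2.2.2 = s.2.2.2) := by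
        rintro ⟨ha, hb, hc⟩
        refine hs ?_
        rw [ha, hb, hc, ← h.2.2]
      simp [hadamardY, this]
    · rw [if_neg h, mul_zero]
  · intro h
    exact absurd (Finset.mem_univ _) h

/-- The signs of the states that the construction prepares. -/
def constructionSign {d ℓ n : ℕ} (f : Bits d → Bits ℓ) (g : Bits ℓ → Bits n → Bits 1)
    (w : Record d n) : Bool := g (f w.1) w.2 0

/-- The amplitude with which the registers `K` and `Anc` end up in a basis state. -/
def discardAmp {ℓ : ℕ} (s : Bits ℓ × Bits 1) : ℂ :=
  if s.1 = zeroBits ℓ then boolSign (s.2 0) / (Real.sqrt 2 : ℂ) else 0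

/-- The evaluation acts on |-⟩ as a sign, and the second V maps the key register back to zero. So K
and Anc end in a pure state independent of the query and the reply, and all Kraus operators are
multiples of one isometry. -/
theorem constructionOracle_kraus {d ℓ n : ℕ} (f : Bits d → Bits ℓ) (g : Bits ℓ → Bits n → Bits 1)
    (s : Bits ℓ × Bits 1) :
    (constructionOracle f g).kraus s =
      discardAmp s • (stateOracle (signState (constructionSign f g))).kraus () := by
  have hV : Function.Involutive fun s : Reg d ℓ n =>
      (s.1, xorBits (f s.1) s.2.1, s.2.2.1, s.2.2.2) := fun s => by
    simp [xorBits_xorBits]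
  have hE : Function.Involutive fun s : Reg d ℓ n =>
      (s.1, s.2.1, s.2.2.1, xorBits s.2.2.2 (g s.2.1 s.2.2.1)) := fun s => by
    simp only [xorBits_comm _ (g s.2.1 s.2.2.1), xorBits_xorBits]
  ext u x
  obtain ⟨κ, c⟩ := s
  have h : (constructionOracle f g).kraus (κ, c) u x =
      (unitaryV n f * (evalAnc d g * (hadamardY d ℓ n * (unitaryV n f * initRegs d ℓ n))))
        (u.1, κ, u.2, c) x := by
    simp only [constructionOracle, constructionMat, Matrix.of_apply, Matrix.mul_assoc]
  rw [h]
  refine (mapMat_mul_apply hV _ _ _).trans ((mapMat_mul_apply hE _ _ _).trans ?_)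
  rw [hadamardY_mul_unitaryV_initRegs]
  simp only [Matrix.smul_apply, stateOracle, Matrix.of_apply, discardAmp, smul_eq_mul, signState,
    signedState, constructionSign]
  by_cases hx : u.1 = x
  · subst hx
    have hκ : xorBits (f u.1) κ = f u.1 ↔ κ = zeroBits ℓ := by
      constructor
      · intro h
        have := xorBits_xorBits (f u.1) κ
        rw [h] at this
        rw [← this]
        exact (xorBits_eq_zero_iff _ _).2 rfl
      · rintro rfl
        funext i
        simp [xorBits, zeroBits]
    by_cases hk : κ = zeroBits ℓ
    · subst hk
      have h2 : xorBits (f u.1) (zeroBits ℓ) = f u.1 := by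
        funext i
        simp [xorBits, zeroBits]
      have h3 : xorBits c (g (f u.1) u.2) 0 = xor (c 0) (g (f u.1) u.2 0) := rfl
      simp only [h2, h3, boolSign_xor, and_self, if_true]
      ring
    · simp only [hκ, hk, and_false, if_false, zero_mul]
  · simp [hx]

theorem sum_discardAmp (ℓ : ℕ) :
    ∑ s : Bits ℓ × Bits 1, discardAmp s * star (discardAmp s) = 1 := by
  have h : ∀ s : Bits ℓ × Bits 1, discardAmp s * star (discardAmp s) =
      if s.1 = zeroBits ℓ then 1 / 2 else 0 := fun s => by
    unfold discardAmp
    split_ifs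
    · rw [star_div₀, star_boolSign, Complex.star_def, Complex.conj_ofReal, div_mul_div_comm,
        boolSign_mul_self, sqrt_two_mul_self]
    · simp
  simp only [h, Fintype.sum_prod_type]
  simp

theorem sum_smul_conj {m n S : Type*} [Fintype n] [Fintype S] {c : S → ℂ}
    (hc : ∑ s, c s * star (c s) = 1) (K : Matrix m n ℂ) (ρ : Matrix n n ℂ) :
    ∑ s, (c s • K) * ρ * (c s • K)ᴴ = K * ρ * Kᴴ := by
  simp only [Matrix.conjTranspose_smul, Matrix.smul_mul, Matrix.mul_smul, smul_smul,
    ← Finset.sum_smul]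
  simp only [mul_comm (star _), hc, one_smul]

theorem constructionOracle_apply {d ℓ n : ℕ} (f : Bits d → Bits ℓ) (g : Bits ℓ → Bits n → Bits 1)
    (ρ : Op d) : (constructionOracle f g).apply ρ =
      (stateOracle (signState (constructionSign f g))).kraus () * ρ *
        ((stateOracle (signState (constructionSign f g))).kraus ())ᴴ := by
  refine Eq.trans ?_ (sum_smul_conj (sum_discardAmp ℓ) _ ρ)
  exact Finset.sum_congr rfl fun s _ =>
    congrArg (fun K => K * ρ * Kᴴ) (constructionOracle_kraus f g s)

theorem liftKraus_smul {a b N : ℕ} (e : Fin a ↪ Fin N) (c : ℂ)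
    (E : Matrix (Bits a × Bits b) (Bits a) ℂ) : liftKraus e (c • E) = c • liftKraus e E := by
  ext u v
  simp [liftKraus]

theorem constructionOracle_applyAt {d ℓ n N : ℕ} (f : Bits d → Bits ℓ)
    (g : Bits ℓ → Bits n → Bits 1) (e : Fin d ↪ Fin N) (ρ : Op N) :
    (constructionOracle f g).applyAt e ρ =
      (stateOracle (signState (constructionSign f g))).applyAt e ρ := by
  rw [applyAt_stateOracle, ← liftKraus_stateOracle _ e ()]
  refine Eq.trans ?_ (sum_smul_conj (sum_discardAmp ℓ) _ ρ)
  exact Finset.sum_congr rfl fun s _ => congrArg (fun K => K * ρ * Kᴴ)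
    ((congrArg (liftKraus e) (constructionOracle_kraus f g s)).trans (liftKraus_smul _ _ _))

theorem accept_congr {a b N : ℕ} {O O' : QOracle a b}
    (h : ∀ {N : ℕ} (e : Fin a ↪ Fin N) (ρ : Op N), O.applyAt e ρ = O'.applyAt e ρ)
    (C : OracleCircuit a b N) (ρ : Op N) : C.accept O ρ = C.accept O' ρ := by
  induction C with
  | measure i => rfl
  | gate g C ih => exact ih _
  | query e C ih => rw [OracleCircuit.accept, OracleCircuit.accept, h, ih]

theorem prob_constructionOracle {d ℓ n : ℕ} (f : Bits d → Bits ℓ) (g : Bits ℓ → Bits n → Bits 1)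
    (A : Adversary d n) :
    A.prob (constructionOracle f g) = A.prob (stateOracle (signState (constructionSign f g))) :=
  accept_congr (constructionOracle_applyAt f g) _ _

theorem isControlled_constructionOracle {d ℓ n : ℕ} (f : Bits d → Bits ℓ)
    (g : Bits ℓ → Bits n → Bits 1) : (constructionOracle f g).IsControlled := by
  intro s u x hux
  refine (congrFun (congrFun (constructionOracle_kraus f g s) u) x).trans ?_
  simp [stateOracle, hux]

/-! ### Circuits for the generator -/

/-- All qubits off `e` are in the fixed basis state b, hence unentangled, and tracing them out loses
nothing. -/
theorem reduce_mapMat_conj {N m : ℕ} (e : Fin m ↪ Fin N) (b : Bits N) (σ : Op m) :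
    reduce e (mapMat (fun u : Bits m => Function.extend e u b) * σ *
      (mapMat fun u : Bits m => Function.extend e u b)ᴴ) = σ := by
  set φ : Bits m → Bits N := fun u => Function.extend e u b with hφ
  have hc : ∀ u, φ u ∘ e = u := fun u => funext fun i => e.injective.extend_apply _ _ _
  have hi : Function.Injective φ := fun u v h => by rw [← hc u, h, hc]
  have ho : ∀ u v, AgreeOff (Set.range e) (φ u) (φ v) := fun u v j hj => by
    rw [hφ]
    exact (Function.extend_apply' _ _ _ hj).trans (Function.extend_apply' _ _ _ hj).symm
  ext u v
  simp only [reduce, Matrix.of_apply]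
  rw [Finset.sum_eq_single (φ u), Finset.sum_eq_single (φ v)]
  · rw [if_pos ⟨hc u, hc v, ho u v⟩, mapMat_conj_apply hi]
  · intro w _ hw
    split_ifs with h
    · refine mapMat_conj_apply_right _ _ ?_
      rintro ⟨v', rfl⟩
      exact hw (congrArg φ ((hc v').symm.trans h.2.1))
    · rfl
  · intro h
    exact absurd (Finset.mem_univ _) h
  · intro w _ hw
    refine Finset.sum_eq_zero fun w' _ => ?_
    split_ifs with h
    · refine mapMat_conj_apply_left _ ?_ _
      rintro ⟨u', rfl⟩
      exact hw (congrArg φ ((hc u').symm.trans h.1))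
    · rfl
  · intro h
    exact absurd (Finset.mem_univ _) h

theorem tensor_ketbra_left {κ d : ℕ} (k : Bits κ) (ρ : Op d) :
    tensor (ketbra k) ρ = mapMat (fun x : Bits d => (Fin.append k x : Bits (κ + d))) * ρ *
      (mapMat fun x : Bits d => (Fin.append k x : Bits (κ + d)))ᴴ := by
  set φ : Bits d → Bits (κ + d) := fun x => Fin.append k x with hφ
  have hi : Function.Injective φ := fun x x' h => by
    rw [← sndBits_append k x, ← sndBits_append k x']
    exact congrArg sndBits h
  have hr : ∀ w, fstBits w = k → w = φ (sndBits w) := fun w hw => by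
    rw [hφ, ← hw]
    exact (append_fstBits_sndBits w).symm
  have hs : ∀ w, fstBits w ≠ k → w ∉ Set.range φ := by
    rintro _ hw ⟨x, rfl⟩
    exact hw (fstBits_append _ _)
  ext u v
  simp only [tensor, Matrix.of_apply, ketbra_apply]
  by_cases hu : fstBits u = k
  · by_cases hv : fstBits v = k
    · rw [if_pos ⟨hu, hv⟩, one_mul]
      conv_rhs => rw [hr u hu, hr v hv, mapMat_conj_apply hi]
    · rw [if_neg fun h => hv h.2, zero_mul, mapMat_conj_apply_right _ _ (hs v hv)]
  · rw [if_neg fun h => hu h.1, zero_mul, mapMat_conj_apply_left _ (hs u hu)]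

/-- The isometry `|x⟩ ↦ ∑_y ψ_x(y) |x, y⟩`. -/
def stateIso {d n : ℕ} (ψ : Bits d → Bits n → ℂ) : Matrix (Bits (d + n)) (Bits d) ℂ :=
  Matrix.of fun u x => (stateOracle ψ).kraus () (fstBits u, sndBits u) x

theorem stateIso_mulVec_ket {d n : ℕ} (ψ : Bits d → Bits n → ℂ) (x : Bits d) :
    stateIso ψ *ᵥ ket x = ∑ y, ψ x y • ket (Fin.append x y) := by
  have h := stateKraus_mulVec_ket ψ (Function.Embedding.refl _) x
  exact h

/-- The matrix of the gates of a circuit, with the first input register fixed to `k` and the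
ancillas fixed to zero. -/
def GenCircuit.keyedMat {κ d out : ℕ} (C : GenCircuit (κ + d) out) (k : Bits κ) :
    Matrix (Bits (κ + d + C.anc)) (Bits d) ℂ :=
  runGates C.gates * (placeMat (N := κ + d) (Fin.castAddEmb C.anc) *
    mapMat fun x : Bits d => (Fin.append k x : Bits (κ + d)))

theorem GenCircuit.channel_tensor_ketbra {κ d out : ℕ} (C : GenCircuit (κ + d) out) (k : Bits κ)
    (ρ : Op d) :
    C.channel (tensor (ketbra k) ρ) = reduce C.outPos (C.keyedMat k * ρ * (C.keyedMat k)ᴴ) := by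
  rw [GenCircuit.channel, foldl_conj_eq_runGates, tensor_ketbra_left, tensor_ketbra_zero,
    conj_conj, conj_conj, GenCircuit.keyedMat, Matrix.mul_assoc (runGates C.gates)]

/-- The circuit need only realize the same channel, not follow the procedure: Hadamards on the reply
register, then the sign of the Boolean circuit with its ancillas uncomputed. The key register is
never changed, so the discarded qubits are left in a basis state. -/
theorem exists_genCircuit {κ d n : ℕ} (D : BoolCircuit 1 (κ + d + n)) :
    ∃ C : GenCircuit (κ + d) (d + n), C.size ≤ 2 * (κ + d + n) + 100 * (D.gates + n + d + 1) ∧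
      ∀ (k : Bits κ) (ρ : Op d), C.channel (tensor (ketbra k) ρ) =
        stateIso (signState fun w => D.eval (Fin.append (Fin.append k w.1) w.2) 0) * ρ *
          (stateIso (signState fun w => D.eval (Fin.append (Fin.append k w.1) w.2) 0))ᴴ := by
  let N := κ + d + (n + D.gates)
  let kx : Fin (κ + d) ↪ Fin N := Fin.castAddEmb _
  let x : Fin d ↪ Fin N := (Fin.natAddEmb κ).trans kx
  let y : Fin n ↪ Fin N := (Fin.castAddEmb D.gates).trans (Fin.natAddEmb (κ + d))
  let c : Fin D.gates ↪ Fin N := (Fin.natAddEmb n).trans (Fin.natAddEmb (κ + d))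
  have hkxy : ∀ i j, kx i ≠ y j := fun i j h => by
    have := congrArg Fin.val h
    change (i : ℕ) = κ + d + j at this
    omega
  have hkxc : ∀ i j, kx i ≠ c j := fun i j h => by
    have := congrArg Fin.val h
    change (i : ℕ) = κ + d + (n + j) at this
    omega
  have hyc : ∀ i j, y i ≠ c j := fun i j h => by
    have := congrArg Fin.val h
    change κ + d + i = κ + d + (n + j) at this
    omega
  have hxy : ∀ i j, x i ≠ y j := fun i j => hkxy _ j
  obtain ⟨g₁, hg₁, h1⟩ := exists_hadamards y
  have hwires : ∀ z ∈ List.ofFn c, ∀ i,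
      (Fin.append kx y : Fin (κ + d + n) → Fin N) i ≠ z := by
    intro z hz i
    obtain ⟨j, rfl⟩ := (List.mem_ofFn' _ _).1 hz
    refine Fin.addCases (fun k => ?_) (fun k => ?_) i
    · rw [Fin.append_left]; exact hkxc k j
    · rw [Fin.append_right]; exact hyc k j
  obtain ⟨g₂, hg₂, h2⟩ := exists_sign_of_circuit D (Fin.append kx y) (List.ofFn c)
    (List.nodup_ofFn.2 c.injective) hwires (by simp)
  refine ⟨⟨n + D.gates, g₁ ++ g₂, appendEmb x y hxy⟩, ?_, fun k ρ => ?_⟩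
  · simp only [GenCircuit.size, List.length_append]
    omega
  · set ψ : Bits d → Bits n → ℂ :=
      signState fun w => D.eval (Fin.append (Fin.append k w.1) w.2) 0 with hψ
    set e : Fin (d + n) ↪ Fin N := appendEmb x y hxy with he
    -- The content of the discarded qubits: the key on its register and zeros on the ancillas. The
    -- entries on the output qubits are overwritten and play no role.
    set b : Bits N := placeBits kx (Fin.append k (zeroBits d)) with hb
    have key : GenCircuit.keyedMat ⟨n + D.gates, g₁ ++ g₂, e⟩ k =
        mapMat (fun u : Bits (d + n) => (Function.extend e u b : Bits N)) * stateIso ψ := by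
      refine matrix_ext_ket fun z => ?_
      rw [GenCircuit.keyedMat, runGates_append]
      simp only [← Matrix.mulVec_mulVec]
      set v : Bits N := placeBits kx (Fin.append k z) with hv
      have hvy : ∀ j, v (y j) = false := fun j => placeBits_of_notMem kx _ fun i => hkxy i j
      rw [mapMat_mulVec_ket, placeMat_mulVec_ket, ← hv, h1 _ hvy, stateIso_mulVec_ket]
      simp only [Matrix.mulVec_smul, Matrix.mulVec_sum, mapMat_mulVec_ket]
      rw [Finset.smul_sum]
      refine Finset.sum_congr rfl fun s _ => ?_
      set u : Bits N := Function.extend y s v with hu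
      have huy : ∀ i, u (y i) = s i := fun i => y.injective.extend_apply _ _ _
      have hun : ∀ j, (∀ i, y i ≠ j) → u j = v j := fun j hj =>
        Function.extend_apply' _ _ _ fun ⟨i, hi⟩ => hj i hi
      rw [h2]
      · have hw : (fun i => u ((Fin.append kx y : Fin (κ + d + n) → Fin N) i)) =
            (Fin.append (Fin.append k z) s : Bits (κ + d + n)) := by
          funext i
          refine Fin.addCases (fun i => ?_) (fun i => ?_) i
          · rw [Fin.append_left, Fin.append_left, hun _ fun j => (hkxy i j).symm, hv,
              placeBits_apply]
          · rw [Fin.append_right, Fin.append_right, huy]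
        have hΩ : u = Function.extend e (Fin.append z s) b := by
          funext j
          by_cases hj : ∃ i, y i = j
          · obtain ⟨i, rfl⟩ := hj
            have : y i = e (Fin.natAdd d i) := (Fin.append_right _ _ i).symm
            rw [huy, this, e.injective.extend_apply, Fin.append_right]
          · rw [hun _ fun i hi => hj ⟨i, hi⟩]
            by_cases hx : ∃ i, x i = j
            · obtain ⟨i, rfl⟩ := hx
              have h3 : x i = e (Fin.castAdd n i) := (Fin.append_left _ _ i).symm
              have h4 : x i = kx (Fin.natAdd κ i) := rfl
              rw [h4, hv, placeBits_apply, ← h4, h3, e.injective.extend_apply, Fin.append_left,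
                Fin.append_right]
            · rw [Function.extend_apply']
              · by_cases hk : ∃ i, kx i = j
                · obtain ⟨i, rfl⟩ := hk
                  rw [hv, hb, placeBits_apply, placeBits_apply]
                  revert hx
                  refine Fin.addCases (fun i _ => ?_) (fun i hx => absurd ⟨i, rfl⟩ hx) i
                  rw [Fin.append_left, Fin.append_left]
                · rw [hv, hb, placeBits_of_notMem _ _ fun i hi => hk ⟨i, hi⟩,
                    placeBits_of_notMem _ _ fun i hi => hk ⟨i, hi⟩]
              · rintro ⟨i, hi⟩
                revert hi
                refine Fin.addCases (fun i hi => hx ⟨i, ?_⟩) (fun i hi => hj ⟨i, ?_⟩) i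
                · rw [← hi]; exact (Fin.append_left _ _ i).symm
                · rw [← hi]; exact (Fin.append_right _ _ i).symm
        rw [hw, hΩ, smul_smul, mul_comm]
        rfl
      · intro a ha
        obtain ⟨j, rfl⟩ := (List.mem_ofFn' _ _).1 ha
        rw [hun _ fun i => hyc i j, hv]
        exact placeBits_of_notMem kx _ fun i => hkxc i j
    rw [GenCircuit.channel_tensor_ketbra]
    rw [key, ← conj_conj, reduce_mapMat_conj]

theorem exists_genCircuit_construction {κ d ℓ n : ℕ} {F₁ : Bits κ → Bits d → Bits ℓ}
    {F₂ : Bits ℓ → Bits n → Bits 1} {s₁ s₂ : ℕ}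
    (hF₁ : Computes s₁ fun w : Bits (κ + d) => F₁ (fstBits w) (sndBits w))
    (hF₂ : Computes s₂ fun w : Bits (ℓ + n) => F₂ (fstBits w) (sndBits w)) :
    ∃ C : GenCircuit (κ + d) (d + n),
      C.size ≤ 2 * (κ + d + n) + 100 * (s₁ + s₂ + n + d + 1) ∧
      ∀ (k : Bits κ) (ρ : Op d) (u v : Bits (d + n)), C.channel (tensor (ketbra k) ρ) u v =
        (constructionOracle (F₁ k) F₂).apply ρ (fstBits u, sndBits u) (fstBits v, sndBits v) := by
  have h : Computes (s₁ + s₂) fun w : Bits (κ + d + n) =>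
      F₂ (F₁ (fstBits (fstBits w)) (sndBits (fstBits w))) (sndBits w) := by
    have hkx : Computes 0 fun w : Bits (κ + d + n) => fstBits w :=
      computes_select fun i => Fin.castAdd n i
    have hy : Computes 0 fun w : Bits (κ + d + n) => sndBits w :=
      computes_select fun i => Fin.natAdd (κ + d) i
    have h := hF₂.comp ((hF₁.comp hkx).append hy)
    simp only [fstBits_append, sndBits_append] at h
    exact h.mono (by omega)
  obtain ⟨D, hD, hDF⟩ := h
  obtain ⟨C, hC, hch⟩ := exists_genCircuit D
  refine ⟨C, hC.trans (by omega), fun k ρ u v => ?_⟩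
  rw [hch, constructionOracle_apply]
  have hs : (fun w : Record d n => D.eval (Fin.append (Fin.append k w.1) w.2) 0) =
      constructionSign (F₁ k) F₂ := by
    funext w
    rw [hDF]
    simp only [fstBits_append, sndBits_append]
    rfl
  rw [hs]
  rfl

/-! ### Polynomial growth and negligible functions -/

theorem PolyBounded.mono {s t : ℕ → ℕ} (ht : PolyBounded t) (h : ∀ lam, s lam ≤ t lam) :
    PolyBounded s := by
  obtain ⟨p, hp⟩ := ht
  exact ⟨p, fun lam => (h lam).trans (hp lam)⟩

theorem PolyBounded.const (c : ℕ) : PolyBounded fun _ => c :=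
  ⟨Polynomial.C c, fun lam => by simp⟩

theorem PolyBounded.add {s t : ℕ → ℕ} (hs : PolyBounded s) (ht : PolyBounded t) :
    PolyBounded fun lam => s lam + t lam := by
  obtain ⟨p, hp⟩ := hs
  obtain ⟨q, hq⟩ := ht
  exact ⟨p + q, fun lam => by
    rw [Polynomial.eval_add]
    exact add_le_add (hp lam) (hq lam)⟩

theorem PolyBounded.mul {s t : ℕ → ℕ} (hs : PolyBounded s) (ht : PolyBounded t) :
    PolyBounded fun lam => s lam * t lam := by
  obtain ⟨p, hp⟩ := hs
  obtain ⟨q, hq⟩ := ht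
  exact ⟨p * q, fun lam => by
    rw [Polynomial.eval_mul]
    exact Nat.mul_le_mul (hp lam) (hq lam)⟩

theorem PolyBounded.pow {s : ℕ → ℕ} (hs : PolyBounded s) (k : ℕ) :
    PolyBounded fun lam => s lam ^ k := by
  induction k with
  | zero => simpa using PolyBounded.const 1
  | succ k ih => simpa only [pow_succ] using ih.mul hs

theorem PolyBounded.hashGates {a v k : ℕ → ℕ} (ha : PolyBounded a) (hv : PolyBounded v)
    (hk : PolyBounded k) : PolyBounded fun lam => hashGates (a lam) (v lam) (k lam) :=
  (hk.add (.const 1)).mul ((PolyBounded.const 20).mul (((ha.add hv).add (.const 1)).pow 3))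

theorem PolyBounded.stepGates {d ℓ n k s : ℕ → ℕ} (hd : PolyBounded d) (hℓ : PolyBounded ℓ)
    (hn : PolyBounded n) (hk : PolyBounded k) (hs : PolyBounded s) :
    PolyBounded fun lam => stepGates (d lam) (ℓ lam) (n lam) (k lam) (s lam) :=
  ((((PolyBounded.const 14).mul hd).add (.const 20)).add
    (PolyBounded.hashGates (hd.add hn) (.const 1) hk)).add (PolyBounded.hashGates hd hℓ hk) |>.add hs

theorem Negligible.of_le {f g : ℕ → ℝ} (hf : Negligible f) (h0 : ∀ lam, 0 ≤ g lam)
    (h : ∀ᶠ lam in atTop, g lam ≤ f lam) : Negligible g := by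
  refine Asymptotics.SuperpolynomialDecay.trans_eventually_abs_le hf ?_
  filter_upwards [h] with lam hlam
  simp only [Function.comp_apply]
  rw [abs_of_nonneg (h0 lam)]
  exact hlam.trans (le_abs_self _)

theorem Negligible.polyBounded_mul {f : ℕ → ℝ} {q : ℕ → ℕ} (hf : Negligible f)
    (h0 : ∀ lam, 0 ≤ f lam) (hq : PolyBounded q) : Negligible fun lam => (q lam : ℝ) * f lam := by
  obtain ⟨p, hp⟩ := hq
  have h := Asymptotics.SuperpolynomialDecay.polynomial_mul hf (p.map (Nat.castRingHom ℝ))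
  refine Negligible.of_le h (fun lam => mul_nonneg (Nat.cast_nonneg _) (h0 lam)) ?_
  refine Eventually.of_forall fun lam => ?_
  rw [Polynomial.eval_natCast_map]
  exact mul_le_mul_of_nonneg_right ((Nat.cast_le (α := ℝ)).2 (hp lam)) (h0 lam)

/-- One has λ^c 2^{-g} = exp(log λ · (c - log 2 · g / log λ)), and the second factor in the exponent
tends to -∞. -/
theorem negligible_two_rpow_neg {g : ℕ → ℝ}
    (hg : Tendsto (fun lam : ℕ => g lam / Real.log lam) atTop atTop) :
    Negligible fun lam => (2 : ℝ) ^ (-g lam) := by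
  intro c
  have hlog : Tendsto (fun lam : ℕ => Real.log (lam : ℝ)) atTop atTop :=
    Real.tendsto_log_atTop.comp tendsto_natCast_atTop_atTop
  have h1 : Tendsto (fun lam : ℕ => (c : ℝ) - Real.log 2 * (g lam / Real.log lam)) atTop atBot := by
    have h := tendsto_neg_atTop_atBot.comp (hg.const_mul_atTop (Real.log_pos one_lt_two))
    exact tendsto_atBot_add_const_left _ (c : ℝ) h
  refine (Real.tendsto_exp_atBot.comp (hlog.atTop_mul_atBot₀ h1)).congr' ?_
  filter_upwards [eventually_ge_atTop 2] with lam hlam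
  have hl : (1 : ℝ) < lam := by exact_mod_cast hlam
  have hl0 : (0 : ℝ) < lam := by linarith
  have hlog0 : Real.log (lam : ℝ) ≠ 0 := (Real.log_pos hl).ne'
  simp only [Function.comp_apply]
  rw [Real.rpow_def_of_pos two_pos, ← Real.rpow_natCast, Real.rpow_def_of_pos hl0, ← Real.exp_add]
  congr 1
  field_simp
  ring

theorem tendsto_rpow_sub_rpow_div_log {γ δ : ℝ} (hγ : 0 < γ) (hδ : γ < δ) :
    Tendsto (fun lam : ℕ => ((lam : ℝ) ^ δ - (lam : ℝ) ^ γ) / Real.log lam) atTop atTop := by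
  have h1 : Tendsto (fun x : ℝ => x ^ γ / Real.log x) atTop atTop := by
    have h := (isLittleO_log_rpow_atTop hγ).tendsto_div_nhds_zero
    have h' : Tendsto (fun x : ℝ => Real.log x / x ^ γ) atTop (nhdsWithin 0 (Set.Ioi 0)) := by
      refine tendsto_nhdsWithin_iff.2 ⟨h, ?_⟩
      filter_upwards [eventually_gt_atTop 1] with x hx
      exact div_pos (Real.log_pos hx) (Real.rpow_pos_of_pos (by linarith) _)
    refine h'.inv_tendsto_nhdsGT_zero.congr fun x => ?_
    simp
  have h2 : Tendsto (fun x : ℝ => x ^ (δ - γ)) atTop atTop := tendsto_rpow_atTop (by linarith)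
  have h3 : Tendsto (fun x : ℝ => (x ^ δ - x ^ γ) / Real.log x) atTop atTop := by
    refine tendsto_atTop_mono' _ ?_ h1
    -- Once x^(δ-γ) ≥ 2, the difference x^δ - x^γ is at least x^γ, which already outgrows the
    -- logarithm.
    filter_upwards [eventually_gt_atTop 1, h2.eventually_ge_atTop 2] with x hx hx2
    have hx0 : 0 < x := by linarith
    have e : x ^ δ = x ^ γ * x ^ (δ - γ) := by
      rw [← Real.rpow_add hx0]
      congr 1
      ring
    have hp : 0 < x ^ γ := Real.rpow_pos_of_pos hx0 _
    refine div_le_div_of_nonneg_right ?_ (Real.log_pos hx).le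
    rw [e]
    nlinarith
  exact h3.comp tendsto_natCast_atTop_atTop

/-! ### Security of the construction -/

theorem queries_le_adversary_size {a b : ℕ} (A : Adversary a b) : A.queries ≤ A.size :=
  (queries_le_size A.circ).trans (by unfold Adversary.size; omega)

/-- The concrete security of the construction. -/
theorem exists_adversaries {κ d ℓ n s : ℕ} (F₁ : Bits κ → Bits d → Bits ℓ)
    {F₂ : Bits ℓ → Bits n → Bits 1}
    (hF₂ : Computes s fun w : Bits (ℓ + n) => F₂ (fstBits w) (sndBits w)) (A : Adversary d n) :
    ∃ (B₁ : Adversary (d + ℓ) 0) (B₂ : Adversary (n + 1) 0),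
      B₁.size ≤ (A.size + 1) * (2 * n + ℓ + 83 * s + 7) ∧
      B₂.size ≤ (A.size + 1) * (2 * n + 1 + 83 * stepGates d ℓ n (2 * A.queries) s + 7) ∧
      prfsAdvantage (fun k => constructionOracle (F₁ k) F₂) A ≤
        prfAdvantage F₁ B₁ + 2 ^ d * prfAdvantage F₂ B₂ +
          2 * (A.queries / (2 : ℝ) ^ ((n : ℝ) / 2)) := by
  obtain ⟨B₁, hB₁, h1⟩ := exists_adversary_first F₁ hF₂ A
  obtain ⟨B₂, hB₂, h2⟩ := exists_adversary_second hF₂ A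
  refine ⟨B₁, B₂, hB₁, hB₂, ?_⟩
  have h3 := signState_haar_close A
  simp only [prfsAdvantage, prob_constructionOracle]
  rw [← h1]
  refine (abs_sub_le _ (𝔼 f : Bits d → Bits ℓ,
    A.prob (stateOracle (signState fun w => F₂ (f w.1) w.2 0))) _).trans ?_
  rw [add_assoc]
  refine add_le_add le_rfl ?_
  exact (abs_sub_le _ _ _).trans (add_le_add h2 h3)

theorem computes_circuits {a b : ℕ → ℕ} {F : ∀ lam, Bits (a lam) → Bits (b lam)}
    (hF : PolyComputable F) :
    ∃ s : ℕ → ℕ, PolyBounded (fun lam => s lam + a lam + b lam) ∧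
      ∀ lam, Computes (s lam) (F lam) := by
  obtain ⟨C, hC, hCF⟩ := hF
  exact ⟨fun lam => (C lam).gates, hC, fun lam => ⟨C lam, le_rfl, hCF lam⟩⟩

theorem isQPTGenerator_construction {d ℓ n : ℕ → ℕ}
    {F₁ : ∀ lam, Bits lam → Bits (d lam) → Bits (ℓ lam)}
    {F₂ : ∀ lam, Bits (ℓ lam) → Bits (n lam) → Bits 1}
    (hF₁ : PolyComputable (a := fun lam => lam + d lam) (b := ℓ)
      fun lam w => F₁ lam (fstBits w) (sndBits w))
    (hF₂ : PolyComputable (a := fun lam => ℓ lam + n lam) (b := fun _ => 1)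
      fun lam w => F₂ lam (fstBits w) (sndBits w)) :
    IsQPTGenerator (κ := fun lam => lam) (construction F₁ F₂) := by
  obtain ⟨s₁, hs₁, h₁⟩ := computes_circuits hF₁
  obtain ⟨s₂, hs₂, h₂⟩ := computes_circuits hF₂
  choose C hC hch using fun lam => exists_genCircuit_construction (h₁ lam) (h₂ lam)
  refine ⟨C, ?_, hch⟩
  refine (((PolyBounded.const 102).mul (hs₁.add hs₂)).add (.const 100)).mono fun lam => ?_
  refine (hC lam).trans ?_
  omega

theorem eventually_prfsAdvantage_le {d ℓ n : ℕ → ℕ} {ν ε : ℕ → ℝ}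
    {F₁ : ∀ lam, Bits lam → Bits (d lam) → Bits (ℓ lam)}
    {F₂ : ∀ lam, Bits (ℓ lam) → Bits (n lam) → Bits 1}
    (hF₁ : IsQPRF (κ := fun lam => lam) F₁ ν) (hF₂ : IsQPRF (n := fun _ => 1) F₂ ε)
    {A : ∀ lam, Adversary (d lam) (n lam)} (hA : IsQPT A) :
    ∀ᶠ lam in atTop, prfsAdvantage (construction F₁ F₂ lam) (A lam) ≤
      ν lam + 2 ^ d lam * ε lam + 2 * ((A lam).queries / (2 : ℝ) ^ ((n lam : ℝ) / 2)) := by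
  obtain ⟨s₁, hs₁, -⟩ := computes_circuits hF₁.1
  obtain ⟨s₂, hs₂, h₂⟩ := computes_circuits hF₂.1
  choose B₁ B₂ hB₁ hB₂ h using fun lam => exists_adversaries (F₁ lam) (h₂ lam) (A lam)
  -- The size in `PolyComputable` counts inputs and outputs, so efficient computability of F₁ and F₂
  -- bounds d, ℓ and n polynomially.
  have hd : PolyBounded d := hs₁.mono fun lam => by omega
  have hℓ : PolyBounded ℓ := hs₁.mono fun lam => by omega
  have hn : PolyBounded n := hs₂.mono fun lam => by omega
  have hs : PolyBounded s₂ := hs₂.mono fun lam => by omega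
  have hA' : PolyBounded fun lam => (A lam).size := hA
  have hq : PolyBounded fun lam => 2 * (A lam).queries :=
    (PolyBounded.const 2).mul (hA'.mono fun lam => queries_le_adversary_size _)
  have hQ₁ : IsQPT (a := fun lam => d lam + ℓ lam) (b := fun _ => 0) B₁ :=
    ((hA'.add (.const 1)).mul ((((PolyBounded.const 2).mul hn).add hℓ).add
      ((PolyBounded.const 83).mul hs) |>.add (.const 7))).mono hB₁
  have hQ₂ : IsQPT (a := fun lam => n lam + 1) (b := fun _ => 0) B₂ :=
    ((hA'.add (.const 1)).mul ((((PolyBounded.const 2).mul hn).add (.const 1)).add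
      ((PolyBounded.const 83).mul (PolyBounded.stepGates hd hℓ hn hq hs)) |>.add (.const 7))).mono hB₂
  filter_upwards [hF₁.2 B₁ hQ₁, hF₂.2 B₂ hQ₂] with lam h1 h2
  exact (h lam).trans (add_le_add (add_le_add h1 (mul_le_mul_of_nonneg_left h2 (by positivity)))
    le_rfl)

end

end QAPRFS

/-! ### The asymptotic statement -/

theorem mainTheorem6 :
    ∃ C : ℝ, 0 < C ∧
      ∀ (γ δ : ℝ) (d ℓ n : ℕ → ℕ) (ν : ℕ → ℝ)
        (F₁ : ∀ lam : ℕ, QAPRFS.Bits lam → QAPRFS.Bits (d lam) → QAPRFS.Bits (ℓ lam))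
        (F₂ : ∀ lam : ℕ, QAPRFS.Bits (ℓ lam) → QAPRFS.Bits (n lam) → QAPRFS.Bits 1),
        0 < γ → γ < δ → δ < 1 →
        (∀ lam : ℕ, (d lam : ℝ) ≤ (lam : ℝ) ^ γ + 1) →
        Filter.Tendsto (fun lam : ℕ => ((n lam : ℝ) / 2 - (d lam : ℝ)) / Real.log (lam : ℝ))
          Filter.atTop Filter.atTop →
        QAPRFS.Negligible ν →
        QAPRFS.IsQPRF (κ := fun lam => lam) F₁ ν →
        QAPRFS.IsQPRF (n := fun _ => 1) F₂ (fun lam => 1 / (2 : ℝ) ^ ((lam : ℝ) ^ δ)) →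
        QAPRFS.IsQAPRFS (QAPRFS.construction F₁ F₂) ∧
        ∀ A : ∀ lam : ℕ, QAPRFS.Adversary (d lam) (n lam), QAPRFS.IsQPT A →
          ∀ᶠ lam : ℕ in Filter.atTop,
            QAPRFS.prfsAdvantage (QAPRFS.construction F₁ F₂ lam) (A lam) ≤
              ν lam + (2 : ℝ) ^ (d lam) / (2 : ℝ) ^ ((lam : ℝ) ^ δ) +
                C * (((A lam).queries : ℝ) * (2 : ℝ) ^ (d lam) / (2 : ℝ) ^ ((n lam : ℝ) / 2)) := by
  -- The constant 2 is that of `signState_haar_close`.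
  refine ⟨2, two_pos, ?_⟩
  intro γ δ d ℓ n ν F₁ F₂ hγ hγδ _ hd hn hν hF₁ hF₂
  have bound : ∀ A : ∀ lam : ℕ, QAPRFS.Adversary (d lam) (n lam), QAPRFS.IsQPT A →
      ∀ᶠ lam : ℕ in Filter.atTop,
        QAPRFS.prfsAdvantage (QAPRFS.construction F₁ F₂ lam) (A lam) ≤
          ν lam + (2 : ℝ) ^ (d lam) / (2 : ℝ) ^ ((lam : ℝ) ^ δ) +
            2 * (((A lam).queries : ℝ) * (2 : ℝ) ^ (d lam) / (2 : ℝ) ^ ((n lam : ℝ) / 2)) := by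
    intro A hA
    filter_upwards [QAPRFS.eventually_prfsAdvantage_le hF₁ hF₂ hA] with lam h
    refine h.trans (add_le_add (add_le_add le_rfl (by rw [mul_one_div])) ?_)
    refine mul_le_mul_of_nonneg_left ?_ two_pos.le
    refine div_le_div_of_nonneg_right ?_ (by positivity)
    -- The bound already proved lacks the factor 2^d in the last term; it is inserted because 1 ≤
    -- 2^d.
    exact le_mul_of_one_le_right (Nat.cast_nonneg _) (one_le_pow₀ one_le_two)
  refine ⟨⟨QAPRFS.isQPTGenerator_construction hF₁.1 hF₂.1,
    fun lam k => QAPRFS.isControlled_constructionOracle _ _, fun A hA => ?_⟩, bound⟩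
  refine ⟨fun lam => QAPRFS.prfsAdvantage (QAPRFS.construction F₁ F₂ lam) (A lam), ?_,
    fun lam => le_rfl⟩
  have hq : QAPRFS.PolyBounded fun lam => 2 * (A lam).queries :=
    (QAPRFS.PolyBounded.const 2).mul (QAPRFS.PolyBounded.mono (t := fun lam => (A lam).size) hA
      fun lam => QAPRFS.queries_le_adversary_size _)
  -- The factor 2 absorbs the + 1 in d ≤ λ^γ + 1, so that 2^d / 2^(λ^δ) is at most twice 2^(-(λ^δ -
  -- λ^γ)).
  have h2 := QAPRFS.Negligible.polyBounded_mul
    (QAPRFS.negligible_two_rpow_neg (QAPRFS.tendsto_rpow_sub_rpow_div_log hγ hγδ))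
    (fun lam => by positivity) (QAPRFS.PolyBounded.const 2)
  -- The last term is 2q · 2^(-(n/2 - d)), a polynomial factor times a negligible function because
  -- n/2 - d outgrows the logarithm.
  have h3 := QAPRFS.Negligible.polyBounded_mul (QAPRFS.negligible_two_rpow_neg hn)
    (fun lam => by positivity) hq
  refine QAPRFS.Negligible.of_le ((hν.add h2).add h3) (fun lam => abs_nonneg _) ?_
  filter_upwards [bound A hA] with lam h
  refine h.trans (add_le_add (add_le_add le_rfl ?_) (le_of_eq ?_))
  · beta_reduce
    rw [Real.rpow_neg two_pos.le, Real.rpow_sub two_pos, inv_div]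
    push_cast
    rw [← mul_div_assoc]
    refine div_le_div_of_nonneg_right ?_ (by positivity)
    have h := Real.rpow_le_rpow_of_exponent_le one_le_two (hd lam)
    rw [Real.rpow_natCast, Real.rpow_add two_pos, Real.rpow_one] at h
    linarith
  · beta_reduce
    rw [Real.rpow_neg two_pos.le, Real.rpow_sub two_pos, inv_div, Real.rpow_natCast]
    push_cast
    ring
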